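/- Let $m\ge 0$ and let $\mathcal H_m=L^2(\mathbb R^m)$ be the Hilbert space of $m$ Bosonic modes with canonical operators $\hat x_j$ (multiplication by the $j$-th coordinate) and $\hat p_j=-i\partial_j$. For $(x,p)\in\mathbb R^m\times\mathbb R^m$ put $\alpha_j=\frac{1}{\sqrt2}(x_j+ip_j)$, let $D(\alpha)=\exp\sum_j(\alpha_ja_j^\dagger-\overline{\alpha_j}a_j)$ with annihilation operators $a_j=\frac{1}{\sqrt2}(\hat x_j+i\hat p_j)$ be the displacement operator, and let $(-1)^{N_1+\cdots+N_m}$, $N_j=a_j^\dagger a_j$, be the parity operator. The Wigner function of a trace class operator $\rho$ is $$W_\rho(x,p)=\pi^{-m}\operatorname{tr}\,\rho\,D(\alpha)(-1)^{N_1+\cdots+N_m}D(\alpha)^\dagger ;$$ for a bounded operator $M$, $W_M$ is the tempered distribution given by the same formula, integrated against a Schwartz function before taking the trace. For a set $\mathbb M$ of binary POVMs $(M,\mathbb 1-M)$ with $0\le M\le\mathbb 1$ on $\mathcal H_m$, and states $\rho_0,\rho_1$ (positive operators of trace one), define $\|\rho_0-\rho_1\|_{\mathbb M}$ by $$\inf_{(M,\mathbb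 1-M)\in\mathbb M}\Bigl(\tfrac12\operatorname{tr}\rho_0(\mathbb 1-M)+\tfrac12\operatorname{tr}\rho_1M\Bigr)=\tfrac12\Bigl(1-\tfrac12\|\rho_0-\rho_1\|_{\mathbb M}\Bigr).$$ Let $\mathrm{W}{+}$ be the set of binary POVMs $(M,\mathbb 1-M)$ such that $W_M$ and $W_{\mathbb 1-M}$ are non-negative. Let $\mathrm{GOCC}$ be the set of binary POVMs $(M,\mathbb 1-M)$ that are implemented by a GOCC protocol, or are limits of such POVMs in the strong operator topology. A GOCC protocol has a finite number $R$ of rounds. In each round one adds some number of modes in the vacuum state, performs a Gaussian unitary on all present modes (a unitary transforming the canonical variables by an affine linear map), and performs homodyne detection (a measurement of the $\hat x_j$) on some number of the last modes, keeping the others; the numbers and the unitary may depend measurably on all previous outcomes. In the $R$-th round all remaining modes are measured, and the final outcome in $\{0,1\}$ is a measurable function of all outcomes. Then for any two states $\rho_0,\rho_1$ of an $m$-mode system with Wigner functions $W_0,W_1$, $$\|\rho_0-\rho_1\|_{\mathrm{GOCC}}\le\|\rho_0-\rho_1\|_{\mathrm{W}+}\le\|W_0-W_1\|_{L^1}=\int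 \mathrm d^mx\,\mathrm d^mp\,|W_0(x,p)-W_1(x,p)|,$$ where the right-hand side is $+\infty$ if $W_0-W_1$ is not integrable. -/

import Mathlib

open MeasureTheory

noncomputable section

namespace Bosonic

/-! ### Hilbert space and phase space of `m` modes -/

/-- The Hilbert space of `m` Bosonic modes in the Schrödinger representation, `L²(ℝᵐ)`; the
position operator `x_j` is multiplication by the `j`-th coordinate and `p_j = -i ∂_j`. -/
abbrev H (m : ℕ) : Type := Lp ℂ 2 (volume : Measure (Fin m → ℝ))

/-- Phase space `ℝᵐ × ℝᵐ`, with points `(x, p)`. -/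
abbrev Phase (m : ℕ) : Type := (Fin m → ℝ) × (Fin m → ℝ)

/-- A Hilbert basis of `L²(ℝᵐ)`. Everything computed from it below is a trace of a trace class
operator, hence does not depend on which basis it is. -/
def basisIndex (m : ℕ) : Set (H m) := (exists_hilbertBasis ℂ (H m)).choose

/-- See `basisIndex`. -/
def basis (m : ℕ) : HilbertBasis (basisIndex m) ℂ (H m) :=
  (exists_hilbertBasis ℂ (H m)).choose_spec.choose

/-- The trace of a (trace class) operator. -/
def trace {m : ℕ} (T : H m →L[ℂ] H m) : ℂ :=
  ∑' i, inner ℂ (basis m i) (T (basis m i))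

/-- States (density operators): positive operators, trace class with trace one. -/
structure IsState {m : ℕ} (ρ : H m →L[ℂ] H m) : Prop where
  pos : ρ.IsPositive
  hasSum_one : HasSum (fun i => inner ℂ (basis m i) (ρ (basis m i))) 1

/-! ### Displacements and parity -/

theorem memLp_mul_of_norm_one {m : ℕ} {u : (Fin m → ℝ) → ℂ} (hu : Continuous u)
    (h1 : ∀ q, ‖u q‖ = 1) (f : H m) :
    MemLp (fun q => u q * f q) 2 volume :=
  (Lp.memLp f).congr_norm
    (hu.aestronglyMeasurable.mul (Lp.aestronglyMeasurable f))
    (Filter.Eventually.of_forall fun q => by simp [h1 q])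

/-- Multiplication by a continuous function of modulus one. -/
def phaseMul {m : ℕ} (u : (Fin m → ℝ) → ℂ) (hu : Continuous u) (h1 : ∀ q, ‖u q‖ = 1) :
    H m →L[ℂ] H m :=
  LinearMap.mkContinuous
    { toFun := fun f => (memLp_mul_of_norm_one hu h1 f).toLp _
      map_add' := fun f g => by
        rw [← MemLp.toLp_add, MemLp.toLp_eq_toLp_iff]
        filter_upwards [Lp.coeFn_add f g] with q hq
        change u q * (f + g : H m) q = u q * f q + u q * g q
        rw [hq, Pi.add_apply, mul_add]
      map_smul' := fun c f => by
        rw [RingHom.id_apply, ← MemLp.toLp_const_smul, MemLp.toLp_eq_toLp_iff]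
        filter_upwards [Lp.coeFn_smul c f] with q hq
        change u q * (c • f : H m) q = c • (u q * f q)
        rw [hq, Pi.smul_apply, mul_smul_comm] } 1
    (fun f => by
      change ‖(memLp_mul_of_norm_one hu h1 f).toLp _‖ ≤ 1 * ‖f‖
      rw [one_mul, Lp.norm_toLp, Lp.norm_def]
      refine le_of_eq (congrArg _ (eLpNorm_congr_norm_ae ?_))
      exact Filter.Eventually.of_forall fun q => by rw [norm_mul, h1 q, one_mul])

/-- The phase `q ↦ exp (i p·q - i x·p / 2)`. -/
def dispPhase {m : ℕ} (z : Phase m) (q : Fin m → ℝ) : ℂ :=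
  Complex.exp (((∑ j, z.2 j * q j - (∑ j, z.1 j * z.2 j) / 2 : ℝ) : ℂ) * Complex.I)

theorem continuous_dispPhase {m : ℕ} (z : Phase m) : Continuous (dispPhase z) := by
  unfold dispPhase
  fun_prop

theorem norm_dispPhase {m : ℕ} (z : Phase m) (q : Fin m → ℝ) : ‖dispPhase z q‖ = 1 :=
  Complex.norm_exp_ofReal_mul_I _

/-- The displacement (Weyl) operator
`D(α) = exp (∑ j, (α_j a_j† - conj α_j a_j)) = exp (i ∑ j, (p_j X_j - x_j P_j))`, where `z = (x, p)`
and `α_j = (x_j + i p_j) / √2`. Explicitly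
`(D ψ)(q) = exp (i p·q - i x·p / 2) ψ(q - x)`. -/
def displacement {m : ℕ} (z : Phase m) : H m →L[ℂ] H m :=
  (phaseMul (dispPhase z) (continuous_dispPhase z) (norm_dispPhase z)).comp
    (Lp.compMeasurePreservingₗᵢ ℂ (fun q : Fin m → ℝ => q - z.1)
      (measurePreserving_sub_right volume z.1)).toContinuousLinearMap

/-- The parity operator `(-1)^(N_1 + ... + N_m)`, i.e. `ψ(q) ↦ ψ(-q)`. -/
def parity (m : ℕ) : H m →L[ℂ] H m :=
  (Lp.compMeasurePreservingₗᵢ ℂ (fun q : Fin m → ℝ => -q)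
    (Measure.measurePreserving_neg volume)).toContinuousLinearMap

/-- The phase point operator `π⁻ᵐ D(α) (-1)^(N_1 + ... + N_m) D(α)†`,
`α_j = (x_j + i p_j) / √2`, `z = (x, p)`. -/
def phasePoint {m : ℕ} (z : Phase m) : H m →L[ℂ] H m :=
  (((Real.pi ^ m)⁻¹ : ℝ) : ℂ) •
    (displacement z).comp ((parity m).comp (ContinuousLinearMap.adjoint (displacement z)))

/-! ### Wigner functions -/

/-- The Wigner function
`W_ρ(x, p) = π⁻ᵐ tr (ρ D(α) (-1)^(N_1 + ... + N_m) D(α)†)` of a self-adjoint trace class operator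
(for which the trace is real). -/
def wigner {m : ℕ} (ρ : H m →L[ℂ] H m) (z : Phase m) : ℝ :=
  (trace (ρ.comp (phasePoint z))).re

/-- The Wigner function of a bounded operator `M`, as a tempered distribution: its value
`∫ W_M(z) φ(z) dz = tr (M ∫ φ(z) A_z dz)` at a Schwartz function `φ`, with `A_z` the phase point
operators. (The operator `∫ φ(z) A_z dz` is trace class, while `M A_z` need not be.) -/
def wignerDist {m : ℕ} (M : H m →L[ℂ] H m) (φ : SchwartzMap (Phase m) ℝ) : ℂ :=
  ∑' i, ∫ z : Phase m, (φ z : ℂ) * inner ℂ (basis m i) (M (phasePoint z (basis m i)))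

/-- A self-adjoint bounded operator has a non-negative Wigner function. -/
def WignerNonneg {m : ℕ} (M : H m →L[ℂ] H m) : Prop :=
  ∀ φ : SchwartzMap (Phase m) ℝ, (∀ z, 0 ≤ φ z) → 0 ≤ (wignerDist M φ).re

/-- The set of `M` such that `(M, 1 - M)` is a W+ POVM: a binary POVM both of whose elements have
non-negative Wigner functions. (As `W_M + W_{1 - M} = (2π)⁻ᵐ`, both distributions are then given by
measurable functions with values in `[0, (2π)⁻ᵐ]`.) -/
def wPlus (m : ℕ) : Set (H m →L[ℂ] H m) :=
  {M | M.IsPositive ∧ (1 - M).IsPositive ∧ WignerNonneg M ∧ WignerNonneg (1 - M)}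

/-! ### Joining modes, vacuum, Gaussian unitaries -/

theorem measurePreserving_split (n l : ℕ) :
    MeasurePreserving
      (fun q : Fin (n + l) → ℝ =>
        ((fun i => q (Fin.castAdd l i), fun j => q (Fin.natAdd n j)) :
          (Fin n → ℝ) × (Fin l → ℝ))) volume volume := by
  have h1 := (volume_measurePreserving_piCongrLeft (fun _ : Fin (n + l) => ℝ)
    (finSumFinEquiv (m := n) (n := l))).symm
  have h2 := volume_measurePreserving_sumPiEquivProdPi (fun _ : Fin n ⊕ Fin l => ℝ)
  exact h2.comp h1

theorem memLp_tensor {n l : ℕ} (f : H n) (g : H l) :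
    MemLp (fun q : Fin (n + l) → ℝ =>
      f (fun i => q (Fin.castAdd l i)) * g (fun j => q (Fin.natAdd n j))) 2 volume := by
  have key : MemLp (fun w : (Fin n → ℝ) × (Fin l → ℝ) => f w.1 * g w.2) 2
      ((volume : Measure (Fin n → ℝ)).prod (volume : Measure (Fin l → ℝ))) := by
    have hm : AEStronglyMeasurable (fun w : (Fin n → ℝ) × (Fin l → ℝ) => f w.1 * g w.2)
        ((volume : Measure (Fin n → ℝ)).prod (volume : Measure (Fin l → ℝ))) :=
      (Lp.aestronglyMeasurable f).comp_fst.mul (Lp.aestronglyMeasurable g).comp_snd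
    rw [memLp_two_iff_integrable_sq_norm hm]
    have hf := (memLp_two_iff_integrable_sq_norm (Lp.aestronglyMeasurable f)).1 (Lp.memLp f)
    have hg := (memLp_two_iff_integrable_sq_norm (Lp.aestronglyMeasurable g)).1 (Lp.memLp g)
    simpa [mul_pow] using hf.mul_prod hg
  exact key.comp_measurePreserving (measurePreserving_split n l)

/-- The product vector `f ⊗ g` in `L²(ℝⁿ⁺ˡ) = L²(ℝⁿ) ⊗ L²(ℝˡ)`, the first `n` coordinates
belonging to `f` and the last `l` to `g`. -/
def tensor {n l : ℕ} (f : H n) (g : H l) : H (n + l) := (memLp_tensor f g).toLp _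

/-- The vacuum wave function of one mode. -/
def vacuumFun (t : ℝ) : ℝ := Real.pi ^ (-(1 / 4) : ℝ) * Real.exp (-(t ^ 2) / 2)

theorem memLp_vacuum (k : ℕ) :
    MemLp (fun q : Fin k → ℝ => ((∏ j, vacuumFun (q j) : ℝ) : ℂ)) 2 volume := by
  have hc : Continuous (fun q : Fin k → ℝ => ((∏ j, vacuumFun (q j) : ℝ) : ℂ)) := by
    unfold vacuumFun
    fun_prop
  rw [memLp_two_iff_integrable_sq_norm hc.aestronglyMeasurable]
  have h1 : Integrable (fun t : ℝ => vacuumFun t ^ 2) := by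
    have h := (integrable_exp_neg_mul_sq (b := 1) one_pos).const_mul
      ((Real.pi ^ (-(1 / 4) : ℝ)) ^ 2)
    refine h.congr (Filter.Eventually.of_forall fun t => ?_)
    simp only [vacuumFun, mul_pow, ← Real.exp_nat_mul]
    congr 2
    push_cast
    ring
  have h2 := Integrable.fintype_prod (ι := Fin k) (μ := fun _ => (volume : Measure ℝ))
    (fun _ => h1)
  refine h2.congr (Filter.Eventually.of_forall fun q => ?_)
  simp only [Complex.norm_real, Real.norm_eq_abs, sq_abs, Finset.prod_pow]

/-- The vacuum of `k` modes, `q ↦ π^(-k/4) exp (-|q|² / 2)`. -/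
def vacuum (k : ℕ) : H k := (memLp_vacuum k).toLp _

/-- The symplectic form on phase space. -/
def symp {m : ℕ} (z w : Phase m) : ℝ := ∑ j, (z.1 j * w.2 j - z.2 j * w.1 j)

/-- Gaussian unitaries: unitaries that transform the canonical variables by an affine linear map.
In terms of displacement operators, `U D(z) U† = exp (i λ(z)) D(S z)` with `S` linear symplectic
and `λ` a real linear form (encoding a displacement vector). The two numbers of modes are allowed
to be different expressions, such as `m + k` and `n + l`, for the same number. -/
def IsGaussianUnitary {a b : ℕ} (U : H a ≃ₗᵢ[ℂ] H b) : Prop :=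
  ∃ (S : Phase a ≃ₗ[ℝ] Phase b) (lam : Phase a →ₗ[ℝ] ℝ),
    (∀ z w, symp (S z) (S w) = symp z w) ∧
    ∀ (z : Phase a) (ψ : H a),
      U (displacement z ψ) = Complex.exp ((lam z : ℂ) * Complex.I) • displacement (S z) (U ψ)

/-! ### Gaussian operations and classical computation -/

/-- `IsConditional N T` says that the operator `T` on `n + l` modes is the POVM element of the
following measurement: perform homodyne detection (measure the positions) on the last `l` modes
and, for outcome `y ∈ ℝˡ`, apply to the remaining first `n` modes a measurement with POVM element
`N y`. That is, `T = ∫ N_y ⊗ |y⟩⟨y| dy`, written out on product vectors. -/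
def IsConditional {n l : ℕ} (N : (Fin l → ℝ) → (H n →L[ℂ] H n))
    (T : H (n + l) →L[ℂ] H (n + l)) : Prop :=
  ∀ (f f' : H n) (g g' : H l),
    inner ℂ (tensor f g) (T (tensor f' g')) =
      ∫ y, (starRingEnd ℂ) (g y) * g' y * inner ℂ f (N y f')

/-- `IsProtocolEffect R m M`: there is a GOCC measurement protocol on `m` modes with `R` rounds and
a `{0, 1}`-valued function of all its measurement outcomes such that `M` is the POVM element
belonging to the value `1`.

* With no rounds left there are no modes left, and the value (`0` or `1`) has been decided.
* A round creates `k` modes in the vacuum state, performs a Gaussian unitary `U` on all `m + k`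
  modes, performs homodyne detection on the last `l` of them, and proceeds on the other `n` modes
  with a protocol that depends on the outcome `y`; the dependence is measurable, meaning that
  the probability of the final value `1`, conditioned on `y`, is a measurable function of `y`. -/
inductive IsProtocolEffect : (R m : ℕ) → (H m →L[ℂ] H m) → Prop
  | reject : IsProtocolEffect 0 0 0
  | accept : IsProtocolEffect 0 0 1
  | round {R m k n l : ℕ} (hmodes : m + k = n + l)
      (U : H (m + k) ≃ₗᵢ[ℂ] H (n + l)) (hU : IsGaussianUnitary U)
      (N : (Fin l → ℝ) → (H n →L[ℂ] H n))
      (hN : ∀ y, IsProtocolEffect R n (N y))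
      (hmeas : ∀ f f' : H n, Measurable fun y => inner ℂ f (N y f'))
      (T : H (n + l) →L[ℂ] H (n + l)) (hT : IsConditional N T)
      (M : H m →L[ℂ] H m)
      (hM : ∀ φ ψ : H m, inner ℂ φ (M ψ) =
        inner ℂ (U (tensor φ (vacuum k))) (T (U (tensor ψ (vacuum k))))) :
      IsProtocolEffect (R + 1) m M

/-- The set of `M` such that `(M, 1 - M)` is a GOCC POVM: those implemented by some GOCC protocol
with finitely many rounds, and their limits in the strong operator topology (the topology of
pointwise convergence on the Hilbert space). -/
def gocc (m : ℕ) : Set (H m →L[ℂ] H m) :=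
  {M | (M : H m → H m) ∈
    closure {F : H m → H m | ∃ (R : ℕ) (M' : H m →L[ℂ] H m), IsProtocolEffect R m M' ∧ F = M'}}

/-! ### Distinguishability norms -/

/-- The error probability `P_e = ½ tr ρ₀ (1 - M) + ½ tr ρ₁ M` of the binary POVM `(M, 1 - M)` for
equiprobable hypotheses. -/
def errorProb {m : ℕ} (ρ₀ ρ₁ M : H m →L[ℂ] H m) : ℝ :=
  (trace (ρ₀.comp (1 - M))).re / 2 + (trace (ρ₁.comp M)).re / 2

/-- The distinguishability norm `‖ρ₀ - ρ₁‖_𝓜` with respect to a (non-empty) set of binary POVMs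
`(M, 1 - M)`, `M ∈ 𝓜`, defined by `inf P_e = ½ (1 - ½ ‖ρ₀ - ρ₁‖_𝓜)`. -/
def distNorm {m : ℕ} (𝓜 : Set (H m →L[ℂ] H m)) (ρ₀ ρ₁ : H m →L[ℂ] H m) : ℝ :=
  2 * (1 - 2 * sInf (errorProb ρ₀ ρ₁ '' 𝓜))

end Bosonic

end

noncomputable section

namespace Bosonic

/-! ### Weyl relations -/

/-! Write `A_z` for the phase point operators, and call `φ` the symbol of the operator `G = ∫ φ(z)
A_z dz`. There are two inequalities.

GOCC ≤ W+ holds because every GOCC measurement is a W+ measurement, so the infimum over W+ runs over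
a larger set. Positivity is tested by duality: `StrongWignerNonneg M` says that `tr(M G) ≥ 0` for
every trace class `G` with non-negative integrable symbol. Each ingredient of a round maps such `G`
to operators of the same kind. Adding vacuum modes multiplies the symbol by a Gaussian
(`IsWeylSum.tensor_vacuum`). A Gaussian unitary moves it by an affine bijection
(`IsGaussianUnitary.exists_isWeylSum`). Homodyne detection fixes the measured positions and
integrates out the conjugate momenta (`IsWeylSum.ae_slice`). Induction on the number of rounds gives
the claim for protocols, applied to both `M` and `1 - M`. Dominated convergence extends it to strong
limits. Since Schwartz functions have trace class quantizations (`exists_isWeylSum_schwartz`), the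
strong form implies the distributional one.

For W+ ≤ L¹, the error probability is `1/2 - tr((ρ₀ - ρ₁) B) / 4` with `B = 2M - 1`. Formally
`tr((ρ₀ - ρ₁) B) = (2π)ᵐ ∫ (W₀ - W₁) W_B`, and the W+ conditions say `|W_B| ≤ (2π)⁻ᵐ`. As `W_B` is
only a distribution and `W₀ - W₁` only integrable, the identity is proved after smoothing.
`IsWeylSum.integral_duality` pairs `W₀ - W₁` with `W_B` averaged by a mollifier `g`, and equates
this with the `g`-average of the continuous function `z ↦ tr(D(z)(ρ₀ - ρ₁)D(z)† B)`. Concentrating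
`g` near `0` recovers the trace (`re_tsum_le_integral_norm`).

The analytic basis is the orthogonality relation `integral_moyal`, which is Plancherel in the
momentum variable followed by polarization. Trace class operators are handled throughout as sums `∑
|u k⟩⟨v k|` with square-summable families, packaged in `IsWeylSum`. -/

theorem symp_add_left {m : ℕ} (z z' w : Phase m) : symp (z + z') w = symp z w + symp z' w := by
  simp only [symp, ← Finset.sum_add_distrib]
  exact Finset.sum_congr rfl fun j _ => by simp; ring

theorem symp_swap {m : ℕ} (z w : Phase m) : symp w z = -symp z w := by
  simp only [symp, ← Finset.sum_neg_distrib]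
  exact Finset.sum_congr rfl fun j _ => by ring

theorem symp_add_right {m : ℕ} (z w w' : Phase m) : symp z (w + w') = symp z w + symp z w' := by
  rw [symp_swap, symp_add_left, symp_swap z w, symp_swap z w']; ring

theorem symp_smul_left {m : ℕ} (c : ℝ) (z w : Phase m) : symp (c • z) w = c * symp z w := by
  simp only [symp, Finset.mul_sum]
  exact Finset.sum_congr rfl fun j _ => by simp; ring

theorem symp_smul_right {m : ℕ} (c : ℝ) (z w : Phase m) : symp z (c • w) = c * symp z w := by
  rw [symp_swap, symp_smul_left, symp_swap z w]; ring

theorem symp_neg_left {m : ℕ} (z w : Phase m) : symp (-z) w = -symp z w := by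
  simpa using symp_smul_left (-1) z w

theorem symp_neg_right {m : ℕ} (z w : Phase m) : symp z (-w) = -symp z w := by
  simpa using symp_smul_right (-1) z w

theorem symp_self {m : ℕ} (z : Phase m) : symp z z = 0 := by
  have := symp_swap z z; linarith

theorem symp_sub_left {m : ℕ} (z z' w : Phase m) : symp (z - z') w = symp z w - symp z' w := by
  rw [sub_eq_add_neg, symp_add_left, symp_neg_left]; ring

theorem continuous_symp {m : ℕ} (z : Phase m) : Continuous fun w => symp z w := by
  unfold symp; fun_prop

/-- The unimodular number `exp (i t)`. -/
def ephase (t : ℝ) : ℂ := Complex.exp ((t : ℂ) * Complex.I)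

theorem ephase_add (s t : ℝ) : ephase (s + t) = ephase s * ephase t := by
  simp [ephase, add_mul, Complex.exp_add]

@[simp] theorem ephase_zero : ephase 0 = 1 := by simp [ephase]

@[simp] theorem norm_ephase (t : ℝ) : ‖ephase t‖ = 1 := Complex.norm_exp_ofReal_mul_I t

theorem ephase_mul_neg (t : ℝ) : ephase t * ephase (-t) = 1 := by
  rw [← ephase_add]; simp

theorem continuous_ephase : Continuous ephase := by unfold ephase; fun_prop

theorem dispPhase_eq {m : ℕ} (z : Phase m) (q : Fin m → ℝ) :
    dispPhase z q = ephase (∑ j, z.2 j * q j - (∑ j, z.1 j * z.2 j) / 2) := rfl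

theorem coeFn_phaseMul {m : ℕ} (u : (Fin m → ℝ) → ℂ) (hu : Continuous u) (h1 : ∀ q, ‖u q‖ = 1)
    (f : H m) : phaseMul u hu h1 f =ᵐ[volume] fun q => u q * f q :=
  MemLp.coeFn_toLp (memLp_mul_of_norm_one hu h1 f)

theorem coeFn_displacement {m : ℕ} (z : Phase m) (ψ : H m) :
    displacement z ψ =ᵐ[volume] fun q => dispPhase z q * ψ (q - z.1) := by
  have h1 := coeFn_phaseMul (dispPhase z) (continuous_dispPhase z) (norm_dispPhase z)
    (Lp.compMeasurePreserving (fun q : Fin m → ℝ => q - z.1)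
      (measurePreserving_sub_right volume z.1) ψ)
  have h2 := Lp.coeFn_compMeasurePreserving ψ (measurePreserving_sub_right volume z.1)
  filter_upwards [h1, h2] with q hq1 hq2
  exact hq1.trans (by rw [hq2]; rfl)

theorem coeFn_parity {m : ℕ} (ψ : H m) : parity m ψ =ᵐ[volume] fun q => ψ (-q) :=
  Lp.coeFn_compMeasurePreserving ψ (Measure.measurePreserving_neg volume)

theorem norm_phaseMul {m : ℕ} (u : (Fin m → ℝ) → ℂ) (hu : Continuous u) (h1 : ∀ q, ‖u q‖ = 1)
    (f : H m) : ‖phaseMul u hu h1 f‖ = ‖f‖ := by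
  rw [Lp.norm_def, Lp.norm_def]
  congr 1
  refine eLpNorm_congr_norm_ae ?_
  filter_upwards [coeFn_phaseMul u hu h1 f] with q hq
  rw [hq, norm_mul, h1, one_mul]

@[simp] theorem norm_displacement {m : ℕ} (z : Phase m) (ψ : H m) : ‖displacement z ψ‖ = ‖ψ‖ := by
  unfold displacement
  rw [ContinuousLinearMap.comp_apply, norm_phaseMul]
  exact LinearIsometry.norm_map _ _

@[simp] theorem norm_parity {m : ℕ} (ψ : H m) : ‖parity m ψ‖ = ‖ψ‖ :=
  LinearIsometry.norm_map _ _

theorem displacement_displacement {m : ℕ} (z w : Phase m) (ψ : H m) :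
    displacement z (displacement w ψ) = ephase (-(symp z w) / 2) • displacement (z + w) ψ := by
  apply Lp.ext
  have hw : ∀ᵐ q : Fin m → ℝ, displacement w ψ (q - z.1)
      = dispPhase w (q - z.1) * ψ (q - z.1 - w.1) :=
    (measurePreserving_sub_right volume z.1).quasiMeasurePreserving.ae (coeFn_displacement w ψ)
  filter_upwards [coeFn_displacement z (displacement w ψ), hw, coeFn_displacement (z + w) ψ,
    Lp.coeFn_smul (ephase (-(symp z w) / 2)) (displacement (z + w) ψ)] with q h1 h2 h3 h4
  rw [h1, h2, h4, Pi.smul_apply, h3, smul_eq_mul, ← mul_assoc, ← mul_assoc, dispPhase_eq,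
    dispPhase_eq, dispPhase_eq, ← ephase_add, ← ephase_add]
  have e : q - z.1 - w.1 = q - (z + w).1 := by simp [sub_sub]
  rw [e]
  congr 2
  simp only [symp, Prod.fst_add, Prod.snd_add, Pi.add_apply, Pi.sub_apply, add_mul, mul_add,
    mul_sub, Finset.sum_add_distrib, Finset.sum_sub_distrib]
  have : ∑ j, w.2 j * z.1 j = ∑ j, z.1 j * w.2 j := Finset.sum_congr rfl fun j _ => mul_comm _ _
  have h' : ∑ j, w.1 j * z.2 j = ∑ j, z.2 j * w.1 j := Finset.sum_congr rfl fun j _ => mul_comm _ _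
  rw [this, h']
  ring

@[simp] theorem displacement_zero {m : ℕ} (ψ : H m) : displacement (0 : Phase m) ψ = ψ := by
  apply Lp.ext
  filter_upwards [coeFn_displacement 0 ψ] with q h
  rw [h, dispPhase_eq]
  simp

theorem displacement_neg_displacement {m : ℕ} (z : Phase m) (ψ : H m) :
    displacement (-z) (displacement z ψ) = ψ := by
  rw [displacement_displacement, symp_neg_left, symp_self]; simp

theorem displacement_displacement_neg {m : ℕ} (z : Phase m) (ψ : H m) :
    displacement z (displacement (-z) ψ) = ψ := by
  simpa using displacement_neg_displacement (-z) ψ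

/-- Displacement operators as unitaries. -/
def dispU {m : ℕ} (z : Phase m) : H m ≃ₗᵢ[ℂ] H m where
  toFun := displacement z
  invFun := displacement (-z)
  left_inv := displacement_neg_displacement z
  right_inv := displacement_displacement_neg z
  map_add' := map_add _
  map_smul' := map_smul _
  norm_map' := norm_displacement z

theorem inner_displacement_displacement {m : ℕ} (z : Phase m) (f g : H m) :
    inner ℂ (displacement z f) (displacement z g) = inner ℂ f g :=
  (dispU z).inner_map_map f g

theorem inner_displacement_left {m : ℕ} (z : Phase m) (f g : H m) :
    inner ℂ (displacement z f) g = inner ℂ f (displacement (-z) g) := by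
  rw [← inner_displacement_displacement z f, displacement_displacement_neg]

theorem inner_displacement_right {m : ℕ} (z : Phase m) (f g : H m) :
    inner ℂ f (displacement z g) = inner ℂ (displacement (-z) f) g := by
  rw [inner_displacement_left, neg_neg]

theorem adjoint_displacement {m : ℕ} (z : Phase m) :
    ContinuousLinearMap.adjoint (displacement z) = displacement (-z) := by
  symm
  rw [ContinuousLinearMap.eq_adjoint_iff]
  intro f g
  rw [inner_displacement_left, neg_neg]

theorem parity_parity {m : ℕ} (ψ : H m) : parity m (parity m ψ) = ψ := by
  apply Lp.ext
  have h2 : ∀ᵐ q : Fin m → ℝ, parity m ψ (-q) = ψ (- -q) :=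
    (Measure.measurePreserving_neg volume).quasiMeasurePreserving.ae (coeFn_parity ψ)
  filter_upwards [coeFn_parity (parity m ψ), h2] with q h1 h2
  rw [h1, h2, neg_neg]

theorem inner_parity_parity {m : ℕ} (f g : H m) :
    inner ℂ (parity m f) (parity m g) = inner ℂ f g :=
  LinearIsometry.inner_map_map _ f g

theorem inner_parity_left {m : ℕ} (f g : H m) :
    inner ℂ (parity m f) g = inner ℂ f (parity m g) := by
  rw [← inner_parity_parity f, parity_parity]

theorem parity_displacement {m : ℕ} (z : Phase m) (ψ : H m) :
    parity m (displacement z ψ) = displacement (-z) (parity m ψ) := by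
  apply Lp.ext
  have h2 : ∀ᵐ q : Fin m → ℝ, displacement z ψ (-q) = dispPhase z (-q) * ψ (-q - z.1) :=
    (Measure.measurePreserving_neg volume).quasiMeasurePreserving.ae (coeFn_displacement z ψ)
  have h4 : ∀ᵐ q : Fin m → ℝ, parity m ψ (q - (-z).1) = ψ (-(q - (-z).1)) :=
    (measurePreserving_sub_right volume (-z).1).quasiMeasurePreserving.ae (coeFn_parity ψ)
  filter_upwards [coeFn_parity (displacement z ψ), h2, coeFn_displacement (-z) (parity m ψ), h4]
    with q h1 h2 h3 h4
  rw [h1, h2, h3, h4]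
  congr 1
  · simp [dispPhase_eq]
  · congr 1
    simp [sub_eq_add_neg, add_comm]

/-! ### Phase point operators -/

/-- Parity reverses displacements, so `D(z) Π D(z)† = D(2z) Π`. Facts about phase point operators
thereby become facts about displacements at the doubled argument. -/
theorem phasePoint_apply {m : ℕ} (z : Phase m) (ψ : H m) :
    phasePoint z ψ
      = (((Real.pi ^ m)⁻¹ : ℝ) : ℂ) • displacement ((2 : ℝ) • z) (parity m ψ) := by
  unfold phasePoint
  simp only [_root_.smul_apply, ContinuousLinearMap.comp_apply, adjoint_displacement]
  rw [parity_displacement, neg_neg, displacement_displacement, symp_self, two_smul]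
  simp

theorem norm_phasePoint {m : ℕ} (z : Phase m) (ψ : H m) :
    ‖phasePoint z ψ‖ = (Real.pi ^ m)⁻¹ * ‖ψ‖ := by
  rw [phasePoint_apply, norm_smul, norm_displacement, norm_parity, Complex.norm_real,
    Real.norm_of_nonneg (by positivity)]

theorem norm_inner_phasePoint_le {m : ℕ} (z : Phase m) (f g : H m) :
    ‖inner ℂ f (phasePoint z g)‖ ≤ (Real.pi ^ m)⁻¹ * (‖f‖ * ‖g‖) := by
  refine (norm_inner_le_norm _ _).trans (le_of_eq ?_)
  rw [norm_phasePoint]; ring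

theorem inner_phasePoint_left {m : ℕ} (z : Phase m) (f g : H m) :
    inner ℂ (phasePoint z f) g = inner ℂ f (phasePoint z g) := by
  rw [phasePoint_apply, phasePoint_apply, inner_smul_left, inner_smul_right, Complex.conj_ofReal,
    inner_displacement_left, inner_parity_left, parity_displacement, neg_neg]

theorem displacement_phasePoint {m : ℕ} (w z : Phase m) (ψ : H m) :
    displacement w (phasePoint z ψ) = phasePoint (z + w) (displacement w ψ) := by
  rw [phasePoint_apply, phasePoint_apply, map_smul, parity_displacement, displacement_displacement,
    displacement_displacement]
  rw [show w + (2 : ℝ) • z = (2 : ℝ) • (z + w) + -w by module]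
  congr 3
  · simp only [smul_add, symp_add_left, symp_smul_left, symp_smul_right, symp_neg_right, symp_self]
    rw [symp_swap z w]; ring

theorem inner_displacement_phasePoint {m : ℕ} (w z : Phase m) (f g : H m) :
    inner ℂ (displacement w f) (phasePoint z (displacement w g))
      = inner ℂ f (phasePoint (z - w) g) := by
  rw [inner_displacement_left, displacement_phasePoint, displacement_neg_displacement,
    sub_eq_add_neg]

/-- A one-sided displacement moves the phase point by half its argument and adds a symplectic phase.
This phase is what makes `tr(G D(ζ))` a Fourier transform of the symbol of `G`. -/
theorem displacement_phasePoint' {m : ℕ} (w z : Phase m) (ψ : H m) :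
    displacement w (phasePoint z ψ)
      = ephase (-symp w z) • phasePoint (z + (1 / 2 : ℝ) • w) ψ := by
  rw [phasePoint_apply, phasePoint_apply, map_smul, displacement_displacement, smul_comm]
  rw [show w + (2 : ℝ) • z = (2 : ℝ) • (z + (1 / 2 : ℝ) • w) by module, symp_smul_right]
  congr 2
  ring_nf

/-! ### Strong continuity of the displacement operators -/

theorem norm_sq_eq_integral {α : Type*} [MeasurableSpace α] {μ : Measure α} (f : Lp ℂ 2 μ) :
    ‖f‖ ^ 2 = ∫ q, ‖f q‖ ^ 2 ∂μ := by
  have h := L2.inner_def (𝕜 := ℂ) f f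
  rw [inner_self_eq_norm_sq_to_K] at h
  have h2 : (fun a => inner ℂ (f a) (f a)) = fun a => ((‖f a‖ ^ 2 : ℝ) : ℂ) := by
    funext a
    rw [inner_self_eq_norm_sq_to_K]; norm_cast
  rw [h2, integral_complex_ofReal] at h
  exact Complex.ofReal_injective (by simpa using h)

theorem integrable_norm_sq {α : Type*} [MeasurableSpace α] {μ : Measure α} (f : Lp ℂ 2 μ) :
    Integrable (fun q => ‖f q‖ ^ 2) μ :=
  (memLp_two_iff_integrable_sq_norm (Lp.aestronglyMeasurable f)).1 (Lp.memLp f)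

theorem continuous_phaseMul {m : ℕ} (f : H m) :
    Continuous fun z : Phase m =>
      phaseMul (dispPhase z) (continuous_dispPhase z) (norm_dispPhase z) f := by
  refine continuous_iff_continuousAt.2 fun z₀ => ?_
  rw [ContinuousAt, tendsto_iff_norm_sub_tendsto_zero]
  set P : Phase m → H m := fun z =>
    phaseMul (dispPhase z) (continuous_dispPhase z) (norm_dispPhase z) f
  have h2 : Filter.Tendsto (fun z => ‖P z - P z₀‖ ^ 2) (nhds z₀) (nhds 0) := by
    have e : ∀ z, ‖P z - P z₀‖ ^ 2
        = ∫ q, ‖(dispPhase z q - dispPhase z₀ q) * f q‖ ^ 2 := fun z => by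
      rw [norm_sq_eq_integral]
      refine integral_congr_ae ?_
      filter_upwards [Lp.coeFn_sub (P z) (P z₀),
        coeFn_phaseMul (dispPhase z) (continuous_dispPhase z) (norm_dispPhase z) f,
        coeFn_phaseMul (dispPhase z₀) (continuous_dispPhase z₀) (norm_dispPhase z₀) f]
        with q h1 h2 h3
      rw [h1, Pi.sub_apply, h2, h3, sub_mul]
    simp only [e]
    have z0 : (0 : ℝ) = ∫ q : Fin m → ℝ, ‖(dispPhase z₀ q - dispPhase z₀ q) * f q‖ ^ 2 := by simp
    rw [z0]
    refine tendsto_integral_filter_of_dominated_convergence (fun q => 4 * ‖f q‖ ^ 2) ?_ ?_ ?_ ?_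
    · refine Filter.Eventually.of_forall fun z => ?_
      exact ((((continuous_dispPhase z).sub (continuous_dispPhase z₀)).aestronglyMeasurable.mul
        (Lp.aestronglyMeasurable f)).norm.pow 2)
    · refine Filter.Eventually.of_forall fun z => Filter.Eventually.of_forall fun q => ?_
      have : ‖dispPhase z q - dispPhase z₀ q‖ ≤ 2 :=
        (norm_sub_le _ _).trans (by rw [norm_dispPhase, norm_dispPhase]; norm_num)
      rw [Real.norm_of_nonneg (by positivity), norm_mul, mul_pow]
      have : ‖dispPhase z q - dispPhase z₀ q‖ ^ 2 ≤ 2 ^ 2 := by gcongr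
      nlinarith [sq_nonneg ‖f q‖]
    · exact (integrable_norm_sq f).const_mul 4
    · refine Filter.Eventually.of_forall fun q => ?_
      have hc : Continuous fun z : Phase m => ‖(dispPhase z q - dispPhase z₀ q) * f q‖ ^ 2 := by
        unfold dispPhase; fun_prop
      exact hc.tendsto z₀
  have h3 := h2.sqrt
  simpa [Real.sqrt_sq] using h3

theorem continuous_displacement {m : ℕ} (ψ : H m) :
    Continuous fun z : Phase m => displacement z ψ := by
  let T : Phase m → H m := fun z => Lp.compMeasurePreserving (fun q : Fin m → ℝ => q - z.1)
    (measurePreserving_sub_right volume z.1) ψ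
  have hT : Continuous T := by
    let g : C(Phase m, C((Fin m → ℝ), (Fin m → ℝ))) :=
      (ContinuousMap.mk (fun a : Phase m × (Fin m → ℝ) => a.2 - a.1.1) (by fun_prop)).curry
    exact (continuous_const (y := ψ)).compMeasurePreservingLp g.continuous
      (fun z => measurePreserving_sub_right volume z.1) (by simp)
  refine continuous_iff_continuousAt.2 fun z₀ => ?_
  rw [ContinuousAt, tendsto_iff_norm_sub_tendsto_zero]
  let P : Phase m → H m →L[ℂ] H m := fun z =>
    phaseMul (dispPhase z) (continuous_dispPhase z) (norm_dispPhase z)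
  -- Multiplication by the phase is isometric, so the translation and the phase can be varied one
  -- after the other.
  have hb : ∀ z, ‖displacement z ψ - displacement z₀ ψ‖
      ≤ ‖T z - T z₀‖ + ‖P z (T z₀) - P z₀ (T z₀)‖ := fun z => by
    have e : displacement z ψ - displacement z₀ ψ
        = P z (T z - T z₀) + (P z (T z₀) - P z₀ (T z₀)) := by
      rw [map_sub]
      change P z (T z) - P z₀ (T z₀) = _
      abel
    rw [e]
    refine (norm_add_le _ _).trans (le_of_eq ?_)
    rw [norm_phaseMul]
  refine squeeze_zero (fun _ => norm_nonneg _) hb ?_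
  have h1 := tendsto_iff_norm_sub_tendsto_zero.1 (hT.tendsto z₀)
  have h2 := tendsto_iff_norm_sub_tendsto_zero.1 ((continuous_phaseMul (T z₀)).tendsto z₀)
  simpa using h1.add h2

theorem continuous_phasePoint {m : ℕ} (ψ : H m) : Continuous fun z : Phase m => phasePoint z ψ := by
  simp only [phasePoint_apply]
  have h : Continuous fun z : Phase m => displacement ((2 : ℝ) • z) (parity m ψ) :=
    (continuous_displacement (parity m ψ)).comp (by fun_prop)
  exact h.const_smul (((Real.pi ^ m)⁻¹ : ℝ) : ℂ)

/-! ### The Fourier transform on `ℝᵐ` -/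

section Fourier

open FourierTransform SchwartzMap
open scoped ContDiff

/-- A real test function as a complex Schwartz function. -/
theorem exists_schwartz_of_testFunction {E : Type*} [NormedAddCommGroup E] [NormedSpace ℝ E]
    (g : E → ℝ) (hg : ContDiff ℝ ∞ g)
    (hs : HasCompactSupport g) : ∃ ψ : 𝓢(E, ℂ), ∀ x, ψ x = (g x : ℂ) := by
  have h1 : HasCompactSupport fun x => (g x : ℂ) := hs.comp_left (g := fun t : ℝ => (t : ℂ)) rfl
  have h2 : ContDiff ℝ ∞ fun x => (g x : ℂ) := Complex.ofRealCLM.contDiff.comp hg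
  exact ⟨h1.toSchwartzMap h2, fun x => rfl⟩

variable {E : Type*} [NormedAddCommGroup E] [InnerProductSpace ℝ E] [FiniteDimensional ℝ E]
  [MeasurableSpace E] [BorelSpace E]

theorem integral_fourier_mul_schwartz {f : E → ℂ} (h1 : Integrable f) (ψ : 𝓢(E, ℂ)) :
    ∫ x, 𝓕 f x * ψ x = ∫ x, f x * (𝓕 ψ) x := by
  have := VectorFourier.integral_fourierIntegral_smul_eq_flip (μ := (volume : Measure E))
    (ν := (volume : Measure E)) (L := innerₗ E) Real.continuous_fourierChar continuous_inner h1
    ψ.integrable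
  rw [flip_innerₗ] at this
  exact this

/-- The `L²` transform agrees with the distributional one, and the integral transform moves onto
test functions by Fubini; both sides therefore have the same integrals against test functions. -/
theorem fourier_ae_eq_of_memLp {f : E → ℂ} (h1 : Integrable f) (h2 : MemLp f 2) :
    𝓕 f =ᵐ[volume] (𝓕 (h2.toLp f) : Lp ℂ 2 (volume : Measure E)) := by
  have hc : Continuous (𝓕 f) := VectorFourier.fourierIntegral_continuous
    Real.continuous_fourierChar continuous_inner h1
  refine ae_eq_of_integral_contDiff_smul_eq hc.locallyIntegrable
    ((Lp.memLp _).locallyIntegrable (by norm_num)) fun g hg hs => ?_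
  obtain ⟨ψ, hψ⟩ := exists_schwartz_of_testFunction g hg hs
  have h3 := congrArg (fun T : 𝓢'(E, ℂ) => T ψ)
    (Lp.fourier_toTemperedDistribution_eq (h2.toLp f))
  simp only [TemperedDistribution.fourier_apply, Lp.toTemperedDistribution_apply] at h3
  have h4 := integral_fourier_mul_schwartz h1 ψ
  calc ∫ x, g x • 𝓕 f x = ∫ x, 𝓕 f x * ψ x :=
        integral_congr_ae (Filter.Eventually.of_forall fun x => by simp [hψ, mul_comm])
    _ = ∫ x, (𝓕 ψ) x • (h2.toLp f) x := by
        rw [h4]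
        refine integral_congr_ae ?_
        filter_upwards [h2.coeFn_toLp] with x hx
        rw [hx, smul_eq_mul, mul_comm]
    _ = _ := h3.trans (integral_congr_ae (Filter.Eventually.of_forall fun x => by simp [hψ]))

theorem lintegral_enorm_sq_fourier {f : E → ℂ} (h1 : Integrable f) (h2 : MemLp f 2) :
    ∫⁻ ξ, ‖𝓕 f ξ‖ₑ ^ 2 = ∫⁻ x, ‖f x‖ₑ ^ 2 := by
  have e : eLpNorm (𝓕 f) 2 volume = eLpNorm f 2 volume := by
    rw [eLpNorm_congr_ae (fourier_ae_eq_of_memLp h1 h2)]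
    have := Lp.norm_fourier_eq (h2.toLp f)
    rw [Lp.norm_def, Lp.norm_toLp, ENNReal.toReal_eq_toReal_iff' (Lp.memLp _).2.ne h2.2.ne] at this
    exact this
  rw [eLpNorm_eq_lintegral_rpow_enorm_toReal (by norm_num) (by norm_num),
    eLpNorm_eq_lintegral_rpow_enorm_toReal (by norm_num) (by norm_num)] at e
  have := congrArg (fun t : ENNReal => t ^ (2 : ℝ)) e
  simp only [← ENNReal.rpow_mul, ENNReal.toReal_ofNat, one_div] at this
  rw [inv_mul_cancel₀ (by norm_num)] at this
  simpa using this

/-- A test function is the transform of its inverse transform, so its pairing with `f` equals a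
pairing with `𝓕 f = 0`. -/
theorem ae_eq_zero_of_fourier_eq_zero {f : E → ℂ} (h1 : Integrable f) (h : ∀ ξ, 𝓕 f ξ = 0) :
    f =ᵐ[volume] 0 := by
  refine ae_eq_zero_of_integral_contDiff_smul_eq_zero h1.locallyIntegrable fun g hg hs => ?_
  obtain ⟨ψ, hψ⟩ := exists_schwartz_of_testFunction g hg hs
  have h4 := integral_fourier_mul_schwartz h1 (𝓕⁻ ψ)
  simp only [h, zero_mul, integral_zero, fourier_fourierInv_eq] at h4
  rw [h4]
  exact integral_congr_ae (Filter.Eventually.of_forall fun x => by simp [hψ, mul_comm])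

end Fourier

/-- The Fourier transform on `ℝᵐ` without normalization. -/
def fourierPi {m : ℕ} (F : (Fin m → ℝ) → ℂ) (p : Fin m → ℝ) : ℂ :=
  ∫ q, ephase (∑ j, p j * q j) * F q

open FourierTransform in
theorem fourier_comp_ofLp {m : ℕ} (F : (Fin m → ℝ) → ℂ) (p : Fin m → ℝ) :
    𝓕 (fun x : EuclideanSpace ℝ (Fin m) => F (WithLp.ofLp x)) (WithLp.toLp 2 p)
      = fourierPi F ((-(2 * Real.pi)) • p) := by
  rw [Real.fourier_eq', fourierPi,
    ← (PiLp.volume_preserving_ofLp (Fin m)).integral_comp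
      (MeasurableEquiv.toLp 2 (Fin m → ℝ)).symm.measurableEmbedding]
  refine integral_congr_ae (Filter.Eventually.of_forall fun x => ?_)
  simp only [smul_eq_mul, ephase]
  congr 3
  simp only [PiLp.inner_apply, Pi.smul_apply, smul_eq_mul, RCLike.inner_apply, conj_trivial,
    Finset.mul_sum]
  push_cast
  exact Finset.sum_congr rfl fun j _ => by ring

theorem integrable_comp_ofLp {m : ℕ} {F : (Fin m → ℝ) → ℂ} (h : Integrable F) :
    Integrable (fun x : EuclideanSpace ℝ (Fin m) => F (WithLp.ofLp x)) :=
  (PiLp.volume_preserving_ofLp (Fin m)).integrable_comp_of_integrable h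

theorem lintegral_enorm_sq_fourierPi {m : ℕ} {F : (Fin m → ℝ) → ℂ} (h1 : Integrable F)
    (h2 : MemLp F 2) :
    ∫⁻ p, ‖fourierPi F p‖ₑ ^ 2 = ENNReal.ofReal ((2 * Real.pi) ^ m) * ∫⁻ q, ‖F q‖ₑ ^ 2 := by
  have hπ := Real.pi_pos
  have key := lintegral_enorm_sq_fourier (integrable_comp_ofLp h1)
    (h2.comp_measurePreserving (PiLp.volume_preserving_ofLp (Fin m)))
  have e1 := (PiLp.volume_preserving_ofLp (Fin m)).lintegral_comp_emb
    (MeasurableEquiv.toLp 2 (Fin m → ℝ)).symm.measurableEmbedding (fun q => ‖F q‖ₑ ^ 2)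
  have e2 := (PiLp.volume_preserving_toLp (Fin m)).lintegral_comp_emb
    (MeasurableEquiv.toLp 2 (Fin m → ℝ)).measurableEmbedding (fun x => ‖FourierTransform.fourier
      (fun x : EuclideanSpace ℝ (Fin m) => F (WithLp.ofLp x)) x‖ₑ ^ 2)
  have key' : ∫⁻ p : Fin m → ℝ, ‖fourierPi F ((-(2 * Real.pi)) • p)‖ₑ ^ 2
      = ∫⁻ q, ‖F q‖ₑ ^ 2 := by
    rw [← e1, ← key, ← e2]
    exact lintegral_congr fun p => by rw [fourier_comp_ofLp]
  -- Dilation by `-2π` contributes the Jacobian `(2π)⁻ᵐ`, the price of the unnormalized convention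
  -- `exp(i p·q)`.
  have e3 : ∫⁻ p : Fin m → ℝ, ‖fourierPi F ((-(2 * Real.pi)) • p)‖ₑ ^ 2
      = ENNReal.ofReal ((2 * Real.pi) ^ m)⁻¹ * ∫⁻ p, ‖fourierPi F p‖ₑ ^ 2 := by
    have hne : -(2 * Real.pi) ≠ 0 := by simp [hπ.ne']
    have := (MeasurableEquiv.smul₀ (α := Fin m → ℝ) _ hne).measurableEmbedding.lintegral_map
      (μ := volume) (fun p => ‖fourierPi F p‖ₑ ^ 2)
    rw [show (⇑(MeasurableEquiv.smul₀ (α := Fin m → ℝ) _ hne)) = (fun p => (-(2 * Real.pi)) • p)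
      from rfl, Measure.map_addHaar_smul _ hne, lintegral_smul_measure] at this
    rw [← this, smul_eq_mul, Module.finrank_fin_fun, abs_inv, abs_pow, abs_neg,
      abs_of_pos (by positivity)]
  rw [← key', e3, ← mul_assoc, ← ENNReal.ofReal_mul (by positivity),
    mul_inv_cancel₀ (by positivity), ENNReal.ofReal_one, one_mul]

theorem ae_eq_zero_of_fourierPi_eq_zero {m : ℕ} {F : (Fin m → ℝ) → ℂ} (h1 : Integrable F)
    (h : ∀ p, fourierPi F p = 0) : F =ᵐ[volume] 0 := by
  have := ae_eq_zero_of_fourier_eq_zero (integrable_comp_ofLp h1) fun ξ => by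
    rw [← WithLp.toLp_ofLp 2 ξ, fourier_comp_ofLp, h]
  have h3 := (PiLp.volume_preserving_toLp (Fin m)).quasiMeasurePreserving.ae this
  filter_upwards [h3] with q hq
  simpa using hq

/-! ### Orthogonality relations -/

theorem lintegral_enorm_sq {m : ℕ} (f : H m) :
    ∫⁻ q, ‖f q‖ₑ ^ 2 = ENNReal.ofReal (‖f‖ ^ 2) := by
  rw [norm_sq_eq_integral, ofReal_integral_eq_lintegral_ofReal (integrable_norm_sq f)
    (Filter.Eventually.of_forall fun q => by positivity)]
  refine lintegral_congr fun q => ?_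
  rw [ENNReal.ofReal_pow (norm_nonneg _), ofReal_norm]

/-- For fixed `x` the matrix element is, up to a phase, a Fourier transform in `p`, so Plancherel
applies in the momentum variable. -/
theorem inner_displacement_eq_fourierPi {m : ℕ} (a b : H m) (x p : Fin m → ℝ) :
    inner ℂ a (displacement (x, p) b) = ephase (-((∑ j, x j * p j) / 2)) *
      fourierPi (fun q => (starRingEnd ℂ) (a q) * b (q - x)) p := by
  rw [L2.inner_def, fourierPi, ← integral_const_mul]
  refine integral_congr_ae ?_
  filter_upwards [coeFn_displacement (x, p) b] with q hq
  rw [hq, dispPhase_eq, RCLike.inner_apply, sub_eq_add_neg, ephase_add]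
  ring

theorem memLp_comp_sub {m : ℕ} (b : H m) (x : Fin m → ℝ) : MemLp (fun q => b (q - x)) 2 volume :=
  (Lp.memLp b).comp_measurePreserving (measurePreserving_sub_right volume x)

theorem integrable_conj_mul_comp_sub {m : ℕ} (a b : H m) (x : Fin m → ℝ) :
    Integrable (fun q => (starRingEnd ℂ) (a q) * b (q - x)) :=
  (Lp.memLp a).star.integrable_mul (memLp_comp_sub b x)

theorem lintegral_lintegral_conj_mul_comp_sub {m : ℕ} (a b : H m) :
    ∫⁻ x : Fin m → ℝ, ∫⁻ q, ‖(starRingEnd ℂ) (a q) * b (q - x)‖ₑ ^ 2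
      = ENNReal.ofReal (‖a‖ ^ 2 * ‖b‖ ^ 2) := by
  have ha := (Lp.stronglyMeasurable a).measurable
  have hb := (Lp.stronglyMeasurable b).measurable
  rw [lintegral_lintegral_swap]
  · have : ∀ q : Fin m → ℝ, ∫⁻ x, ‖(starRingEnd ℂ) (a q) * b (q - x)‖ₑ ^ 2
        = ‖a q‖ₑ ^ 2 * ENNReal.ofReal (‖b‖ ^ 2) := fun q => by
      simp only [enorm_mul, RCLike.enorm_conj, mul_pow]
      rw [lintegral_const_mul _ (by fun_prop), ← lintegral_enorm_sq]
      rw [lintegral_sub_left_eq_self (fun x => ‖b x‖ₑ ^ 2) q]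
    simp only [this]
    rw [lintegral_mul_const _ (by fun_prop), lintegral_enorm_sq, ENNReal.ofReal_mul (by positivity)]
  · refine Measurable.aemeasurable ?_
    have h1 : Measurable fun y : (Fin m → ℝ) × (Fin m → ℝ) => (starRingEnd ℂ) (a y.2) :=
      Complex.continuous_conj.measurable.comp (ha.comp measurable_snd)
    have h2 : Measurable fun y : (Fin m → ℝ) × (Fin m → ℝ) => b (y.2 - y.1) :=
      hb.comp (measurable_snd.sub measurable_fst)
    exact (h1.mul h2).enorm.pow_const 2

theorem continuous_inner_displacement {m : ℕ} (a b : H m) :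
    Continuous fun z : Phase m => inner ℂ a (displacement z b) :=
  continuous_const.inner (continuous_displacement b)

/-- Plancherel in `p` for each fixed `x`, then Tonelli in `x`; the factor `(2π)ᵐ` is that of
`fourierPi`. -/
theorem lintegral_enorm_sq_inner_displacement {m : ℕ} (a b : H m) :
    ∫⁻ z : Phase m, ‖inner ℂ a (displacement z b)‖ₑ ^ 2
      = ENNReal.ofReal ((2 * Real.pi) ^ m * (‖a‖ ^ 2 * ‖b‖ ^ 2)) := by
  -- The product `conj(a(q)) b(q - x)` is integrable for every `x`, but square-integrable only for
  -- almost every `x`, as Tonelli shows.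
  have hfin : ∀ᵐ x : Fin m → ℝ, ∫⁻ q, ‖(starRingEnd ℂ) (a q) * b (q - x)‖ₑ ^ 2 < ⊤ := by
    refine ae_lt_top' ?_ 
      (by rw [lintegral_lintegral_conj_mul_comp_sub]; exact ENNReal.ofReal_ne_top)
    have h1 : Measurable fun y : (Fin m → ℝ) × (Fin m → ℝ) => (starRingEnd ℂ) (a y.2) :=
      Complex.continuous_conj.measurable.comp
        ((Lp.stronglyMeasurable a).measurable.comp measurable_snd)
    have h2 : Measurable fun y : (Fin m → ℝ) × (Fin m → ℝ) => b (y.2 - y.1) :=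
      (Lp.stronglyMeasurable b).measurable.comp (measurable_snd.sub measurable_fst)
    exact (((h1.mul h2).enorm.pow_const 2).lintegral_prod_right' (ν := volume)).aemeasurable
  rw [Measure.volume_eq_prod, lintegral_prod _
    ((continuous_inner_displacement a b).measurable.enorm.pow_const 2).aemeasurable]
  have : ∀ᵐ x : Fin m → ℝ, ∫⁻ p : Fin m → ℝ, ‖inner ℂ a (displacement (x, p) b)‖ₑ ^ 2
      = ENNReal.ofReal ((2 * Real.pi) ^ m)
        * ∫⁻ q, ‖(starRingEnd ℂ) (a q) * b (q - x)‖ₑ ^ 2 := by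
    filter_upwards [hfin] with x hx
    have hint := integrable_conj_mul_comp_sub a b x
    have hL2 : MemLp (fun q => (starRingEnd ℂ) (a q) * b (q - x)) 2 volume := by
      refine ⟨hint.1, ?_⟩
      rw [eLpNorm_lt_top_iff_lintegral_rpow_enorm_lt_top (by norm_num) (by norm_num)]
      simpa using hx
    rw [← lintegral_enorm_sq_fourierPi hint hL2]
    refine lintegral_congr fun p => ?_
    rw [inner_displacement_eq_fourierPi, enorm_mul, ← ofReal_norm (ephase _), norm_ephase]
    simp
  rw [lintegral_congr_ae this, lintegral_const_mul' _ _ (by simp),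
    lintegral_lintegral_conj_mul_comp_sub, ← ENNReal.ofReal_mul (by positivity)]

theorem memLp_inner_displacement {m : ℕ} (a b : H m) :
    MemLp (fun z : Phase m => inner ℂ a (displacement z b)) 2 volume := by
  refine ⟨(continuous_inner_displacement a b).aestronglyMeasurable, ?_⟩
  rw [eLpNorm_lt_top_iff_lintegral_rpow_enorm_lt_top (by norm_num) (by norm_num)]
  simp only [ENNReal.toReal_ofNat, ENNReal.rpow_ofNat]
  rw [lintegral_enorm_sq_inner_displacement]
  exact ENNReal.ofReal_lt_top

theorem integrable_norm_sq_inner_displacement {m : ℕ} (a b : H m) :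
    Integrable (fun z : Phase m => ‖inner ℂ a (displacement z b)‖ ^ 2) :=
  (memLp_two_iff_integrable_sq_norm (memLp_inner_displacement a b).1).1
    (memLp_inner_displacement a b)

theorem integral_norm_sq_inner_displacement {m : ℕ} (a b : H m) :
    ∫ z : Phase m, ‖inner ℂ a (displacement z b)‖ ^ 2
      = (2 * Real.pi) ^ m * (‖a‖ ^ 2 * ‖b‖ ^ 2) := by
  have h := lintegral_enorm_sq_inner_displacement a b
  have e : ∀ z : Phase m, ‖inner ℂ a (displacement z b)‖ₑ ^ 2
      = ENNReal.ofReal (‖inner ℂ a (displacement z b)‖ ^ 2) := fun z => by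
    rw [ENNReal.ofReal_pow (norm_nonneg _), ofReal_norm]
  simp only [e] at h
  rw [← ofReal_integral_eq_lintegral_ofReal (integrable_norm_sq_inner_displacement a b)
    (Filter.Eventually.of_forall fun q => by positivity)] at h
  exact (ENNReal.ofReal_eq_ofReal_iff (integral_nonneg fun q => by positivity)
    (by positivity)).1 h

theorem integrable_moyal {m : ℕ} (a b c d : H m) :
    Integrable fun z : Phase m =>
      inner ℂ a (displacement z b) * inner ℂ (displacement z d) c := by
  have h : MemLp (fun z : Phase m => inner ℂ (displacement z d) c) 2 volume := by
    have := (memLp_inner_displacement c d).star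
    refine this.congr_norm ((continuous_displacement d).inner
      continuous_const).aestronglyMeasurable (Filter.Eventually.of_forall fun z => ?_)
    simp only [Pi.star_apply, norm_star]
    exact norm_inner_symm _ _
  exact (memLp_inner_displacement a b).integrable_mul h

/-- A sesquilinear form on a complex vector space that vanishes on the diagonal is zero. -/
theorem sesq_eq_zero_of_diag {V : Type*} [AddCommGroup V] [Module ℂ V] (B : V → V → ℂ)
    (add_left : ∀ x x' y, B (x + x') y = B x y + B x' y)
    (add_right : ∀ x y y', B x (y + y') = B x y + B x y')
    (I_left : ∀ x y, B (Complex.I • x) y = -Complex.I * B x y)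
    (I_right : ∀ x y, B x (Complex.I • y) = Complex.I * B x y)
    (diag : ∀ x, B x x = 0) (x y : V) : B x y = 0 := by
  have h1 := diag (x + y)
  have h2 := diag (x + Complex.I • y)
  simp only [add_left, add_right, I_left, I_right, diag, zero_add, add_zero, mul_zero] at h1 h2
  have h3 : Complex.I * (B x y - B y x) = 0 := by linear_combination h2
  have h4 := (mul_eq_zero.1 h3).resolve_left Complex.I_ne_zero
  linear_combination (h1 + h4) / 2

/-- The orthogonality relations of the displacement operators. -/
theorem integral_moyal {m : ℕ} (a b c d : H m) :
    ∫ z : Phase m, inner ℂ a (displacement z b) * inner ℂ (displacement z d) c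
      = (2 * Real.pi) ^ m * (inner ℂ a c * inner ℂ d b) := by
  -- On the diagonal `c = a`, `d = b` the claim is the norm identity. Polarizing in the pair `a, c`
  -- and then in `d, b` gives the general case.
  have diag : ∀ a b : H m,
      ∫ z : Phase m, inner ℂ a (displacement z b) * inner ℂ (displacement z b) a
        = (2 * Real.pi) ^ m * (inner ℂ a a * inner ℂ b b) := fun a b => by
    have e : ∀ z : Phase m, inner ℂ a (displacement z b) * inner ℂ (displacement z b) a
        = ((‖inner ℂ a (displacement z b)‖ ^ 2 : ℝ) : ℂ) := fun z => by
      rw [← inner_conj_symm (displacement z b) a, Complex.mul_conj, Complex.normSq_eq_norm_sq]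
    simp only [e]
    rw [integral_complex_ofReal, integral_norm_sq_inner_displacement, inner_self_eq_norm_sq_to_K,
      inner_self_eq_norm_sq_to_K]
    push_cast
    rfl
  have step : ∀ a b c : H m,
      (∫ z : Phase m, inner ℂ a (displacement z b) * inner ℂ (displacement z b) c)
        - (2 * Real.pi) ^ m * (inner ℂ a c * inner ℂ b b) = 0 := fun a b c => by
    refine sesq_eq_zero_of_diag (fun a c : H m =>
      (∫ z : Phase m, inner ℂ a (displacement z b) * inner ℂ (displacement z b) c)
        - (2 * Real.pi) ^ m * (inner ℂ a c * inner ℂ b b)) ?_ ?_ ?_ ?_ ?_ a c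
    · intro x x' y
      simp only [inner_add_left, add_mul]
      rw [integral_add (integrable_moyal _ _ _ _) (integrable_moyal _ _ _ _)]
      ring
    · intro x y y'
      simp only [inner_add_right, mul_add]
      rw [integral_add (integrable_moyal _ _ _ _) (integrable_moyal _ _ _ _)]
      ring
    · intro x y
      simp only [inner_smul_left, Complex.conj_I, mul_assoc]
      rw [integral_const_mul]
      ring
    · intro x y
      simp only [inner_smul_right, mul_left_comm _ Complex.I]
      rw [integral_const_mul]
      ring
    · intro x
      rw [diag, sub_self]
  have := sesq_eq_zero_of_diag (fun d b : H m =>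
      (∫ z : Phase m, inner ℂ a (displacement z b) * inner ℂ (displacement z d) c)
        - (2 * Real.pi) ^ m * (inner ℂ a c * inner ℂ d b)) ?_ ?_ ?_ ?_ ?_ d b
  · exact sub_eq_zero.1 this
  · intro x x' y
    simp only [inner_add_left, map_add, mul_add]
    rw [integral_add (integrable_moyal _ _ _ _) (integrable_moyal _ _ _ _)]
    ring
  · intro x y y'
    simp only [inner_add_right, map_add, add_mul, mul_add]
    rw [integral_add (integrable_moyal _ _ _ _) (integrable_moyal _ _ _ _)]
    ring
  · intro x y
    simp only [inner_smul_left, map_smul, Complex.conj_I, mul_left_comm _ (-Complex.I)]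
    rw [integral_const_mul]
    ring
  · intro x y
    simp only [inner_smul_right, map_smul, mul_assoc, mul_left_comm _ Complex.I]
    rw [integral_const_mul]
    ring
  · intro x
    exact step a x c

/-- A vector orthogonal to all displacements of a non-zero vector vanishes. -/
theorem eq_zero_of_inner_displacement_eq_zero {m : ℕ} {a b : H m} (hb : b ≠ 0)
    (h : ∀ z, inner ℂ a (displacement z b) = 0) : a = 0 := by
  have := integral_norm_sq_inner_displacement a b
  have hπ := Real.pi_pos
  simp only [h, norm_zero, ne_eq, OfNat.ofNat_ne_zero, not_false_eq_true, zero_pow,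
    integral_zero] at this
  have h2 : 0 < ‖b‖ := norm_pos_iff.2 hb
  have h3 : 0 < (2 * Real.pi) ^ m := by positivity
  by_contra ha
  have h4 : 0 < ‖a‖ := norm_pos_iff.2 ha
  have : 0 < (2 * Real.pi) ^ m * (‖a‖ ^ 2 * ‖b‖ ^ 2) := by positivity
  linarith

theorem finrank_phase (m : ℕ) : Module.finrank ℝ (Phase m) = m + m := by
  simp [Phase]

instance isAddHaarMeasure_volume_phase (m : ℕ) :
    (volume : Measure (Phase m)).IsAddHaarMeasure :=
  Measure.prod.instIsAddHaarMeasure _ _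

theorem integrable_moyal_phasePoint {m : ℕ} (a b c d : H m) :
    Integrable fun z : Phase m => inner ℂ a (phasePoint z b) * inner ℂ (phasePoint z d) c := by
  have h := ((integrable_moyal a (parity m b) c (parity m d)).comp_smul
    (two_ne_zero (α := ℝ))).const_mul
      ((((Real.pi ^ m)⁻¹ : ℝ) : ℂ) * (((Real.pi ^ m)⁻¹ : ℝ) : ℂ))
  refine h.congr (Filter.Eventually.of_forall fun z => ?_)
  simp only [phasePoint_apply, inner_smul_left, inner_smul_right, Complex.conj_ofReal]
  ring

/-- The orthogonality relations of the phase point operators. -/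
theorem integral_moyal_phasePoint {m : ℕ} (a b c d : H m) :
    ∫ z : Phase m, inner ℂ a (phasePoint z b) * inner ℂ (phasePoint z d) c
      = (((2 * Real.pi) ^ m)⁻¹ : ℂ) * (inner ℂ a c * inner ℂ d b) := by
  have hπ : (Real.pi : ℂ) ≠ 0 := by exact_mod_cast Real.pi_ne_zero
  have e : ∀ z : Phase m, inner ℂ a (phasePoint z b) * inner ℂ (phasePoint z d) c
      = ((((Real.pi ^ m)⁻¹ : ℝ) : ℂ) * (((Real.pi ^ m)⁻¹ : ℝ) : ℂ)) *
        (fun w => inner ℂ a (displacement w (parity m b))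
          * inner ℂ (displacement w (parity m d)) c) ((2 : ℝ) • z) := fun z => by
    simp only [phasePoint_apply, inner_smul_left, inner_smul_right, Complex.conj_ofReal]
    ring
  simp only [e]
  -- Substituting `w = 2z` on a space of dimension `2m` costs `2^(-2m)`, and `π^(-2m) · 2^(-2m) ·
  -- (2π)^m = (2π)^(-m)`.
  rw [integral_const_mul, Measure.integral_comp_smul volume (fun w : Phase m =>
    inner ℂ a (displacement w (parity m b)) * inner ℂ (displacement w (parity m d)) c),
    integral_moyal, inner_parity_parity,
    finrank_phase, Complex.real_smul, abs_of_pos (by positivity)]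
  push_cast
  rw [mul_pow, pow_add]
  field_simp

/-- Absolute version of the orthogonality relations. -/
theorem integral_norm_moyal_le {m : ℕ} (a b c d : H m) :
    ∫ z : Phase m, ‖inner ℂ a (displacement z b)‖ * ‖inner ℂ (displacement z d) c‖
      ≤ (2 * Real.pi) ^ m * (‖a‖ * ‖b‖ * (‖c‖ * ‖d‖)) := by
  have hπ := Real.pi_pos
  have h1 : MemLp (fun z : Phase m => ‖inner ℂ a (displacement z b)‖) (ENNReal.ofReal 2) volume := by
    simpa using (memLp_inner_displacement a b).norm
  have h2 : MemLp (fun z : Phase m => ‖inner ℂ (displacement z d) c‖) (ENNReal.ofReal 2) volume := by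
    have := (memLp_inner_displacement c d).norm
    simpa [norm_inner_symm] using this
  -- Cauchy–Schwarz between two functions whose `L²` norms are known exactly.
  have := integral_mul_le_Lp_mul_Lq_of_nonneg (Real.HolderConjugate.two_two)
    (Filter.Eventually.of_forall fun z => norm_nonneg _)
    (Filter.Eventually.of_forall fun z => norm_nonneg _) h1 h2
  refine this.trans (le_of_eq ?_)
  have e2 : ∀ z : Phase m, ‖inner ℂ (displacement z d) c‖ = ‖inner ℂ c (displacement z d)‖ :=
    fun z => norm_inner_symm _ _
  simp only [e2, Real.rpow_two, integral_norm_sq_inner_displacement, ← Real.sqrt_eq_rpow]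
  rw [← Real.sqrt_mul (by positivity), show (2 * Real.pi) ^ m * (‖a‖ ^ 2 * ‖b‖ ^ 2) *
    ((2 * Real.pi) ^ m * (‖c‖ ^ 2 * ‖d‖ ^ 2))
      = ((2 * Real.pi) ^ m * (‖a‖ * ‖b‖ * (‖c‖ * ‖d‖))) ^ 2 by ring, Real.sqrt_sq (by positivity)]

/-! ### The vacuum -/

/-- The squared Euclidean norm on phase space. -/
def phaseNormSq {m : ℕ} (z : Phase m) : ℝ := ∑ j, (z.1 j ^ 2 + z.2 j ^ 2)

theorem phaseNormSq_nonneg {m : ℕ} (z : Phase m) : 0 ≤ phaseNormSq z :=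
  Finset.sum_nonneg fun j _ => by positivity

theorem phaseNormSq_smul {m : ℕ} (c : ℝ) (z : Phase m) :
    phaseNormSq (c • z) = c ^ 2 * phaseNormSq z := by
  simp only [phaseNormSq, Finset.mul_sum]
  exact Finset.sum_congr rfl fun j _ => by simp; ring

theorem phaseNormSq_neg {m : ℕ} (z : Phase m) : phaseNormSq (-z) = phaseNormSq z := by
  simpa using phaseNormSq_smul (-1) z

theorem prod_vacuumFun {k : ℕ} (q : Fin k → ℝ) :
    ∏ j, vacuumFun (q j)
      = (Real.pi ^ (-(1 / 4) : ℝ)) ^ k * Real.exp (-(∑ j, q j ^ 2) / 2) := by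
  simp only [vacuumFun, Finset.prod_mul_distrib, Finset.prod_const, Finset.card_univ,
    Fintype.card_fin, ← Real.exp_sum]
  congr 2
  rw [← Finset.sum_neg_distrib, Finset.sum_div]

theorem coeFn_vacuum (k : ℕ) :
    vacuum k =ᵐ[volume] fun q => ((∏ j, vacuumFun (q j) : ℝ) : ℂ) :=
  MemLp.coeFn_toLp _

theorem cpow_half_mul_self (m : ℕ) :
    (Real.pi : ℂ) ^ ((m : ℂ) / 2) * (Real.pi : ℂ) ^ ((m : ℂ) / 2) = (Real.pi : ℂ) ^ m := by
  rw [← Complex.cpow_add _ _ (by exact_mod_cast Real.pi_ne_zero), add_halves, Complex.cpow_natCast]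

theorem integral_gaussian_pi {m : ℕ} (c : Fin m → ℂ) :
    ∫ q : Fin m → ℝ, Complex.exp (-(∑ j, (q j : ℂ) ^ 2) + ∑ j, c j * q j)
      = (Real.pi : ℂ) ^ ((m : ℂ) / 2) * Complex.exp ((∑ j, c j ^ 2) / 4) := by
  have := GaussianFourier.integral_cexp_neg_mul_sum_add (ι := Fin m) (b := 1) (by simp) c
  simpa using this

/-- A Gaussian integral with complex linear coefficient `x + ip`: completing the square gives `(x +
ip)²/4 - x²/2 - i x p/2 = -(x² + p²)/4` in each mode. -/
theorem inner_vacuum_displacement {m : ℕ} (z : Phase m) :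
    inner ℂ (vacuum m) (displacement z (vacuum m)) = (Real.exp (-phaseNormSq z / 4) : ℂ) := by
  have hv : ∀ᵐ q : Fin m → ℝ, vacuum m (q - z.1)
      = ((∏ j, vacuumFun ((q - z.1) j) : ℝ) : ℂ) :=
    (measurePreserving_sub_right volume z.1).quasiMeasurePreserving.ae (coeFn_vacuum m)
  have hc : ((Real.pi ^ (-(1 / 4) : ℝ)) ^ m * (Real.pi ^ (-(1 / 4) : ℝ)) ^ m : ℝ)
      * (Real.pi : ℂ) ^ ((m : ℂ) / 2) = 1 := by
    have hπ := Real.pi_pos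
    have : (Real.pi : ℂ) ^ ((m : ℂ) / 2) = ((Real.pi ^ ((m : ℝ) / 2) : ℝ) : ℂ) := by
      rw [Complex.ofReal_cpow hπ.le]; push_cast; rfl
    rw [this, ← Complex.ofReal_mul, ← Real.rpow_natCast, ← Real.rpow_mul hπ.le,
      ← Real.rpow_add hπ, ← Real.rpow_add hπ]
    norm_num
    rw [show -(1 / 4 * (m : ℝ)) + -(1 / 4 * (m : ℝ)) + (m : ℝ) / 2 = 0 by ring, Real.rpow_zero]
  have e : (fun q => inner ℂ (vacuum m q) (displacement z (vacuum m) q)) =ᵐ[volume] fun q =>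
      (((Real.pi ^ (-(1 / 4) : ℝ)) ^ m * (Real.pi ^ (-(1 / 4) : ℝ)) ^ m : ℝ) : ℂ) *
      Complex.exp (-(∑ j, (z.1 j : ℂ) ^ 2) / 2 - (∑ j, (z.1 j : ℂ) * z.2 j) / 2 * Complex.I) *
      Complex.exp (-(∑ j, (q j : ℂ) ^ 2) + ∑ j, ((z.1 j : ℂ) + z.2 j * Complex.I) * q j) := by
    filter_upwards [coeFn_displacement z (vacuum m), hv, coeFn_vacuum m] with q h1 h2 h3
    rw [h1, h2, h3, RCLike.inner_apply, prod_vacuumFun, prod_vacuumFun, dispPhase]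
    simp only [Complex.ofReal_mul, map_mul, Complex.conj_ofReal]
    simp only [Complex.ofReal_exp]
    rw [mul_assoc _ (Complex.exp _) (Complex.exp _), ← Complex.exp_add]
    rw [show ∀ a b c d e : ℂ, a * (b * c) * (d * e) = b * d * (a * c * e) from
      fun a b c d e => by ring, ← Complex.exp_add, ← Complex.exp_add]
    congr 2
    simp only [Pi.sub_apply, sub_sq, add_mul, Finset.sum_add_distrib, Finset.sum_sub_distrib]
    push_cast
    have : ∑ j, 2 * (q j : ℂ) * (z.1 j : ℂ) = 2 * ∑ j, (z.1 j : ℂ) * (q j : ℂ) := by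
      rw [Finset.mul_sum]; exact Finset.sum_congr rfl fun j _ => by ring
    rw [this]
    have h' : ∑ j, (z.2 j : ℂ) * Complex.I * (q j : ℂ)
        = (∑ j, (z.2 j : ℂ) * (q j : ℂ)) * Complex.I := by
      rw [Finset.sum_mul]; exact Finset.sum_congr rfl fun j _ => by ring
    rw [h']
    ring
  rw [L2.inner_def, integral_congr_ae e, integral_const_mul, integral_gaussian_pi,
    show ∀ a b c d : ℂ, a * b * (c * d) = a * c * (b * d) from fun a b c d => by ring, hc, one_mul,
    ← Complex.exp_add, Complex.ofReal_exp]
  congr 1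
  simp only [phaseNormSq, add_sq, mul_pow, Complex.I_sq, Finset.sum_add_distrib]
  push_cast
  have : ∑ j, 2 * (z.1 j : ℂ) * ((z.2 j : ℂ) * Complex.I)
      = 2 * (∑ j, (z.1 j : ℂ) * (z.2 j : ℂ)) * Complex.I := by
    rw [Finset.mul_sum, Finset.sum_mul]; exact Finset.sum_congr rfl fun j _ => by ring
  rw [this]
  simp only [mul_neg, mul_one, Finset.sum_neg_distrib]
  ring

theorem norm_vacuum (m : ℕ) : ‖vacuum m‖ = 1 := by
  have := inner_vacuum_displacement (0 : Phase m)
  rw [displacement_zero, inner_self_eq_norm_sq_to_K] at this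
  have h : phaseNormSq (0 : Phase m) = 0 := by simp [phaseNormSq]
  rw [h] at this
  simp only [neg_zero, zero_div, Real.exp_zero, Complex.ofReal_one] at this
  have h2 : ‖vacuum m‖ ^ 2 = 1 := by
    apply Complex.ofReal_injective
    simpa using this
  nlinarith [norm_nonneg (vacuum m)]

theorem vacuum_ne_zero (m : ℕ) : vacuum m ≠ 0 := by
  intro h
  have := norm_vacuum m
  rw [h, norm_zero] at this
  exact zero_ne_one this

theorem parity_vacuum (m : ℕ) : parity m (vacuum m) = vacuum m := by
  apply Lp.ext
  have h2 : ∀ᵐ q : Fin m → ℝ, vacuum m (-q) = ((∏ j, vacuumFun ((-q) j) : ℝ) : ℂ) :=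
    (Measure.measurePreserving_neg volume).quasiMeasurePreserving.ae (coeFn_vacuum m)
  filter_upwards [coeFn_parity (vacuum m), h2, coeFn_vacuum m] with q h1 h2 h3
  rw [h1, h2, h3]
  simp [vacuumFun]

/-- The Wigner function of the vacuum. -/
def vacuumWigner {m : ℕ} (z : Phase m) : ℝ := (Real.pi ^ m)⁻¹ * Real.exp (-phaseNormSq z)

theorem inner_vacuum_phasePoint {m : ℕ} (z : Phase m) :
    inner ℂ (vacuum m) (phasePoint z (vacuum m)) = (vacuumWigner z : ℂ) := by
  rw [phasePoint_apply, parity_vacuum, inner_smul_right, inner_vacuum_displacement,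
    phaseNormSq_smul, vacuumWigner]
  push_cast
  ring_nf

theorem vacuumWigner_nonneg {m : ℕ} (z : Phase m) : 0 ≤ vacuumWigner z := by
  have := Real.pi_pos
  unfold vacuumWigner; positivity

theorem vacuumWigner_neg {m : ℕ} (z : Phase m) : vacuumWigner (-z) = vacuumWigner z := by
  rw [vacuumWigner, phaseNormSq_neg, vacuumWigner]

/-- The symplectic Fourier transform of a Gaussian. -/
theorem integral_gaussian_phase {m : ℕ} (ζ : Phase m) :
    ∫ z : Phase m, (Real.exp (-phaseNormSq z) : ℂ) * ephase (symp ζ z)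
      = (Real.pi : ℂ) ^ m * Real.exp (-phaseNormSq ζ / 4) := by
  have e : ∀ z : Phase m, (Real.exp (-phaseNormSq z) : ℂ) * ephase (symp ζ z)
      = Complex.exp (-(∑ j, (z.1 j : ℂ) ^ 2) + ∑ j, (-(ζ.2 j : ℂ) * Complex.I) * z.1 j) *
        Complex.exp (-(∑ j, (z.2 j : ℂ) ^ 2) + ∑ j, ((ζ.1 j : ℂ) * Complex.I) * z.2 j) := by
    intro z
    rw [ephase, Complex.ofReal_exp, ← Complex.exp_add, ← Complex.exp_add]
    congr 1
    simp only [phaseNormSq, symp, Finset.sum_add_distrib, Finset.sum_sub_distrib]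
    push_cast
    rw [sub_mul, Finset.sum_mul, Finset.sum_mul]
    have h1 : ∑ j, -(ζ.2 j : ℂ) * Complex.I * (z.1 j : ℂ)
        = -∑ j, (ζ.2 j : ℂ) * (z.1 j : ℂ) * Complex.I := by
      rw [← Finset.sum_neg_distrib]; exact Finset.sum_congr rfl fun j _ => by ring
    have h2 : ∑ j, (ζ.1 j : ℂ) * Complex.I * (z.2 j : ℂ)
        = ∑ j, (ζ.1 j : ℂ) * (z.2 j : ℂ) * Complex.I :=
      Finset.sum_congr rfl fun j _ => by ring
    rw [h1, h2]
    ring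
  simp only [e]
  rw [Measure.volume_eq_prod, integral_prod_mul
    (fun x : Fin m → ℝ => Complex.exp (-(∑ j, (x j : ℂ) ^ 2)
      + ∑ j, (-(ζ.2 j : ℂ) * Complex.I) * x j))
    (fun p : Fin m → ℝ => Complex.exp (-(∑ j, (p j : ℂ) ^ 2) + ∑ j, ((ζ.1 j : ℂ) * Complex.I) * p j)),
    integral_gaussian_pi, integral_gaussian_pi,
    show ∀ a b c : ℂ, a * b * (a * c) = a * a * (b * c) from fun a b c => by ring,
    cpow_half_mul_self, ← Complex.exp_add, Complex.ofReal_exp]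
  congr 2
  simp only [phaseNormSq, mul_pow, Complex.I_sq, neg_sq, mul_neg, mul_one, Finset.sum_neg_distrib]
  push_cast
  rw [Finset.sum_add_distrib]
  ring

theorem integral_ofReal_vacuumWigner (m : ℕ) : ∫ z : Phase m, (vacuumWigner z : ℂ) = 1 := by
  have h := integral_gaussian_phase (0 : Phase m)
  have h0 : ∀ z : Phase m, symp 0 z = 0 := fun z => by simp [symp]
  have h1 : phaseNormSq (0 : Phase m) = 0 := by simp [phaseNormSq]
  simp only [h0, ephase_zero, mul_one, h1, neg_zero, zero_div, Real.exp_zero,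
    Complex.ofReal_one] at h
  simp only [vacuumWigner, Complex.ofReal_mul]
  rw [integral_const_mul, h]
  push_cast
  exact inv_mul_cancel₀ (pow_ne_zero _ (by exact_mod_cast Real.pi_ne_zero))

theorem integral_vacuumWigner (m : ℕ) : ∫ z : Phase m, vacuumWigner z = 1 := by
  have := integral_ofReal_vacuumWigner m
  rw [integral_complex_ofReal] at this
  exact_mod_cast this

theorem integrable_vacuumWigner (m : ℕ) :
    Integrable (vacuumWigner : Phase m → ℝ) := by
  -- The integral of a non-integrable function is `0` by convention, so having integral `1` already
  -- forces integrability.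
  by_contra h
  have := integral_vacuumWigner m
  rw [integral_undef h] at this
  exact zero_ne_one this

/-! ### Countability of bases -/

/-- Distinct basis vectors have distance `√2`, so balls of radius `1/2` around them are disjoint
open sets in a separable space. -/
theorem HilbertBasis.countable_index {ι V : Type*} [NormedAddCommGroup V] [InnerProductSpace ℂ V]
    [TopologicalSpace.SeparableSpace V] (b : HilbertBasis ι ℂ V) : Countable ι := by
  have hd : ∀ i j, i ≠ j → 1 ≤ dist (b i) (b j) := fun i j hij => by
    have h := b.orthonormal
    have h2 : ‖b i - b j‖ ^ 2 = 2 := by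
      rw [@norm_sub_sq ℂ, h.2 hij, h.1, h.1]; norm_num
    rw [dist_eq_norm]
    nlinarith [norm_nonneg (b i - b j)]
  refine Pairwise.countable_of_isOpen_disjoint (s := fun i => Metric.ball (b i) (1 / 2))
    (fun i j hij => ?_) (fun i => Metric.isOpen_ball) fun i => ⟨b i, by simp⟩
  exact Metric.ball_disjoint_ball (by linarith [hd i j hij])

instance fact_two_ne_top : Fact ((2 : ENNReal) ≠ ⊤) := ⟨by norm_num⟩

instance countable_basisIndex (m : ℕ) : Countable (basisIndex m) :=
  HilbertBasis.countable_index (basis m)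

/-! ### Sums of rank one operators -/

section HilbertSpace

variable {V : Type*} [NormedAddCommGroup V] [InnerProductSpace ℂ V]

theorem mul_le_half_add_sq (a b : ℝ) : a * b ≤ (a ^ 2 + b ^ 2) / 2 := by
  nlinarith [sq_nonneg (a - b)]

theorem summable_norm_mul_norm {ι W W' : Type*} [SeminormedAddCommGroup W]
    [SeminormedAddCommGroup W'] {u : ι → W} {v : ι → W'}
    (hu : Summable fun k => ‖u k‖ ^ 2) (hv : Summable fun k => ‖v k‖ ^ 2) :
    Summable fun k => ‖u k‖ * ‖v k‖ :=
  Summable.of_nonneg_of_le (fun _ => by positivity) (fun _ => mul_le_half_add_sq _ _)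
    ((hu.add hv).div_const 2)

theorem summable_norm_sq_map {ι W : Type*} [NormedAddCommGroup W] [InnerProductSpace ℂ W]
    {u : ι → V} (hu : Summable fun k => ‖u k‖ ^ 2) (X : V →L[ℂ] W) :
    Summable fun k => ‖X (u k)‖ ^ 2 :=
  Summable.of_nonneg_of_le (fun _ => by positivity)
    (fun _ => by rw [← mul_pow]; gcongr; exact X.le_opNorm _) (hu.mul_left (‖X‖ ^ 2))

theorem summable_inner {ι : Type*} {u v : ι → V}
    (hu : Summable fun k => ‖u k‖ ^ 2) (hv : Summable fun k => ‖v k‖ ^ 2) :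
    Summable fun k => inner ℂ (v k) (u k) :=
  Summable.of_norm_bounded (summable_norm_mul_norm hv hu) fun _ => norm_inner_le_norm _ _

theorem hasSum_norm_sq_inner {κ : Type*} (b : HilbertBasis κ ℂ V) (x : V) :
    HasSum (fun i => ‖inner ℂ (b i) x‖ ^ 2) (‖x‖ ^ 2) := by
  have h := b.hasSum_inner_mul_inner x x
  have e : ∀ i, inner ℂ x (b i) * inner ℂ (b i) x = ((‖inner ℂ (b i) x‖ ^ 2 : ℝ) : ℂ) := fun i => by
    rw [← inner_conj_symm x (b i), mul_comm, Complex.mul_conj, Complex.normSq_eq_norm_sq]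
  simp only [e, inner_self_eq_norm_sq_to_K] at h
  have h2 : HasSum (fun i => ((‖inner ℂ (b i) x‖ ^ 2 : ℝ) : ℂ)) ((‖x‖ ^ 2 : ℝ) : ℂ) := by
    simpa using h
  exact Complex.hasSum_ofReal.1 h2

/-- Absolute convergence of the double series for the trace, which permits exchanging the sum over
the basis with the sum over the rank one terms. -/
theorem summable_trace_norm {ι κ : Type*} (b : HilbertBasis κ ℂ V) {u v : ι → V}
    (hu : Summable fun k => ‖u k‖ ^ 2) (hv : Summable fun k => ‖v k‖ ^ 2) :
    Summable fun p : ι × κ => ‖inner ℂ (b p.2) (u p.1)‖ * ‖inner ℂ (v p.1) (b p.2)‖ := by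
  have hx : ∀ x : V, Summable fun i => ‖inner ℂ (b i) x‖ ^ 2 := fun x =>
    (hasSum_norm_sq_inner b x).summable
  have key : ∀ {w : ι → V}, (Summable fun k => ‖w k‖ ^ 2) →
      Summable fun p : ι × κ => ‖inner ℂ (b p.2) (w p.1)‖ ^ 2 := fun {w} hw => by
    rw [summable_prod_of_nonneg fun p => by positivity]
    refine ⟨fun k => hx (w k), ?_⟩
    simpa only [(hasSum_norm_sq_inner b _).tsum_eq] using hw
  refine Summable.of_nonneg_of_le (fun p => by positivity) (fun p => mul_le_half_add_sq _ _)
    (((key hu).add (key hv)).div_const 2 |>.congr fun p => ?_)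
  rw [norm_inner_symm (v p.1)]

/-- The trace of `∑ k, |u k⟩⟨v k|` does not depend on the basis. -/
theorem tsum_tsum_inner_mul_inner {ι κ : Type*} (b : HilbertBasis κ ℂ V) {u v : ι → V}
    (hu : Summable fun k => ‖u k‖ ^ 2) (hv : Summable fun k => ‖v k‖ ^ 2) :
    ∑' i, ∑' k, inner ℂ (b i) (u k) * inner ℂ (v k) (b i) = ∑' k, inner ℂ (v k) (u k) := by
  have hs : Summable fun p : ι × κ => inner ℂ (b p.2) (u p.1) * inner ℂ (v p.1) (b p.2) :=
    Summable.of_norm ((summable_trace_norm b hu hv).congr fun p => (norm_mul _ _).symm)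
  have h2 : Summable (Function.uncurry fun (i : κ) (k : ι) =>
      inner ℂ (b i) (u k) * inner ℂ (v k) (b i)) := hs.prod_symm
  rw [← h2.tsum_comm]
  refine tsum_congr fun k => ?_
  rw [← b.tsum_inner_mul_inner (v k) (u k)]
  exact tsum_congr fun i => mul_comm _ _

end HilbertSpace

/-! ### Trace class Weyl quantization -/

/-- The Weyl quantization `∫ φ(z) A_z dz` of an integrable function `φ` is the trace class operator
`∑ k, |u k⟩⟨v k|`. -/
structure IsWeylSum {m : ℕ} {ι : Type*} (φ : Phase m → ℂ) (u v : ι → H m) : Prop where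
  integrable : Integrable φ
  summable_left : Summable fun k => ‖u k‖ ^ 2
  summable_right : Summable fun k => ‖v k‖ ^ 2
  tsum_eq : ∀ f g : H m,
    ∑' k, inner ℂ f (u k) * inner ℂ (v k) g = ∫ z, φ z * inner ℂ f (phasePoint z g)

theorem inner_displacement_vacuum_phasePoint {m : ℕ} (w z : Phase m) :
    inner ℂ (displacement w (vacuum m)) (phasePoint z (displacement w (vacuum m)))
      = (vacuumWigner (z - w) : ℂ) := by
  rw [inner_displacement_phasePoint, inner_vacuum_phasePoint]

/-- The resolution of the identity into coherent states `D(w)|0⟩`, a special case of the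
orthogonality relations. -/
theorem inner_eq_integral_coherent {m : ℕ} (f g : H m) :
    inner ℂ f g = (((2 * Real.pi) ^ m)⁻¹ : ℂ) * ∫ w : Phase m,
      inner ℂ f (displacement w (vacuum m)) * inner ℂ (displacement w (vacuum m)) g := by
  have hπ : (2 * Real.pi : ℂ) ^ m ≠ 0 := by
    exact_mod_cast (pow_pos (by positivity : 0 < 2 * Real.pi) m).ne'
  rw [integral_moyal, inner_self_eq_norm_sq_to_K, norm_vacuum]
  field_simp
  simp

namespace IsWeylSum

variable {m : ℕ} {ι : Type*} {φ : Phase m → ℂ} {u v : ι → H m}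

/-- The characteristic function of a trace class Weyl quantization. -/
theorem tsum_inner_displacement [Countable ι] (h : IsWeylSum φ u v) (ζ : Phase m) :
    ∑' k, inner ℂ (v k) (displacement ζ (u k))
      = (((2 * Real.pi) ^ m)⁻¹ : ℂ) * ∫ z, φ z * ephase (-symp ζ z) := by
  have hπ := Real.pi_pos
  -- The operators `A_z` are not trace class, so the trace cannot simply be moved under `∫ φ(z) …
  -- dz`. Computing it in coherent states helps: the diagonal element of `A_z` there is the vacuum
  -- Wigner function, integrable in `w` with integral `1`, and Fubini becomes legitimate.
  have h1 : ∀ k, inner ℂ (v k) (displacement ζ (u k)) = (((2 * Real.pi) ^ m)⁻¹ : ℂ) *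
      ∫ w : Phase m, inner ℂ (v k) (displacement w (vacuum m))
        * inner ℂ (displacement w (vacuum m)) (displacement ζ (u k)) := fun k =>
    inner_eq_integral_coherent _ _
  simp only [h1]
  rw [tsum_mul_left]
  congr 1
  rw [integral_tsum_of_summable_integral_norm (fun k =>
    integrable_moyal (v k) (vacuum m) (displacement ζ (u k)) (vacuum m))]
  swap
  · refine Summable.of_nonneg_of_le (fun k => integral_nonneg fun w => norm_nonneg _) (fun k => ?_)
      ((summable_norm_mul_norm h.summable_right h.summable_left).mul_left ((2 * Real.pi) ^ m))
    simp only [norm_mul]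
    refine (integral_norm_moyal_le _ _ _ _).trans (le_of_eq ?_)
    rw [norm_vacuum, norm_displacement]; ring
  have h2 : ∀ w : Phase m, ∑' k, inner ℂ (v k) (displacement w (vacuum m))
        * inner ℂ (displacement w (vacuum m)) (displacement ζ (u k))
      = ∫ z, φ z * ephase (-symp ζ z) * (vacuumWigner (w - z - (1 / 2 : ℝ) • ζ) : ℂ) := fun w => by
    have := h.tsum_eq (displacement (-ζ) (displacement w (vacuum m)))
      (displacement w (vacuum m))
    simp only [inner_displacement_left (-ζ), neg_neg, displacement_phasePoint', inner_smul_right,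
      inner_displacement_vacuum_phasePoint] at this
    rw [← tsum_congr fun k => mul_comm _ _, this]
    refine integral_congr_ae (Filter.Eventually.of_forall fun z => ?_)
    simp only
    rw [mul_assoc, ← vacuumWigner_neg]
    congr 4
    abel
  simp only [h2]
  have hφ : Integrable fun z => φ z * ephase (-symp ζ z) :=
    h.integrable.mul_bdd (c := 1)
      (continuous_ephase.comp (continuous_symp ζ).neg).aestronglyMeasurable
      (Filter.Eventually.of_forall fun z => by simp)
  have hW : Integrable fun y : Phase m => (vacuumWigner (y - (1 / 2 : ℝ) • ζ) : ℂ) :=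
    ((integrable_vacuumWigner m).comp_sub_right _).ofReal
  -- The integrand is that of a convolution of two integrable functions. The inner integral over `w`
  -- is a translate of the vacuum Wigner function, hence `1`.
  rw [integral_integral_swap (hφ.convolution_integrand (ContinuousLinearMap.mul ℂ ℂ) hW)]
  refine integral_congr_ae (Filter.Eventually.of_forall fun z => ?_)
  simp only
  rw [integral_const_mul, integral_sub_right_eq_self
    (fun y : Phase m => (vacuumWigner (y - (1 / 2 : ℝ) • ζ) : ℂ)) z, integral_sub_right_eq_self
    (fun y : Phase m => (vacuumWigner y : ℂ)), integral_ofReal_vacuumWigner, mul_one]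

theorem tsum_inner [Countable ι] (h : IsWeylSum φ u v) :
    ∑' k, inner ℂ (v k) (u k) = (((2 * Real.pi) ^ m)⁻¹ : ℂ) * ∫ z, φ z := by
  have := h.tsum_inner_displacement 0
  simpa [symp] using this

theorem comp_sub (h : IsWeylSum φ u v) (w : Phase m) :
    IsWeylSum (fun z => φ (z - w)) (fun k => displacement w (u k))
      (fun k => displacement w (v k)) where
  integrable := h.integrable.comp_sub_right w
  summable_left := by simpa using h.summable_left
  summable_right := by simpa using h.summable_right
  tsum_eq f g := by
    have := h.tsum_eq (displacement (-w) f) (displacement (-w) g)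
    simp only [inner_displacement_phasePoint, sub_neg_eq_add] at this
    simp only [inner_displacement_left w, inner_displacement_right w, this]
    rw [← integral_sub_right_eq_self _ w]
    simp

/-- The trace of `M ∫ φ(z) A_z dz`, computed in any basis. -/
theorem tsum_basis {κ : Type*} (b : HilbertBasis κ ℂ (H m)) (h : IsWeylSum φ u v)
    (M : H m →L[ℂ] H m) :
    ∑' i, ∫ z, φ z * inner ℂ (b i) (M (phasePoint z (b i))) = ∑' k, inner ℂ (v k) (M (u k)) := by
  rw [← tsum_tsum_inner_mul_inner b (summable_norm_sq_map h.summable_left M) h.summable_right]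
  refine tsum_congr fun i => ?_
  simp only [← ContinuousLinearMap.adjoint_inner_left M]
  exact (h.tsum_eq _ _).symm

end IsWeylSum

/-- A bounded operator has non-negative Wigner function, tested on all non-negative integrable
functions with trace class Weyl quantization. -/
def StrongWignerNonneg {m : ℕ} (M : H m →L[ℂ] H m) : Prop :=
  ∀ (ι : Type) [Countable ι] (φ : Phase m → ℝ) (u v : ι → H m), (∀ z, 0 ≤ φ z) →
    IsWeylSum (fun z => (φ z : ℂ)) u v → 0 ≤ (∑' k, inner ℂ (v k) (M (u k))).re

/-! ### Composite systems -/

/-- The configuration of the first `n` of `n + l` modes. -/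
def confFst {n l : ℕ} (q : Fin (n + l) → ℝ) : Fin n → ℝ := fun i => q (Fin.castAdd l i)

/-- The configuration of the last `l` of `n + l` modes. -/
def confSnd {n l : ℕ} (q : Fin (n + l) → ℝ) : Fin l → ℝ := fun j => q (Fin.natAdd n j)

theorem measurable_confFst (n l : ℕ) :
    Measurable (confFst : (Fin (n + l) → ℝ) → Fin n → ℝ) := by
  unfold confFst; fun_prop

theorem measurable_confSnd (n l : ℕ) :
    Measurable (confSnd : (Fin (n + l) → ℝ) → Fin l → ℝ) := by
  unfold confSnd; fun_prop

/-- The phase space coordinates of the first `n` of `n + l` modes. -/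
def phaseFst {n l : ℕ} (z : Phase (n + l)) : Phase n := (confFst z.1, confFst z.2)

/-- The phase space coordinates of the last `l` of `n + l` modes. -/
def phaseSnd {n l : ℕ} (z : Phase (n + l)) : Phase l := (confSnd z.1, confSnd z.2)

/-- The phase space of a composite system is the product of the phase spaces. -/
def phaseSplit (n l : ℕ) : Phase (n + l) ≃ᵐ Phase n × Phase l where
  toFun z := (phaseFst z, phaseSnd z)
  invFun w := (Fin.append w.1.1 w.2.1, Fin.append w.1.2 w.2.2)
  left_inv z := by
    refine Prod.ext ?_ ?_ <;>
    · funext i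
      refine Fin.addCases (fun i => ?_) (fun i => ?_) i <;>
        simp [phaseFst, phaseSnd, confFst, confSnd]
  right_inv w := by
    refine Prod.ext (Prod.ext ?_ ?_) (Prod.ext ?_ ?_) <;>
    · funext i
      simp [phaseFst, phaseSnd, confFst, confSnd]
  measurable_toFun := by
    have h1 := measurable_confFst n l
    have h2 := measurable_confSnd n l
    simp only [phaseFst, phaseSnd, Equiv.coe_fn_mk]
    fun_prop
  measurable_invFun := by
    refine Measurable.prodMk ?_ ?_ <;>
    · refine measurable_pi_iff.2 fun i => ?_
      refine Fin.addCases (fun i => ?_) (fun i => ?_) i <;>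
      · simp only [Fin.append_left, Fin.append_right]
        fun_prop

theorem measurePreserving_conf (n l : ℕ) :
    MeasurePreserving (fun q : Fin (n + l) → ℝ => (confFst q, confSnd q)) volume volume :=
  measurePreserving_split n l

theorem measurePreserving_prod_comm {α β γ δ : Type*} [MeasureSpace α] [MeasureSpace β]
    [MeasureSpace γ] [MeasureSpace δ] [SFinite (volume : Measure α)]
    [SFinite (volume : Measure β)] [SFinite (volume : Measure γ)] [SFinite (volume : Measure δ)] :
    MeasurePreserving (fun p : (α × β) × (γ × δ) => ((p.1.1, p.2.1), (p.1.2, p.2.2)))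
      volume volume := by
  have h1 : MeasurePreserving (fun p : (α × β) × (γ × δ) => (p.1.1, (p.1.2, p.2))) volume volume :=
    measurePreserving_prodAssoc (volume : Measure α) (volume : Measure β)
      (volume : Measure (γ × δ))
  have h2 : MeasurePreserving (fun p : β × (γ × δ) => (p.2.1, (p.1, p.2.2))) volume volume := by
    have a := (measurePreserving_prodAssoc (volume : Measure β) (volume : Measure γ)
      (volume : Measure δ)).symm
    have b := (Measure.measurePreserving_swap (μ := (volume : Measure β))
      (ν := (volume : Measure γ))).prod (MeasurePreserving.id (volume : Measure δ))
    have c := measurePreserving_prodAssoc (volume : Measure γ) (volume : Measure β)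
      (volume : Measure δ)
    exact c.comp (b.comp a)
  have h3 := (MeasurePreserving.id (volume : Measure α)).prod h2
  have h4 : MeasurePreserving (fun p : α × (γ × (β × δ)) => ((p.1, p.2.1), p.2.2)) volume volume :=
    (measurePreserving_prodAssoc (volume : Measure α) (volume : Measure γ)
      (volume : Measure (β × δ))).symm
  exact h4.comp (h3.comp h1)

theorem measurePreserving_phaseSplit (n l : ℕ) :
    MeasurePreserving (phaseSplit n l) volume volume :=
  measurePreserving_prod_comm.comp
    ((measurePreserving_conf n l).prod (measurePreserving_conf n l))

section Tensor

variable {n l : ℕ}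

theorem coeFn_tensor (f : H n) (g : H l) :
    tensor f g =ᵐ[volume] fun q => f (confFst q) * g (confSnd q) :=
  MemLp.coeFn_toLp (memLp_tensor f g)

theorem ae_conf_of_ae {P : (Fin n → ℝ) → Prop} (h : ∀ᵐ x, P x) :
    ∀ᵐ q : Fin (n + l) → ℝ, P (confFst q) :=
  ((Measure.quasiMeasurePreserving_fst (μ := (volume : Measure (Fin n → ℝ)))
    (ν := (volume : Measure (Fin l → ℝ)))).comp
    (measurePreserving_conf n l).quasiMeasurePreserving).ae h

theorem ae_conf_of_ae' {P : (Fin l → ℝ) → Prop} (h : ∀ᵐ x, P x) :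
    ∀ᵐ q : Fin (n + l) → ℝ, P (confSnd q) :=
  ((Measure.quasiMeasurePreserving_snd (μ := (volume : Measure (Fin n → ℝ)))
    (ν := (volume : Measure (Fin l → ℝ)))).comp
    (measurePreserving_conf n l).quasiMeasurePreserving).ae h

theorem inner_tensor_tensor (f f' : H n) (g g' : H l) :
    inner ℂ (tensor f g) (tensor f' g') = inner ℂ f f' * inner ℂ g g' := by
  rw [L2.inner_def, L2.inner_def, L2.inner_def, ← integral_prod_mul]
  have hm := measurePreserving_conf n l
  rw [← Measure.volume_eq_prod, ← hm.map_eq, integral_map hm.measurable.aemeasurable]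
  · refine integral_congr_ae ?_
    filter_upwards [coeFn_tensor f g, coeFn_tensor f' g'] with q h1 h2
    rw [h1, h2]
    simp only [RCLike.inner_apply, map_mul]
    ring
  · rw [hm.map_eq, Measure.volume_eq_prod]
    exact (L2.integrable_inner f f').1.comp_fst.mul (L2.integrable_inner g g').1.comp_snd

theorem norm_tensor (f : H n) (g : H l) : ‖tensor f g‖ = ‖f‖ * ‖g‖ := by
  have h := inner_tensor_tensor f f g g
  simp only [inner_self_eq_norm_sq_to_K] at h
  have h2 : ‖tensor f g‖ ^ 2 = (‖f‖ * ‖g‖) ^ 2 := by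
    apply Complex.ofReal_injective
    simpa [mul_pow] using h
  exact (sq_eq_sq₀ (norm_nonneg _) (by positivity)).1 h2

theorem tensor_add_left (f f' : H n) (g : H l) :
    tensor (f + f') g = tensor f g + tensor f' g := by
  apply Lp.ext
  filter_upwards [coeFn_tensor (f + f') g, coeFn_tensor f g, coeFn_tensor f' g,
    Lp.coeFn_add (tensor f g) (tensor f' g), ae_conf_of_ae (l := l) (Lp.coeFn_add f f')]
    with q h1 h2 h3 h4 h5
  rw [h1, h4, Pi.add_apply, h2, h3, h5, Pi.add_apply, add_mul]

theorem tensor_add_right (f : H n) (g g' : H l) :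
    tensor f (g + g') = tensor f g + tensor f g' := by
  apply Lp.ext
  filter_upwards [coeFn_tensor f (g + g'), coeFn_tensor f g, coeFn_tensor f g',
    Lp.coeFn_add (tensor f g) (tensor f g'), ae_conf_of_ae' (n := n) (Lp.coeFn_add g g')]
    with q h1 h2 h3 h4 h5
  rw [h1, h4, Pi.add_apply, h2, h3, h5, Pi.add_apply, mul_add]

theorem tensor_smul_left (c : ℂ) (f : H n) (g : H l) : tensor (c • f) g = c • tensor f g := by
  apply Lp.ext
  filter_upwards [coeFn_tensor (c • f) g, coeFn_tensor f g, Lp.coeFn_smul c (tensor f g),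
    ae_conf_of_ae (l := l) (Lp.coeFn_smul c f)] with q h1 h2 h3 h4
  rw [h1, h3, Pi.smul_apply, h2, h4, Pi.smul_apply, smul_mul_assoc]

theorem tensor_smul_right (c : ℂ) (f : H n) (g : H l) : tensor f (c • g) = c • tensor f g := by
  apply Lp.ext
  filter_upwards [coeFn_tensor f (c • g), coeFn_tensor f g, Lp.coeFn_smul c (tensor f g),
    ae_conf_of_ae' (n := n) (Lp.coeFn_smul c g)] with q h1 h2 h3 h4
  rw [h1, h3, Pi.smul_apply, h2, h4, Pi.smul_apply, mul_smul_comm]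

/-- `g ↦ f ⊗ g` as a bounded operator. -/
def tensorLeft (l : ℕ) (f : H n) : H l →L[ℂ] H (n + l) :=
  LinearMap.mkContinuous
    { toFun := fun g => tensor f g
      map_add' := tensor_add_right f
      map_smul' := fun c g => tensor_smul_right c f g } ‖f‖ fun g => (norm_tensor f g).le

/-- `f ↦ f ⊗ g` as a bounded operator. -/
def tensorRight (n : ℕ) (g : H l) : H n →L[ℂ] H (n + l) :=
  LinearMap.mkContinuous
    { toFun := fun f => tensor f g
      map_add' := fun f f' => tensor_add_left f f' g
      map_smul' := fun c f => tensor_smul_left c f g } ‖g‖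
    fun f => ((norm_tensor f g).trans (mul_comm _ _)).le

@[simp] theorem tensorRight_apply (f : H n) (g : H l) : tensorRight n g f = tensor f g := rfl

theorem displacement_tensor (z : Phase (n + l)) (f : H n) (g : H l) :
    displacement z (tensor f g)
      = tensor (displacement (phaseFst z) f) (displacement (phaseSnd z) g) := by
  apply Lp.ext
  have h2 : ∀ᵐ q : Fin (n + l) → ℝ, tensor f g (q - z.1)
      = f (confFst (q - z.1)) * g (confSnd (q - z.1)) :=
    (measurePreserving_sub_right volume z.1).quasiMeasurePreserving.ae (coeFn_tensor f g)
  filter_upwards [coeFn_displacement z (tensor f g), h2,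
    coeFn_tensor (displacement (phaseFst z) f) (displacement (phaseSnd z) g),
    ae_conf_of_ae (l := l) (coeFn_displacement (phaseFst z) f),
    ae_conf_of_ae' (n := n) (coeFn_displacement (phaseSnd z) g)] with q h1 h2 h3 h4 h5
  rw [h1, h2, h3, h4, h5]
  have e : dispPhase z q
      = dispPhase (phaseFst z) (confFst q) * dispPhase (phaseSnd z) (confSnd q) := by
    simp only [dispPhase_eq, ← ephase_add, Fin.sum_univ_add]
    congr 1
    simp only [phaseFst, phaseSnd, confFst, confSnd]
    ring
  rw [e, show confFst (q - z.1) = confFst q - (phaseFst z).1 from rfl,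
    show confSnd (q - z.1) = confSnd q - (phaseSnd z).1 from rfl]
  ring

theorem parity_tensor (f : H n) (g : H l) :
    parity (n + l) (tensor f g) = tensor (parity n f) (parity l g) := by
  apply Lp.ext
  have h2 : ∀ᵐ q : Fin (n + l) → ℝ, tensor f g (-q) = f (confFst (-q)) * g (confSnd (-q)) :=
    (Measure.measurePreserving_neg volume).quasiMeasurePreserving.ae (coeFn_tensor f g)
  filter_upwards [coeFn_parity (tensor f g), h2, coeFn_tensor (parity n f) (parity l g),
    ae_conf_of_ae (l := l) (coeFn_parity f), ae_conf_of_ae' (n := n) (coeFn_parity g)]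
    with q h1 h2 h3 h4 h5
  rw [h1, h2, h3, h4, h5]
  rfl

theorem phasePoint_tensor (z : Phase (n + l)) (f : H n) (g : H l) :
    phasePoint z (tensor f g) = tensor (phasePoint (phaseFst z) f) (phasePoint (phaseSnd z) g) := by
  simp only [phasePoint_apply, parity_tensor, displacement_tensor, tensor_smul_left,
    tensor_smul_right, smul_smul]
  congr 1
  rw [← Complex.ofReal_mul, pow_add, mul_inv, mul_comm]

theorem vacuum_add (n l : ℕ) : vacuum (n + l) = tensor (vacuum n) (vacuum l) := by
  apply Lp.ext
  filter_upwards [coeFn_vacuum (n + l), coeFn_tensor (vacuum n) (vacuum l),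
    ae_conf_of_ae (l := l) (coeFn_vacuum n), ae_conf_of_ae' (n := n) (coeFn_vacuum l)]
    with q h1 h2 h3 h4
  rw [h1, h2, h3, h4, Fin.prod_univ_add, Complex.ofReal_mul]
  rfl

/-- Product vectors are total. -/
theorem eq_zero_of_inner_tensor_eq_zero {F : H (n + l)}
    (h : ∀ (f : H n) (g : H l), inner ℂ F (tensor f g) = 0) : F = 0 :=
  eq_zero_of_inner_displacement_eq_zero (vacuum_ne_zero (n + l)) fun z => by
    rw [vacuum_add, displacement_tensor, h]

/-- The partial inner product with a vector of the first system. -/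
def partialInner (f : H n) : H (n + l) →L[ℂ] H l :=
  ContinuousLinearMap.adjoint (tensorLeft l f)

theorem inner_partialInner (f : H n) (g : H l) (F : H (n + l)) :
    inner ℂ g (partialInner f F) = inner ℂ (tensor f g) F :=
  ContinuousLinearMap.adjoint_inner_right _ _ _

theorem inner_partialInner' (f : H n) (g : H l) (F : H (n + l)) :
    inner ℂ (partialInner f F) g = inner ℂ F (tensor f g) :=
  ContinuousLinearMap.adjoint_inner_left _ _ _

/-- The product basis. -/
def tensorBasis {ι κ : Type*} (b : HilbertBasis ι ℂ (H n)) (c : HilbertBasis κ ℂ (H l)) :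
    HilbertBasis (ι × κ) ℂ (H (n + l)) :=
  HilbertBasis.mkOfOrthogonalEqBot (v := fun p : ι × κ => tensor (b p.1) (c p.2))
    (by
      classical
      rw [orthonormal_iff_ite]
      intro p p'
      rw [inner_tensor_tensor, orthonormal_iff_ite.1 b.orthonormal,
        orthonormal_iff_ite.1 c.orthonormal]
      simp only [Prod.ext_iff]
      split_ifs <;> simp_all)
    (by
      rw [Submodule.eq_bot_iff]
      intro F hF
      have h1 : ∀ i j, inner ℂ F (tensor (b i) (c j)) = 0 := fun i j => by
        have := (Submodule.mem_orthogonal _ F).1 hF (tensor (b i) (c j))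
          (Submodule.subset_span ⟨(i, j), rfl⟩)
        rw [← inner_conj_symm, this, map_zero]
      -- Completeness is used one factor at a time: first the basis `c` removes the partial inner
      -- products, then the basis `b` removes what remains.
      have h2 : ∀ i, partialInner (b i) F = 0 := fun i => by
        have h3 : ∀ j, inner ℂ (c j) (partialInner (b i) F) = 0 := fun j => by
          rw [inner_partialInner, ← inner_conj_symm, h1, map_zero]
        have := (hasSum_norm_sq_inner c (partialInner (b i) F)).tsum_eq
        simp only [h3, norm_zero, ne_eq, OfNat.ofNat_ne_zero, not_false_eq_true, zero_pow,
          tsum_zero] at this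
        exact norm_eq_zero.1 (pow_eq_zero_iff (two_ne_zero)|>.1 this.symm)
      refine eq_zero_of_inner_tensor_eq_zero fun f g => ?_
      have h4 : ContinuousLinearMap.adjoint (tensorRight n g) F = 0 := by
        have h3 : ∀ i, inner ℂ (b i) (ContinuousLinearMap.adjoint (tensorRight n g) F) = 0 :=
          fun i => by
          rw [ContinuousLinearMap.adjoint_inner_right, tensorRight_apply, ← inner_partialInner, h2,
            inner_zero_right]
        have := (hasSum_norm_sq_inner b (ContinuousLinearMap.adjoint (tensorRight n g) F)).tsum_eq
        simp only [h3, norm_zero, ne_eq, OfNat.ofNat_ne_zero, not_false_eq_true, zero_pow,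
          tsum_zero] at this
        exact norm_eq_zero.1 (pow_eq_zero_iff (two_ne_zero)|>.1 this.symm)
      have := ContinuousLinearMap.adjoint_inner_left (tensorRight n g) f F
      rw [h4, inner_zero_left] at this
      exact this.symm)

theorem tensorBasis_apply {ι κ : Type*} (b : HilbertBasis ι ℂ (H n)) (c : HilbertBasis κ ℂ (H l))
    (p : ι × κ) : tensorBasis b c p = tensor (b p.1) (c p.2) :=
  congrFun (HilbertBasis.coe_mkOfOrthogonalEqBot _ _) p

theorem hasSum_norm_sq_partialInner {ι : Type*} (b : HilbertBasis ι ℂ (H n)) (F : H (n + l)) :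
    HasSum (fun i => ‖partialInner (b i) F‖ ^ 2) (‖F‖ ^ 2) := by
  have h := hasSum_norm_sq_inner (tensorBasis b (basis l)) F
  refine h.prod_fiberwise fun i => ?_
  have := hasSum_norm_sq_inner (basis l) (partialInner (b i) F)
  simp only [inner_partialInner] at this
  simpa only [tensorBasis_apply] using this

/-- The squared distance of a finite partial sum from `F` is `‖F‖²` minus the partial sum of
`‖partialInner (b i) F‖²`, which tends to `0` by Parseval. -/
theorem hasSum_tensor_partialInner {ι : Type*} (b : HilbertBasis ι ℂ (H n)) (F : H (n + l)) :
    HasSum (fun i => tensor (b i) (partialInner (b i) F)) F := by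
  classical
  have key : ∀ s : Finset ι, ‖(∑ i ∈ s, tensor (b i) (partialInner (b i) F)) - F‖ ^ 2
      = ‖F‖ ^ 2 - ∑ i ∈ s, ‖partialInner (b i) F‖ ^ 2 := fun s => by
    have h1 : inner ℂ (∑ i ∈ s, tensor (b i) (partialInner (b i) F)) F
        = ((∑ i ∈ s, ‖partialInner (b i) F‖ ^ 2 : ℝ) : ℂ) := by
      rw [sum_inner]
      push_cast
      refine Finset.sum_congr rfl fun i _ => ?_
      rw [← inner_partialInner, inner_self_eq_norm_sq_to_K]
      rfl
    have h2 : inner ℂ (∑ i ∈ s, tensor (b i) (partialInner (b i) F))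
        (∑ i ∈ s, tensor (b i) (partialInner (b i) F))
        = ((∑ i ∈ s, ‖partialInner (b i) F‖ ^ 2 : ℝ) : ℂ) := by
      rw [sum_inner]
      push_cast
      refine Finset.sum_congr rfl fun i hi => ?_
      rw [inner_sum, Finset.sum_eq_single i]
      · rw [inner_tensor_tensor, inner_self_eq_norm_sq_to_K, b.orthonormal.1,
          inner_self_eq_norm_sq_to_K]
        simp
      · intro j _ hj
        rw [inner_tensor_tensor, b.orthonormal.2 hj.symm, zero_mul]
      · exact fun h => absurd hi h
    have h3 : ‖∑ i ∈ s, tensor (b i) (partialInner (b i) F)‖ ^ 2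
        = ∑ i ∈ s, ‖partialInner (b i) F‖ ^ 2 := by
      rw [inner_self_eq_norm_sq_to_K] at h2
      apply Complex.ofReal_injective
      simpa using h2
    rw [@norm_sub_sq ℂ, h3, h1]
    simp only [RCLike.re_to_complex, Complex.ofReal_re]
    ring
  rw [HasSum, SummationFilter.unconditional_filter, tendsto_iff_norm_sub_tendsto_zero]
  have h := (hasSum_norm_sq_partialInner b F)
  rw [HasSum, SummationFilter.unconditional_filter] at h
  have h2 := (h.const_sub (‖F‖ ^ 2)).sqrt
  simp only [← key, sub_self, Real.sqrt_zero] at h2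
  simpa [Real.sqrt_sq] using h2

end Tensor

/-! ### Slices -/

section HilbertSpace

variable {V : Type*} [NormedAddCommGroup V] [InnerProductSpace ℂ V]

theorem hasSum_smul_basis [CompleteSpace V] {κ : Type*} (b : HilbertBasis κ ℂ V) {c : κ → ℂ}
    (hc : Summable fun i => ‖c i‖ ^ 2) : ∃ x : V, HasSum (fun i => c i • b i) x ∧
      ∀ i, inner ℂ (b i) x = c i := by
  have hm : Memℓp c 2 := memℓp_gen (by simpa using hc)
  refine ⟨b.repr.symm ⟨c, hm⟩, b.hasSum_repr_symm ⟨c, hm⟩, fun i => ?_⟩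
  rw [← b.repr_apply_apply, LinearIsometryEquiv.apply_symm_apply]

theorem norm_sq_sum_smul_basis {κ : Type*} (b : HilbertBasis κ ℂ V) (c : κ → ℂ) (s : Finset κ) :
    ‖∑ i ∈ s, c i • b i‖ ^ 2 = ∑ i ∈ s, ‖c i‖ ^ 2 := by
  have h := b.orthonormal.inner_sum c c s
  rw [inner_self_eq_norm_sq_to_K] at h
  apply Complex.ofReal_injective
  have e : ∀ i, (starRingEnd ℂ) (c i) * c i = ((‖c i‖ ^ 2 : ℝ) : ℂ) := fun i => by
    rw [mul_comm, Complex.mul_conj, Complex.normSq_eq_norm_sq]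
  simp only [e] at h
  simpa using h

end HilbertSpace

section Slice

variable {n l : ℕ}

/-- The partial evaluation `F(·, y)` of a vector of a composite system. -/
def slice (F : H (n + l)) (y : Fin l → ℝ) : H n :=
  ∑' i, (partialInner (basis n i) F) y • basis n i

/-- Finite partial sums of the expansion of a slice. -/
def sliceSum (F : H (n + l)) (s : Finset (basisIndex n)) (y : Fin l → ℝ) : H n :=
  ∑ i ∈ s, (partialInner (basis n i) F) y • basis n i

theorem lintegral_tsum_partialInner (F : H (n + l)) :
    ∫⁻ y, ∑' i, ‖(partialInner (basis n i) F) y‖ₑ ^ 2 = ENNReal.ofReal (‖F‖ ^ 2) := by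
  rw [lintegral_tsum fun i => ((Lp.aestronglyMeasurable _).aemeasurable.enorm.pow_const 2)]
  simp only [lintegral_enorm_sq]
  rw [← ENNReal.ofReal_tsum_of_nonneg (fun i => by positivity)
    (hasSum_norm_sq_partialInner (basis n) F).summable,
    (hasSum_norm_sq_partialInner (basis n) F).tsum_eq]

theorem ae_summable_partialInner (F : H (n + l)) :
    ∀ᵐ y, Summable fun i => ‖(partialInner (basis n i) F) y‖ ^ 2 := by
  have h := ae_lt_top' (f := fun y => ∑' i, ‖(partialInner (basis n i) F) y‖ₑ ^ 2)
    (AEMeasurable.tsum fun i => (Lp.aestronglyMeasurable _).aemeasurable.enorm.pow_const 2)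
    (by rw [lintegral_tsum_partialInner]; exact ENNReal.ofReal_ne_top)
  filter_upwards [h] with y hy
  have := ENNReal.summable_toReal hy.ne
  simpa using this

/-- Where the coefficients are not square-summable the series defining `slice` takes a default
value; by Tonelli this happens only on a null set of outcomes `y`. -/
theorem ae_hasSum_slice (F : H (n + l)) :
    ∀ᵐ y, HasSum (fun i => (partialInner (basis n i) F) y • basis n i) (slice F y) := by
  filter_upwards [ae_summable_partialInner F] with y hy
  obtain ⟨x, hx, -⟩ := hasSum_smul_basis (basis n) hy
  rw [slice, hx.tsum_eq]
  exact hx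

theorem ae_inner_slice (F : H (n + l)) :
    ∀ᵐ y, ∀ i, inner ℂ (basis n i) (slice F y) = (partialInner (basis n i) F) y := by
  filter_upwards [ae_summable_partialInner F] with y hy
  obtain ⟨x, hx, hi⟩ := hasSum_smul_basis (basis n) hy
  rw [slice, hx.tsum_eq]
  exact hi

theorem aestronglyMeasurable_sliceSum (F : H (n + l)) (s : Finset (basisIndex n)) :
    AEStronglyMeasurable (sliceSum F s) volume := by
  unfold sliceSum
  exact Finset.aestronglyMeasurable_fun_sum s fun i _ =>
    (Lp.aestronglyMeasurable _).smul_const _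

theorem ae_tendsto_sliceSum (F : H (n + l)) :
    ∀ᵐ y, Filter.Tendsto (fun s => sliceSum F s y) Filter.atTop (nhds (slice F y)) := by
  filter_upwards [ae_hasSum_slice F] with y hy
  rw [HasSum, SummationFilter.unconditional_filter] at hy
  exact hy

theorem aestronglyMeasurable_slice (F : H (n + l)) : AEStronglyMeasurable (slice F) volume :=
  aestronglyMeasurable_of_tendsto_ae Filter.atTop (aestronglyMeasurable_sliceSum F)
    (ae_tendsto_sliceSum F)

theorem ae_norm_sq_slice (F : H (n + l)) :
    ∀ᵐ y, HasSum (fun i => ‖(partialInner (basis n i) F) y‖ ^ 2) (‖slice F y‖ ^ 2) := by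
  filter_upwards [ae_inner_slice F] with y hy
  simpa only [hy] using hasSum_norm_sq_inner (basis n) (slice F y)

theorem ae_norm_sliceSum_le (F : H (n + l)) :
    ∀ᵐ y, ∀ s, ‖sliceSum F s y‖ ≤ ‖slice F y‖ := by
  filter_upwards [ae_norm_sq_slice F] with y hy s
  have := sum_le_hasSum s (fun i _ => by positivity) hy
  rw [← norm_sq_sum_smul_basis (basis n)] at this
  exact (sq_le_sq₀ (norm_nonneg _) (norm_nonneg _)).1 this

theorem lintegral_enorm_sq_slice (F : H (n + l)) :
    ∫⁻ y, ‖slice F y‖ₑ ^ 2 = ENNReal.ofReal (‖F‖ ^ 2) := by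
  rw [← lintegral_tsum_partialInner]
  refine lintegral_congr_ae ?_
  filter_upwards [ae_norm_sq_slice F] with y hy
  have h := ENNReal.ofReal_tsum_of_nonneg (fun i => by positivity) hy.summable
  rw [hy.tsum_eq, ENNReal.ofReal_pow (norm_nonneg _), ofReal_norm] at h
  rw [h]
  refine tsum_congr fun i => ?_
  rw [ENNReal.ofReal_pow (norm_nonneg _), ofReal_norm]

theorem memLp_slice (F : H (n + l)) : MemLp (slice F) 2 volume := by
  refine ⟨aestronglyMeasurable_slice F, ?_⟩
  rw [eLpNorm_lt_top_iff_lintegral_rpow_enorm_lt_top (by norm_num) (by norm_num)]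
  simp only [ENNReal.toReal_ofNat, ENNReal.rpow_ofNat]
  rw [lintegral_enorm_sq_slice]
  exact ENNReal.ofReal_lt_top

theorem integrable_norm_sq_slice (F : H (n + l)) : Integrable fun y => ‖slice F y‖ ^ 2 :=
  (memLp_two_iff_integrable_sq_norm (memLp_slice F).1).1 (memLp_slice F)

/-- Slicing is isometric into `L²(ℝˡ; H n)`. This supplies the integrable majorants needed when
traces are exchanged with the integral over homodyne outcomes. -/
theorem integral_norm_sq_slice (F : H (n + l)) : ∫ y, ‖slice F y‖ ^ 2 = ‖F‖ ^ 2 := by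
  have h := lintegral_enorm_sq_slice F
  have e : ∀ y, ‖slice F y‖ₑ ^ 2 = ENNReal.ofReal (‖slice F y‖ ^ 2) := fun y => by
    rw [ENNReal.ofReal_pow (norm_nonneg _), ofReal_norm]
  simp only [e] at h
  rw [← ofReal_integral_eq_lintegral_ofReal (integrable_norm_sq_slice F)
    (Filter.Eventually.of_forall fun q => by positivity)] at h
  exact (ENNReal.ofReal_eq_ofReal_iff (integral_nonneg fun q => by positivity)
    (by positivity)).1 h

/-! ### Conditional measurements on arbitrary vectors -/

variable {N : (Fin l → ℝ) → (H n →L[ℂ] H n)}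

theorem integrable_conditional (hN : ∀ y, ‖N y‖ ≤ 1)
    (hmeas : ∀ f f' : H n, Measurable fun y => inner ℂ f (N y f')) (f f' : H n) (g g' : H l) :
    Integrable fun y => (starRingEnd ℂ) (g y) * g' y * inner ℂ f (N y f') := by
  have h : Integrable fun y => (starRingEnd ℂ) (g y) * g' y :=
    (Lp.memLp g).star.integrable_mul (Lp.memLp g')
  refine h.mul_bdd (c := ‖f‖ * ‖f'‖) (hmeas f f').aestronglyMeasurable
    (Filter.Eventually.of_forall fun y => (norm_inner_le_norm _ _).trans ?_)
  gcongr
  exact ((N y).le_of_opNorm_le (hN y) _).trans (one_mul _).le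

theorem norm_inner_apply_le {V : Type*} [NormedAddCommGroup V] [InnerProductSpace ℂ V]
    {X : V →L[ℂ] V} (hX : ‖X‖ ≤ 1) (f g : V) : ‖inner ℂ f (X g)‖ ≤ ‖f‖ * ‖g‖ := by
  refine (norm_inner_le_norm _ _).trans ?_
  gcongr
  exact (X.le_of_opNorm_le hX _).trans (one_mul _).le

theorem inner_sliceSum (F G : H (n + l)) (s : Finset (basisIndex n)) (X : H n →L[ℂ] H n)
    (y : Fin l → ℝ) :
    inner ℂ (sliceSum F s y) (X (sliceSum G s y)) = ∑ i ∈ s, ∑ j ∈ s,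
      (starRingEnd ℂ) ((partialInner (basis n i) F) y) * (partialInner (basis n j) G) y *
        inner ℂ (basis n i) (X (basis n j)) := by
  rw [sliceSum, sliceSum, sum_inner]
  refine Finset.sum_congr rfl fun i _ => ?_
  rw [map_sum, inner_sum]
  refine Finset.sum_congr rfl fun j _ => ?_
  rw [map_smul, inner_smul_left, inner_smul_right]
  ring

theorem aestronglyMeasurable_inner_sliceSum
    (hmeas : ∀ f f' : H n, Measurable fun y => inner ℂ f (N y f')) (F G : H (n + l))
    (s : Finset (basisIndex n)) :
    AEStronglyMeasurable (fun y => inner ℂ (sliceSum F s y) (N y (sliceSum G s y))) volume := by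
  simp only [inner_sliceSum]
  refine Finset.aestronglyMeasurable_fun_sum s fun i _ =>
    Finset.aestronglyMeasurable_fun_sum s fun j _ => ?_
  exact ((Lp.memLp _).star.1.mul (Lp.aestronglyMeasurable _)).mul
    (hmeas _ _).aestronglyMeasurable

theorem ae_tendsto_inner_sliceSum (F G : H (n + l)) :
    ∀ᵐ y, Filter.Tendsto (fun s => inner ℂ (sliceSum F s y) (N y (sliceSum G s y)))
      Filter.atTop (nhds (inner ℂ (slice F y) (N y (slice G y)))) := by
  filter_upwards [ae_tendsto_sliceSum F, ae_tendsto_sliceSum G] with y h1 h2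
  exact h1.inner (((N y).continuous.tendsto _).comp h2)

theorem integrable_norm_slice_mul (F G : H (n + l)) :
    Integrable fun y => ‖slice F y‖ * ‖slice G y‖ :=
  (memLp_slice F).norm.integrable_mul (memLp_slice G).norm

theorem integrable_inner_slice (hN : ∀ y, ‖N y‖ ≤ 1)
    (hmeas : ∀ f f' : H n, Measurable fun y => inner ℂ f (N y f')) (F G : H (n + l)) :
    Integrable fun y => inner ℂ (slice F y) (N y (slice G y)) :=
  (integrable_norm_slice_mul F G).mono' (aestronglyMeasurable_of_tendsto_ae Filter.atTop
    (aestronglyMeasurable_inner_sliceSum hmeas F G) (ae_tendsto_inner_sliceSum F G))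
    (Filter.Eventually.of_forall fun y => norm_inner_apply_le (hN y) _ _)

/-- The matrix elements of a conditional measurement between arbitrary vectors. -/
theorem IsConditional.inner_eq_integral {T : H (n + l) →L[ℂ] H (n + l)} (hT : IsConditional N T)
    (hN : ∀ y, ‖N y‖ ≤ 1) (hmeas : ∀ f f' : H n, Measurable fun y => inner ℂ f (N y f'))
    (F G : H (n + l)) :
    inner ℂ F (T G) = ∫ y, inner ℂ (slice F y) (N y (slice G y)) := by
  -- The defining formula holds on product vectors, hence by bilinearity on these finite sums. They
  -- converge to `F` in norm, and their slices are dominated by the slices of `F`, so both sides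
  -- pass to the limit.
  let P : H (n + l) → Finset (basisIndex n) → H (n + l) := fun F s =>
    ∑ i ∈ s, tensor (basis n i) (partialInner (basis n i) F)
  have hP : ∀ F, Filter.Tendsto (P F) Filter.atTop (nhds F) := fun F => by
    have := hasSum_tensor_partialInner (basis n) F
    rwa [HasSum, SummationFilter.unconditional_filter] at this
  have h1 : Filter.Tendsto (fun s => inner ℂ (P F s) (T (P G s))) Filter.atTop
      (nhds (inner ℂ F (T G))) := (hP F).inner ((T.continuous.tendsto _).comp (hP G))
  have h2 : ∀ s, inner ℂ (P F s) (T (P G s))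
      = ∫ y, inner ℂ (sliceSum F s y) (N y (sliceSum G s y)) := fun s => by
    simp only [inner_sliceSum]
    rw [integral_finsetSum s fun i _ => integrable_finsetSum s fun j _ =>
      integrable_conditional hN hmeas _ _ _ _, sum_inner]
    refine Finset.sum_congr rfl fun i _ => ?_
    rw [integral_finsetSum s fun j _ => integrable_conditional hN hmeas _ _ _ _, map_sum,
      inner_sum]
    exact Finset.sum_congr rfl fun j _ => hT _ _ _ _
  simp only [h2] at h1
  refine tendsto_nhds_unique h1 ?_
  refine tendsto_integral_filter_of_dominated_convergence (fun y => ‖slice F y‖ * ‖slice G y‖)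
    (Filter.Eventually.of_forall fun s => aestronglyMeasurable_inner_sliceSum hmeas F G s)
    (Filter.Eventually.of_forall fun s => ?_) (integrable_norm_slice_mul F G)
    (ae_tendsto_inner_sliceSum F G)
  filter_upwards [ae_norm_sliceSum_le F, ae_norm_sliceSum_le G] with y hF hG
  refine (norm_inner_apply_le (hN y) _ _).trans ?_
  gcongr
  · exact hF s
  · exact hG s

end Slice

/-! ### Covariance under Gaussian unitaries -/

/-- The displacement operators act irreducibly. -/
theorem exists_eq_smul_of_commute_displacement {m : ℕ} (X : H m →L[ℂ] H m)
    (hX : ∀ w ψ, X (displacement w ψ) = displacement w (X ψ)) : ∃ κ : ℂ, ∀ ψ, X ψ = κ • ψ := by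
  refine ⟨inner ℂ (vacuum m) (X (vacuum m)), fun c => ext_inner_left ℂ fun a => ?_⟩
  have hπ : (2 * Real.pi : ℂ) ^ m ≠ 0 := by
    exact_mod_cast (pow_pos (by positivity : 0 < 2 * Real.pi) m).ne'
  -- The integral `∫ ⟨a, X D(w)Ω⟩⟨D(w)Ω, c⟩ dw`, with `Ω` the vacuum, is evaluated twice: as it
  -- stands it yields `⟨a, X c⟩`, and after commuting `X` past `D(w)` it yields `⟨Ω, X Ω⟩⟨a, c⟩`.
  have h1 := integral_moyal (ContinuousLinearMap.adjoint X a) (vacuum m) c (vacuum m)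
  simp only [ContinuousLinearMap.adjoint_inner_left, hX] at h1
  rw [integral_moyal, inner_self_eq_norm_sq_to_K, norm_vacuum] at h1
  have h2 := mul_left_cancel₀ hπ h1
  rw [inner_smul_right, mul_comm, h2]
  simp

/-- Every linear form on phase space is given by the symplectic form. -/
theorem exists_symp_eq {m : ℕ} (lam : Phase m →ₗ[ℝ] ℝ) : ∃ c, ∀ z, symp c z = lam z := by
  classical
  refine ⟨(fun j => lam (0, Pi.single j 1), fun j => -lam (Pi.single j 1, 0)), fun z => ?_⟩
  have h1 : z = ∑ j, (z.1 j • ((Pi.single j 1, 0) : Phase m)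
      + z.2 j • ((0, Pi.single j 1) : Phase m)) := by
    refine Prod.ext ?_ ?_
    · funext i
      simp [Prod.fst_sum, Pi.single_apply]
    · funext i
      simp [Prod.snd_sum, Pi.single_apply]
  conv_rhs => rw [h1]
  rw [map_sum, symp]
  refine Finset.sum_congr rfl fun j _ => ?_
  rw [map_add, map_smul, map_smul, smul_eq_mul, smul_eq_mul]
  ring

theorem displacement_comm {m : ℕ} (z w : Phase m) (ψ : H m) :
    displacement z (displacement w ψ)
      = ephase (-symp z w) • displacement w (displacement z ψ) := by
  rw [displacement_displacement, displacement_displacement, smul_smul, ← ephase_add, add_comm z w,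
    symp_swap z w]
  congr 2
  ring

/-- The Weyl quantization of the Wigner function of the vacuum. -/
theorem isWeylSum_vacuum (m : ℕ) :
    IsWeylSum (fun z : Phase m => (((2 * Real.pi) ^ m * vacuumWigner z : ℝ) : ℂ))
      (fun _ : Unit => vacuum m) (fun _ => vacuum m) where
  integrable := ((integrable_vacuumWigner m).const_mul _).ofReal
  summable_left := Summable.of_finite
  summable_right := Summable.of_finite
  tsum_eq f g := by
    have hπ : (2 * Real.pi : ℂ) ^ m ≠ 0 := by
      exact_mod_cast (pow_pos (by positivity : 0 < 2 * Real.pi) m).ne'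
    have h := integral_moyal_phasePoint f g (vacuum m) (vacuum m)
    simp only [inner_phasePoint_left, inner_vacuum_phasePoint] at h
    have e : ∀ z : Phase m, (((2 * Real.pi) ^ m * vacuumWigner z : ℝ) : ℂ)
        * inner ℂ f (phasePoint z g)
        = (2 * Real.pi : ℂ) ^ m * (inner ℂ f (phasePoint z g) * (vacuumWigner z : ℂ)) := fun z => by
      push_cast; ring
    simp only [e]
    rw [integral_const_mul, h, tsum_fintype, ← mul_assoc, mul_inv_cancel₀ hπ, one_mul]
    simp

/-- Conjugation by `U` is the substitution `w = S z + d` in the integral, with Jacobian factor `J`.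
The scalar `κ` is kept general because this lemma is itself used to show that `κ = 1` for Gaussian
unitaries. -/
theorem IsWeylSum.map_of_covariant {m : ℕ} {ι : Type*} {φ : Phase m → ℂ} {u v : ι → H m}
    (h : IsWeylSum φ u v) (U : H m ≃ₗᵢ[ℂ] H m) (S : Phase m ≃ₗ[ℝ] Phase m) (d : Phase m) (κ : ℂ)
    (hU : ∀ z ψ, U (phasePoint z ψ) = κ • phasePoint (S z + d) (U ψ)) :
    IsWeylSum (fun w => κ * ((|(LinearMap.det (S : Phase m →ₗ[ℝ] Phase m))⁻¹| : ℝ) : ℂ)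
        * φ (S.symm (w - d)))
      (fun k => U (u k)) (fun k => U (v k)) := by
  set J : ℝ := |(LinearMap.det (S : Phase m →ₗ[ℝ] Phase m))⁻¹| with hJ
  have hdet : LinearMap.det (S : Phase m →ₗ[ℝ] Phase m) ≠ 0 := S.isUnit_det'.ne_zero
  have hJ0 : 0 < J := by positivity
  have hmap : Measure.map (S : Phase m → Phase m) volume = ENNReal.ofReal J • volume :=
    Measure.map_linearMap_addHaar_eq_smul_addHaar volume hdet
  let e : Phase m ≃ᵐ Phase m := S.toContinuousLinearEquiv.toHomeomorph.toMeasurableEquiv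
  have he : ∀ z, e z = S z := fun z => rfl
  have hint : ∀ F : Phase m → ℂ, ∫ z, F (S z) = (J : ℂ) * ∫ w, F w := fun F => by
    have h1 := e.measurableEmbedding.integral_map (μ := volume) F
    rw [show (e : Phase m → Phase m) = S from rfl, hmap, integral_smul_measure,
      ENNReal.toReal_ofReal hJ0.le, Complex.real_smul] at h1
    rw [h1]
  have hintg : ∀ F : Phase m → ℂ, Integrable (fun z => F (S z)) → Integrable F := fun F hF => by
    have h1 := (e.measurableEmbedding.integrable_map_iff (μ := volume) (g := F)).2 hF
    rw [show (e : Phase m → Phase m) = S from rfl, hmap, integrable_smul_measure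
      (by simpa using hJ0) ENNReal.ofReal_ne_top] at h1
    exact h1
  constructor
  · have h1 : Integrable fun w => φ (S.symm w) := hintg _ (by simpa using h.integrable)
    exact (h1.comp_sub_right d).const_mul _
  · simpa using h.summable_left
  · simpa using h.summable_right
  · intro f g
    have h1 := h.tsum_eq (U.symm f) (U.symm g)
    have h2 : ∀ z, inner ℂ (U.symm f) (phasePoint z (U.symm g))
        = κ * inner ℂ f (phasePoint (S z + d) g) := fun z => by
      rw [← U.inner_map_map, hU, inner_smul_right, U.apply_symm_apply, U.apply_symm_apply]
    have h3 : ∀ k, inner ℂ f (U (u k)) * inner ℂ (U (v k)) g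
        = inner ℂ (U.symm f) (u k) * inner ℂ (v k) (U.symm g) := fun k => by
      rw [← U.inner_map_map (U.symm f), ← U.inner_map_map (v k), U.apply_symm_apply,
        U.apply_symm_apply]
    simp only [h3, h1, h2]
    have h4 := hint fun w => φ (S.symm w) * (κ * inner ℂ f (phasePoint (w + d) g))
    simp only [LinearEquiv.symm_apply_apply] at h4
    rw [h4, ← integral_sub_right_eq_self _ d, ← integral_const_mul]
    refine integral_congr_ae (Filter.Eventually.of_forall fun w => ?_)
    simp only [sub_add_cancel]
    ring

/-- The linear phase `lam` is absorbed by an extra displacement `c`, leaving `V` with `V D(z) = D(S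
z) V`. Then `V Π V⁻¹ Π` commutes with all displacements and is a scalar `κ` by irreducibility, with
`κ² = 1`. Positivity of the vacuum Wigner function decides the sign. -/
theorem IsGaussianUnitary.exists_phasePoint {m : ℕ} {U : H m ≃ₗᵢ[ℂ] H m}
    (hU : IsGaussianUnitary U) : ∃ (S : Phase m ≃ₗ[ℝ] Phase m) (d : Phase m),
      ∀ z ψ, U (phasePoint z ψ) = phasePoint (S z + d) (U ψ) := by
  obtain ⟨S, lam, -, hD⟩ := hU
  obtain ⟨c, hc⟩ := exists_symp_eq (lam ∘ₗ (S.symm : Phase m →ₗ[ℝ] Phase m))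
  let V : H m ≃ₗᵢ[ℂ] H m := U.trans (dispU c)
  have hV : ∀ ψ, V ψ = displacement c (U ψ) := fun ψ => rfl
  have hVD : ∀ z ψ, V (displacement z ψ) = displacement (S z) (V ψ) := fun z ψ => by
    have hcS : symp c (S z) = lam z := by simp [hc]
    have h1 : U (displacement z ψ) = ephase (lam z) • displacement (S z) (U ψ) := hD z ψ
    rw [hV, h1, map_smul, displacement_comm, smul_smul, hcS, ephase_mul_neg, one_smul, hV]
  have hVD' : ∀ w ψ, V.symm (displacement w ψ) = displacement (S.symm w) (V.symm ψ) := fun w ψ => by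
    apply V.injective
    rw [V.apply_symm_apply, hVD, LinearEquiv.apply_symm_apply, V.apply_symm_apply]
  obtain ⟨κ, hκ⟩ := exists_eq_smul_of_commute_displacement
    ((V : H m →L[ℂ] H m).comp ((parity m).comp ((V.symm : H m →L[ℂ] H m).comp (parity m))))
    (fun w ψ => by
      change V (parity m (V.symm (parity m (displacement w ψ))))
        = displacement w (V (parity m (V.symm (parity m ψ))))
      rw [parity_displacement, hVD', parity_displacement, hVD, map_neg,
        LinearEquiv.apply_symm_apply, neg_neg])
  have hVP : ∀ ψ, V (parity m ψ) = κ • parity m (V ψ) := fun ψ => by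
    have h1 : V (parity m (V.symm (parity m (parity m (V ψ))))) = κ • parity m (V ψ) := hκ _
    rwa [parity_parity, V.symm_apply_apply] at h1
  have hκ2 : κ * κ = 1 := by
    have h1 := hVP (parity m (V.symm (vacuum m)))
    rw [parity_parity, hVP, V.apply_symm_apply, map_smul, parity_parity, smul_smul] at h1
    have h2 := congrArg (fun x => inner ℂ (vacuum m) x) h1
    simp only [inner_smul_right, inner_self_eq_norm_sq_to_K, norm_vacuum] at h2
    simpa using h2.symm
  have hUA : ∀ z ψ, U (phasePoint z ψ) = κ • phasePoint (S z + -c) (U ψ) := fun z ψ => by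
    have h1 : V (phasePoint z ψ) = κ • phasePoint (S z) (V ψ) := by
      rw [phasePoint_apply, map_smul, hVD, hVP, map_smul, phasePoint_apply, map_smul,
        smul_comm κ]
    have h2 : ∀ x, U x = displacement (-c) (V x) := fun x => by
      rw [hV, displacement_neg_displacement]
    rw [h2, h1, map_smul, displacement_phasePoint, ← h2]
  -- If `κ = -1`, the image of the vacuum projection would have a non-positive symbol, hence trace
  -- at most `0`, whereas its trace is `1`.
  have hpos : κ ≠ -1 := by
    intro hneg
    have h1 := ((isWeylSum_vacuum m).map_of_covariant U S (-c) κ hUA).tsum_inner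
    rw [hneg] at h1
    simp only [tsum_fintype, Finset.univ_unique, Finset.sum_singleton, inner_self_eq_norm_sq_to_K,
      LinearIsometryEquiv.norm_map, norm_vacuum] at h1
    have h2 : ∀ w : Phase m, -1 * ((|(LinearMap.det (S : Phase m →ₗ[ℝ] Phase m))⁻¹| : ℝ) : ℂ) *
        (((2 * Real.pi) ^ m * vacuumWigner (S.symm (w - -c)) : ℝ) : ℂ)
        = ((-(|(LinearMap.det (S : Phase m →ₗ[ℝ] Phase m))⁻¹| *
          ((2 * Real.pi) ^ m * vacuumWigner (S.symm (w - -c)))) : ℝ) : ℂ) := fun w => by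
      push_cast; ring
    simp only [h2] at h1
    rw [integral_complex_ofReal] at h1
    have h3 : ((1 : ℝ) : ℂ) = (((((2 * Real.pi) ^ m)⁻¹ * ∫ w : Phase m,
        -(|(LinearMap.det (S : Phase m →ₗ[ℝ] Phase m))⁻¹| *
          ((2 * Real.pi) ^ m * vacuumWigner (S.symm (w - -c))))) : ℝ) : ℂ) := by
      push_cast
      simpa using h1
    have h4 := Complex.ofReal_injective h3
    have h5 : ∫ w : Phase m, -(|(LinearMap.det (S : Phase m →ₗ[ℝ] Phase m))⁻¹| *
          ((2 * Real.pi) ^ m * vacuumWigner (S.symm (w - -c)))) ≤ 0 := by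
      refine integral_nonpos fun w => ?_
      have := vacuumWigner_nonneg (S.symm (w - -c))
      have hp := Real.pi_pos
      simp only [Pi.zero_apply, Left.neg_nonpos_iff]
      positivity
    have h6 : 0 ≤ ((2 * Real.pi) ^ m)⁻¹ := by have := Real.pi_pos; positivity
    nlinarith
  have hone : κ = 1 := by
    have : (κ - 1) * (κ + 1) = 0 := by linear_combination hκ2
    rcases mul_eq_zero.1 this with h | h
    · exact sub_eq_zero.1 h
    · exact absurd (eq_neg_of_add_eq_zero_left h) hpos
  exact ⟨S, -c, fun z ψ => by rw [hUA, hone, one_smul]⟩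

/-- Gaussian unitaries map non-negative symbols to non-negative symbols. -/
theorem IsGaussianUnitary.exists_isWeylSum {a b : ℕ} (hab : a = b) {U : H a ≃ₗᵢ[ℂ] H b}
    (hU : IsGaussianUnitary U) {ι : Type*} {φ : Phase a → ℝ} (hφ : ∀ z, 0 ≤ φ z) {u v : ι → H a}
    (h : IsWeylSum (fun z => (φ z : ℂ)) u v) : ∃ φ' : Phase b → ℝ, (∀ z, 0 ≤ φ' z) ∧
      IsWeylSum (fun z => (φ' z : ℂ)) (fun k => U (u k)) (fun k => U (v k)) := by
  -- Identifying the two mode numbers makes `S` an endomorphism, so that it has a determinant. Only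
  -- the sign of its absolute value matters for positivity.
  subst hab
  obtain ⟨S, d, hUA⟩ := hU.exists_phasePoint
  refine ⟨fun w => |(LinearMap.det (S : Phase a →ₗ[ℝ] Phase a))⁻¹| * φ (S.symm (w - d)),
    fun w => mul_nonneg (abs_nonneg _) (hφ _), ?_⟩
  have := h.map_of_covariant U S d 1 fun z ψ => by rw [hUA, one_smul]
  simpa using this

/-! ### Criteria for Weyl sums -/

theorem ae_summable_norm_of_summable_integral_norm {α ι : Type*} [MeasurableSpace α] {μ : Measure α}
    [Countable ι] {F : ι → α → ℂ} (hF : ∀ i, Integrable (F i) μ)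
    (hs : Summable fun i => ∫ a, ‖F i a‖ ∂μ) :
    (∫⁻ a, ∑' i, ‖F i a‖ₑ ∂μ ≠ ⊤) ∧ ∀ᵐ a ∂μ, Summable fun i => ‖F i a‖ := by
  have h1 : ∫⁻ a, ∑' i, ‖F i a‖ₑ ∂μ ≠ ⊤ := by
    rw [lintegral_tsum fun i => (hF i).1.aemeasurable.enorm]
    have : ∀ i, ∫⁻ a, ‖F i a‖ₑ ∂μ = ENNReal.ofReal (∫ a, ‖F i a‖ ∂μ) := fun i => by
      rw [ofReal_integral_norm_eq_lintegral_enorm (hF i)]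
    simp only [this]
    exact hs.tsum_ofReal_ne_top
  refine ⟨h1, ?_⟩
  filter_upwards [ae_lt_top' (AEMeasurable.tsum fun i => (hF i).1.aemeasurable.enorm) h1] with a ha
  simpa using ENNReal.summable_toReal ha.ne

theorem integrable_tsum_of_summable_integral_norm {α ι : Type*} [MeasurableSpace α] {μ : Measure α}
    [Countable ι] {F : ι → α → ℂ} (hF : ∀ i, Integrable (F i) μ)
    (hs : Summable fun i => ∫ a, ‖F i a‖ ∂μ) : Integrable (fun a => ∑' i, F i a) μ := by
  obtain ⟨h1, h2⟩ := ae_summable_norm_of_summable_integral_norm hF hs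
  refine ⟨aestronglyMeasurable_of_tendsto_ae (Filter.atTop : Filter (Finset ι))
    (f := fun s a => ∑ i ∈ s, F i a)
    (fun s => Finset.aestronglyMeasurable_fun_sum s fun i _ => (hF i).1) ?_, ?_⟩
  · filter_upwards [h2] with a ha
    have := ha.of_norm.hasSum
    rwa [HasSum, SummationFilter.unconditional_filter] at this
  · refine lt_of_le_of_lt (lintegral_mono fun a => ?_) h1.lt_top
    exact enorm_tsum_le_tsum_enorm

section Rank

variable {V : Type*} [NormedAddCommGroup V] [InnerProductSpace ℂ V]

/-- The trace class operator `∑ k, |u k⟩⟨v k|`. -/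
def rankSum {ι : Type*} (u v : ι → V) : V →L[ℂ] V :=
  ∑' k, (innerSL ℂ (v k)).smulRight (u k)

theorem inner_rankSum [CompleteSpace V] {ι : Type*} {u v : ι → V} (hu : Summable fun k => ‖u k‖ ^ 2)
    (hv : Summable fun k => ‖v k‖ ^ 2) (f g : V) :
    inner ℂ f (rankSum u v g) = ∑' k, inner ℂ f (u k) * inner ℂ (v k) g := by
  have h1 : Summable fun k => (innerSL ℂ (v k)).smulRight (u k) := by
    refine Summable.of_norm ((summable_norm_mul_norm hv hu).congr fun k => ?_)
    rw [ContinuousLinearMap.norm_smulRight_apply, innerSL_apply_norm]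
  let L : (V →L[ℂ] V) →L[ℂ] ℂ := (innerSL ℂ f).comp (ContinuousLinearMap.apply ℂ V g)
  have h2 := L.map_tsum h1
  change inner ℂ f (rankSum u v g) = _ at h2
  rw [h2]
  refine tsum_congr fun k => ?_
  change inner ℂ f (inner ℂ (v k) g • u k) = _
  rw [inner_smul_right, mul_comm]

theorem clm_eq_of_basis {κ : Type*} (b : HilbertBasis κ ℂ V) {X Y : V →L[ℂ] V}
    (h : ∀ i j, inner ℂ (b i) (X (b j)) = inner ℂ (b i) (Y (b j))) : X = Y := by
  refine ContinuousLinearMap.ext_on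
    (Submodule.dense_iff_topologicalClosure_eq_top.2 b.dense_span) ?_
  rintro _ ⟨j, rfl⟩
  apply b.repr.injective
  ext i
  simpa only [b.repr_apply_apply] using h i j

end Rank

theorem integrable_smul_phasePoint {m : ℕ} {φ : Phase m → ℂ} (hφ : Integrable φ) (g : H m) :
    Integrable fun z => φ z • phasePoint z g :=
  (hφ.norm.mul_const ((Real.pi ^ m)⁻¹ * ‖g‖)).mono'
    (hφ.1.smul (continuous_phasePoint g).aestronglyMeasurable)
    (Filter.Eventually.of_forall fun z => by rw [norm_smul, norm_phasePoint])

/-- The Weyl quantization of an integrable function, as a bounded operator. -/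
def weyl {m : ℕ} {φ : Phase m → ℂ} (hφ : Integrable φ) : H m →L[ℂ] H m :=
  LinearMap.mkContinuous
    { toFun := fun g => ∫ z, φ z • phasePoint z g
      map_add' := fun g g' => by
        rw [← integral_add (integrable_smul_phasePoint hφ g) (integrable_smul_phasePoint hφ g')]
        simp
      map_smul' := fun c g => by
        rw [RingHom.id_apply, ← integral_smul]
        simp only [map_smul, smul_comm c] } ((Real.pi ^ m)⁻¹ * ∫ z, ‖φ z‖)
    (fun g => by
      refine (norm_integral_le_integral_norm _).trans (le_of_eq ?_)
      simp only [norm_smul, norm_phasePoint]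
      rw [integral_mul_const]
      ring)

theorem inner_weyl {m : ℕ} {φ : Phase m → ℂ} (hφ : Integrable φ) (f g : H m) :
    inner ℂ f (weyl hφ g) = ∫ z, φ z * inner ℂ f (phasePoint z g) := by
  have h := integral_inner (𝕜 := ℂ) (integrable_smul_phasePoint hφ g) f
  simp only [inner_smul_right] at h
  exact h.symm

/-- It suffices to check matrix elements in a Hilbert basis. -/
theorem IsWeylSum.of_basis {m : ℕ} {κ ι : Type*} (b : HilbertBasis κ ℂ (H m)) {φ : Phase m → ℂ}
    {u v : ι → H m} (hφ : Integrable φ) (hu : Summable fun k => ‖u k‖ ^ 2)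
    (hv : Summable fun k => ‖v k‖ ^ 2)
    (h : ∀ i j, ∑' k, inner ℂ (b i) (u k) * inner ℂ (v k) (b j)
      = ∫ z, φ z * inner ℂ (b i) (phasePoint z (b j))) : IsWeylSum φ u v where
  integrable := hφ
  summable_left := hu
  summable_right := hv
  tsum_eq f g := by
    rw [← inner_rankSum hu hv, ← inner_weyl hφ, clm_eq_of_basis (X := rankSum u v) (Y := weyl hφ) b]
    intro i j
    rw [inner_rankSum hu hv, inner_weyl, h]

/-! ### Adding modes in the vacuum state -/

/-- Phase point operators of a composite system are tensor products, so the symbol of `G ⊗ |Ω⟩⟨Ω|`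
is the product of the symbols. It suffices to check this on a product basis. -/
theorem IsWeylSum.tensor_vacuum {m : ℕ} {ι : Type*} {φ : Phase m → ℂ} {u v : ι → H m}
    (h : IsWeylSum φ u v) (k : ℕ) :
    IsWeylSum (fun z : Phase (m + k) => φ (phaseFst z)
        * (((2 * Real.pi) ^ k * vacuumWigner (phaseSnd z) : ℝ) : ℂ))
      (fun i => tensor (u i) (vacuum k)) (fun i => tensor (v i) (vacuum k)) := by
  have hV := isWeylSum_vacuum k
  refine IsWeylSum.of_basis (tensorBasis (basis m) (basis k)) ?_ ?_ ?_ ?_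
  · exact (measurePreserving_phaseSplit m k).integrable_comp_of_integrable
      (h.integrable.mul_prod hV.integrable)
  · simpa [norm_tensor, norm_vacuum] using h.summable_left
  · simpa [norm_tensor, norm_vacuum] using h.summable_right
  · rintro ⟨i, j⟩ ⟨i', j'⟩
    simp only [tensorBasis_apply, inner_tensor_tensor, phasePoint_tensor]
    have e1 : ∀ x, inner ℂ (basis m i) (u x) * inner ℂ (basis k j) (vacuum k) *
        (inner ℂ (v x) (basis m i') * inner ℂ (vacuum k) (basis k j'))
        = inner ℂ (basis m i) (u x) * inner ℂ (v x) (basis m i') *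
        (inner ℂ (basis k j) (vacuum k) * inner ℂ (vacuum k) (basis k j')) := fun x => by ring
    simp only [e1]
    rw [tsum_mul_right, h.tsum_eq]
    have e2 := hV.tsum_eq (basis k j) (basis k j')
    rw [tsum_fintype, Finset.univ_unique, Finset.sum_singleton] at e2
    rw [e2, ← integral_prod_mul, ← Measure.volume_eq_prod,
      ← (measurePreserving_phaseSplit m k).integral_comp (phaseSplit m k).measurableEmbedding]
    refine integral_congr_ae (Filter.Eventually.of_forall fun z => ?_)
    simp only [phaseSplit, MeasurableEquiv.coe_mk, Equiv.coe_fn_mk]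
    ring

/-! ### Homodyne detection on some of the modes -/

section Slice

variable {n l : ℕ} {ι : Type*} {Φ : Phase (n + l) → ℂ} {U V : ι → H (n + l)}

/-- Reordered coordinates of a composite system: the positions of the last modes, their momenta,
and the phase space coordinates of the first modes. -/
def phaseReorder (n l : ℕ) (y : Fin l → ℝ) (w : (Fin l → ℝ) × Phase n) : Phase (n + l) :=
  (phaseSplit n l).symm (w.2, (y, w.1))

/-- The partial matrix element `⟨f| G |g⟩` is an operator on the measured modes alone. Its symbol
need not be real, which is why `IsWeylSum` admits complex `φ`. -/
theorem IsWeylSum.partialInner (h : IsWeylSum Φ U V) (f g : H n) :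
    IsWeylSum (fun z' : Phase l => ∫ z : Phase n, Φ ((phaseSplit n l).symm (z, z'))
        * inner ℂ f (phasePoint z g))
      (fun k => Bosonic.partialInner f (U k)) (fun k => Bosonic.partialInner g (V k)) := by
  have hΦ : Integrable (fun p : Phase n × Phase l => Φ ((phaseSplit n l).symm p))
      (volume.prod volume) :=
    (measurePreserving_phaseSplit n l).symm.integrable_comp_of_integrable h.integrable
  have hΦf : Integrable (fun p : Phase n × Phase l => Φ ((phaseSplit n l).symm p)
      * inner ℂ f (phasePoint p.1 g)) (volume.prod volume) :=
    hΦ.mul_bdd (c := (Real.pi ^ n)⁻¹ * (‖f‖ * ‖g‖))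
      ((continuous_const.inner (continuous_phasePoint g)).comp continuous_fst).aestronglyMeasurable
      (Filter.Eventually.of_forall fun z => norm_inner_phasePoint_le z.1 f g)
  refine ⟨hΦf.integral_prod_right, summable_norm_sq_map h.summable_left _,
    summable_norm_sq_map h.summable_right _, fun a c => ?_⟩
  simp only [inner_partialInner, inner_partialInner']
  rw [h.tsum_eq]
  have hΦa : Integrable (fun p : Phase n × Phase l => Φ ((phaseSplit n l).symm p)
      * inner ℂ f (phasePoint p.1 g) * inner ℂ a (phasePoint p.2 c)) (volume.prod volume) :=
    hΦf.mul_bdd (c := (Real.pi ^ l)⁻¹ * (‖a‖ * ‖c‖))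
      ((continuous_const.inner (continuous_phasePoint c)).comp continuous_snd).aestronglyMeasurable
      (Filter.Eventually.of_forall fun z => norm_inner_phasePoint_le z.2 a c)
  simp only [← integral_mul_const]
  rw [← integral_prod_symm _ hΦa, ← Measure.volume_eq_prod,
    ← (measurePreserving_phaseSplit n l).integral_comp (phaseSplit n l).measurableEmbedding]
  refine integral_congr_ae (Filter.Eventually.of_forall fun z => ?_)
  simp only [MeasurableEquiv.symm_apply_apply, phasePoint_tensor, inner_tensor_tensor, mul_assoc]
  rfl

theorem measurePreserving_phaseReorder (n l : ℕ) :
    MeasurePreserving (fun p : (Fin l → ℝ) × ((Fin l → ℝ) × Phase n) => phaseReorder n l p.1 p.2)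
      volume volume := by
  have h1 : MeasurePreserving (MeasurableEquiv.prodAssoc.symm :
      (Fin l → ℝ) × ((Fin l → ℝ) × Phase n) ≃ᵐ ((Fin l → ℝ) × (Fin l → ℝ)) × Phase n)
      volume volume := (volume_preserving_prodAssoc (α₁ := Fin l → ℝ) (β₁ := Fin l → ℝ)
        (γ₁ := Phase n)).symm
  have h2 : MeasurePreserving (Prod.swap : Phase l × Phase n → Phase n × Phase l) volume volume :=
    Measure.measurePreserving_swap
  exact ((measurePreserving_phaseSplit n l).symm.comp h2).comp h1

/-- The symbol of the operator that remains after finding the last modes at the position `y`. -/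
def sliceSymbol (Φ : Phase (n + l) → ℂ) (y : Fin l → ℝ) (z : Phase n) : ℂ :=
  (((2 * Real.pi) ^ l)⁻¹ : ℂ) * ∫ p, Φ (phaseReorder n l y (p, z))

theorem inner_displacement_momentum (ξ : Fin l → ℝ) (a c : H l) :
    inner ℂ a (displacement (0, ξ) c)
      = ∫ y, ephase (∑ j, ξ j * y j) * ((starRingEnd ℂ) (a y) * c y) := by
  rw [L2.inner_def]
  refine integral_congr_ae ?_
  filter_upwards [coeFn_displacement (0, ξ) c] with y hy
  rw [hy, RCLike.inner_apply, dispPhase_eq]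
  simp only [Pi.zero_apply, zero_mul, Finset.sum_const_zero, zero_div, sub_zero]
  ring

/-- Both sides, as functions of `y`, have the same Fourier transform: at `ξ` it is the
characteristic function of the partial matrix element at the pure momentum displacement `(0, ξ)`.
Fourier uniqueness gives equality almost everywhere. -/
theorem IsWeylSum.ae_tsum_partialInner [Countable ι] (h : IsWeylSum Φ U V) (f g : H n) :
    ∀ᵐ y, ∑' k, (starRingEnd ℂ) ((Bosonic.partialInner g (V k)) y)
        * (Bosonic.partialInner f (U k)) y
      = ∫ z, sliceSymbol Φ y z * inner ℂ f (phasePoint z g) := by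
  have hp := h.partialInner f g
  set F : ι → (Fin l → ℝ) → ℂ := fun k y => (starRingEnd ℂ) ((Bosonic.partialInner g (V k)) y)
        * (Bosonic.partialInner f (U k)) y with hF
  set G : (Fin l → ℝ) → ℂ := fun y => (((2 * Real.pi) ^ l)⁻¹ : ℂ) * ∫ p : Fin l → ℝ,
    ∫ z : Phase n, Φ ((phaseSplit n l).symm (z, (y, p))) * inner ℂ f (phasePoint z g) with hG
  have hFi : ∀ k, Integrable (F k) := fun k => (Lp.memLp _).star.integrable_mul (Lp.memLp _)
  have hFs : Summable fun k => ∫ y, ‖F k y‖ := by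
    refine Summable.of_nonneg_of_le (fun k => integral_nonneg fun y => norm_nonneg _)
      (fun k => ?_) ((hp.summable_right.add hp.summable_left).div_const 2)
    rw [norm_sq_eq_integral, norm_sq_eq_integral, ← integral_add (integrable_norm_sq _)
      (integrable_norm_sq _), ← integral_div]
    refine integral_mono (hFi k).norm (((integrable_norm_sq _).add (integrable_norm_sq _)).div_const
      2) fun y => ?_
    simp only [hF, norm_mul, RCLike.norm_conj]
    exact mul_le_half_add_sq _ _
  have hFt : Integrable fun y => ∑' k, F k y := integrable_tsum_of_summable_integral_norm hFi hFs
  have hGi : Integrable G := hp.integrable.integral_prod_left.const_mul _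
  have hFG : ∀ ξ, fourierPi (fun y => ∑' k, F k y) ξ = fourierPi G ξ := fun ξ => by
    have hc : Continuous fun y : Fin l → ℝ => ephase (∑ j, ξ j * y j) :=
      continuous_ephase.comp (by fun_prop)
    have h1 : fourierPi (fun y => ∑' k, F k y) ξ = ∑' k, ∫ y, ephase (∑ j, ξ j * y j) * F k y := by
      rw [fourierPi, integral_tsum_of_summable_integral_norm]
      · simp only [tsum_mul_left]
      · exact fun k => (hFi k).bdd_mul (c := 1) hc.aestronglyMeasurable
          (Filter.Eventually.of_forall fun y => by simp)
      · simpa using hFs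
    have h2 := hp.tsum_inner_displacement (0, ξ)
    simp only [inner_displacement_momentum] at h2
    rw [h1, h2, fourierPi, Measure.volume_eq_prod, integral_prod, ← integral_const_mul]
    · refine integral_congr_ae (Filter.Eventually.of_forall fun y => ?_)
      simp only [hG, symp]
      rw [← integral_const_mul, ← integral_const_mul, ← integral_const_mul]
      refine integral_congr_ae (Filter.Eventually.of_forall fun p => ?_)
      have : -∑ j, ((0 : Fin l → ℝ) j * p j - ξ j * y j) = ∑ j, ξ j * y j := by
        rw [← Finset.sum_neg_distrib]
        exact Finset.sum_congr rfl fun j _ => by simp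
      simp only [this]
      ring
    · exact hp.integrable.mul_bdd (c := 1)
        (continuous_ephase.comp (continuous_symp (0, ξ)).neg).aestronglyMeasurable
        (Filter.Eventually.of_forall fun z => by simp)
  have h0 := ae_eq_zero_of_fourierPi_eq_zero (hFt.sub hGi) fun ξ => by
    have hc : Continuous fun y : Fin l → ℝ => ephase (∑ j, ξ j * y j) :=
      continuous_ephase.comp (by fun_prop)
    have hb : ∀ K : (Fin l → ℝ) → ℂ, Integrable K →
        Integrable fun y => ephase (∑ j, ξ j * y j) * K y := fun K hK =>
      hK.bdd_mul (c := 1) hc.aestronglyMeasurable (Filter.Eventually.of_forall fun y => by simp)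
    have := hFG ξ
    simp only [fourierPi, Pi.sub_apply, mul_sub] at this ⊢
    rw [integral_sub (hb _ hFt) (hb _ hGi), this, sub_self]
  -- For almost every `y` the symbol is integrable in the remaining variables, so the integrals over
  -- the measured momentum and the kept phase space may be exchanged.
  have hΘ := ((measurePreserving_phaseReorder n l).integrable_comp_of_integrable
    h.integrable).prod_right_ae
  filter_upwards [h0, hΘ] with y hy hΘy
  have h3 : ∑' k, F k y = G y := sub_eq_zero.1 hy
  have h4 : Integrable (fun w : (Fin l → ℝ) × Phase n => Φ (phaseReorder n l y w)
      * inner ℂ f (phasePoint w.2 g)) (volume.prod volume) :=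
    hΘy.mul_bdd (c := (Real.pi ^ n)⁻¹ * (‖f‖ * ‖g‖))
      ((continuous_const.inner (continuous_phasePoint g)).comp continuous_snd).aestronglyMeasurable
      (Filter.Eventually.of_forall fun z => norm_inner_phasePoint_le z.2 f g)
  rw [h3, hG]
  simp only [sliceSymbol]
  have h5 := integral_integral_swap
    (f := fun p z => Φ (phaseReorder n l y (p, z)) * inner ℂ f (phasePoint z g)) h4
  simp only [phaseReorder, integral_mul_const] at h5 ⊢
  rw [h5, ← integral_const_mul]
  simp only [mul_assoc]

theorem ae_summable_slice [Countable ι] (hU : Summable fun k => ‖U k‖ ^ 2) :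
    ∀ᵐ y, Summable fun k => ‖slice (U k) y‖ ^ 2 := by
  have h1 : ∫⁻ y, ∑' k, ‖slice (U k) y‖ₑ ^ 2 ≠ ⊤ := by
    rw [lintegral_tsum fun k => (aestronglyMeasurable_slice _).enorm.pow_const 2]
    simp only [lintegral_enorm_sq_slice]
    exact hU.tsum_ofReal_ne_top
  filter_upwards [ae_lt_top' (AEMeasurable.tsum fun k =>
    (aestronglyMeasurable_slice (U k)).enorm.pow_const 2) h1] with y hy
  simpa using ENNReal.summable_toReal hy.ne

/-- Homodyne detection acts on symbols by restriction of the position and integration over the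
momentum of the measured modes. -/
theorem IsWeylSum.ae_slice [Countable ι] (h : IsWeylSum Φ U V) :
    ∀ᵐ y, IsWeylSum (sliceSymbol Φ y) (fun k => slice (U k) y) (fun k => slice (V k) y) := by
  have hΘ := ((measurePreserving_phaseReorder n l).integrable_comp_of_integrable
    h.integrable).prod_right_ae
  -- Countability of the basis and of `ι` collects all exceptional sets into a single null set of
  -- outcomes.
  have h1 : ∀ᵐ y, ∀ i j, _ := ae_all_iff.2 fun i => ae_all_iff.2 fun j =>
    h.ae_tsum_partialInner (basis n i) (basis n j)
  have h2 : ∀ᵐ y, ∀ k, _ := ae_all_iff.2 fun k => ae_inner_slice (U k)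
  have h3 : ∀ᵐ y, ∀ k, _ := ae_all_iff.2 fun k => ae_inner_slice (V k)
  filter_upwards [h1, h2, h3, hΘ, ae_summable_slice h.summable_left,
    ae_summable_slice h.summable_right] with y h1 h2 h3 hΘ h4 h5
  refine IsWeylSum.of_basis (basis n) (hΘ.integral_prod_right.const_mul _) h4 h5 fun i j => ?_
  rw [← h1 i j]
  refine tsum_congr fun k => ?_
  rw [h2, ← inner_conj_symm (slice (V k) y), h3, mul_comm]

end Slice

/-! ### Effects of measurement protocols -/

theorem isPositive_of_inner_eq_ofReal {V : Type*} [NormedAddCommGroup V] [InnerProductSpace ℂ V]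
    [CompleteSpace V] {X : V →L[ℂ] V} (h : ∀ x, ∃ r : ℝ, 0 ≤ r ∧ inner ℂ x (X x) = (r : ℂ)) :
    X.IsPositive := by
  rw [ContinuousLinearMap.isPositive_iff_complex]
  intro x
  obtain ⟨r, hr, hx⟩ := h x
  rw [← inner_conj_symm, hx]
  simp [hr]

theorem inner_eq_ofReal_re {V : Type*} [NormedAddCommGroup V] [InnerProductSpace ℂ V]
    [CompleteSpace V] {X : V →L[ℂ] V} (h : X.IsPositive) (x : V) :
    0 ≤ (inner ℂ x (X x)).re ∧ inner ℂ x (X x) = (((inner ℂ x (X x)).re : ℝ) : ℂ) := by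
  have h1 := h.inner_nonneg_right x
  rw [Complex.le_def] at h1
  exact ⟨h1.1, Complex.ext rfl h1.2.symm⟩

theorem norm_le_one_of_isPositive {V : Type*} [NormedAddCommGroup V] [InnerProductSpace ℂ V]
    [CompleteSpace V] {X : V →L[ℂ] V} (h : X.IsPositive) (h' : (1 - X).IsPositive) : ‖X‖ ≤ 1 := by
  rw [CStarAlgebra.norm_le_one_iff_of_nonneg X
    ((ContinuousLinearMap.nonneg_iff_isPositive X).2 h)]
  exact (ContinuousLinearMap.le_def _ _).2 h'

/-! ### One round of a protocol -/

section Round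

variable {m k n l : ℕ} {U : H (m + k) ≃ₗᵢ[ℂ] H (n + l)} {N : (Fin l → ℝ) → (H n →L[ℂ] H n)}
  {T : H (n + l) →L[ℂ] H (n + l)} {M : H m →L[ℂ] H m}

theorem isPositive_round (hN1 : ∀ y, ‖N y‖ ≤ 1) (hN : ∀ y, (N y).IsPositive)
    (hmeas : ∀ f f' : H n, Measurable fun y => inner ℂ f (N y f')) (hT : IsConditional N T)
    (hM : ∀ φ ψ : H m, inner ℂ φ (M ψ) =
      inner ℂ (U (tensor φ (vacuum k))) (T (U (tensor ψ (vacuum k))))) : M.IsPositive := by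
  refine isPositive_of_inner_eq_ofReal fun x => ?_
  rw [hM, hT.inner_eq_integral hN1 hmeas]
  refine ⟨∫ y, (inner ℂ (slice (U (tensor x (vacuum k))) y)
    (N y (slice (U (tensor x (vacuum k))) y))).re, integral_nonneg fun y =>
    (inner_eq_ofReal_re (hN y) _).1, ?_⟩
  rw [← integral_complex_ofReal]
  exact integral_congr_ae (Filter.Eventually.of_forall fun y => (inner_eq_ofReal_re (hN y) _).2)

/-- A test operator with non-negative symbol is carried through the round: vacuum modes, the
Gaussian unitary and slicing at `y` all keep the symbol non-negative. The trace against `M` becomes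
the integral over `y` of traces against `N y`, each non-negative by hypothesis. -/
theorem strongWignerNonneg_round (hmodes : m + k = n + l) (hU : IsGaussianUnitary U)
    (hN1 : ∀ y, ‖N y‖ ≤ 1) (hN : ∀ y, StrongWignerNonneg (N y))
    (hmeas : ∀ f f' : H n, Measurable fun y => inner ℂ f (N y f')) (hT : IsConditional N T)
    (hM : ∀ φ ψ : H m, inner ℂ φ (M ψ) =
      inner ℂ (U (tensor φ (vacuum k))) (T (U (tensor ψ (vacuum k))))) : StrongWignerNonneg M := by
  intro ι _ φ u v hφ h
  have h1 := h.tensor_vacuum k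
  simp only [← Complex.ofReal_mul] at h1
  obtain ⟨φ', hφ', h2⟩ := hU.exists_isWeylSum hmodes (fun z => mul_nonneg (hφ _)
    (mul_nonneg (by have := Real.pi_pos; positivity) (vacuumWigner_nonneg _))) h1
  simp only [hM, hT.inner_eq_integral hN1 hmeas]
  set F := fun i => U (tensor (u i) (vacuum k)) with hF
  set G := fun i => U (tensor (v i) (vacuum k)) with hG
  have hi : ∀ i, Integrable fun y => inner ℂ (slice (G i) y) (N y (slice (F i) y)) := fun i =>
    integrable_inner_slice hN1 hmeas _ _
  -- Slices have total squared norm equal to that of the vector, so `‖s‖‖t‖ ≤ (‖s‖² + ‖t‖²)/2`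
  -- reduces summability to that of the original families.
  have hs : Summable fun i => ∫ y, ‖inner ℂ (slice (G i) y) (N y (slice (F i) y))‖ := by
    refine Summable.of_nonneg_of_le (fun k => integral_nonneg fun y => norm_nonneg _)
      (fun k => ?_) ((h2.summable_right.add h2.summable_left).div_const 2)
    rw [← integral_norm_sq_slice (F k), ← integral_norm_sq_slice (G k),
      ← integral_add (integrable_norm_sq_slice _) (integrable_norm_sq_slice _), ← integral_div]
    refine integral_mono (hi k).norm
      (((integrable_norm_sq_slice _).add (integrable_norm_sq_slice _)).div_const 2) fun y => ?_
    exact (norm_inner_apply_le (hN1 y) _ _).trans (mul_le_half_add_sq _ _)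
  rw [integral_tsum_of_summable_integral_norm hi hs]
  have hre := integral_re (𝕜 := ℂ) (integrable_tsum_of_summable_integral_norm hi hs)
  rw [← RCLike.re_eq_complex_re, ← hre]
  refine integral_nonneg_of_ae ?_
  filter_upwards [h2.ae_slice] with y hy
  have e : sliceSymbol (n := n) (fun z => (φ' z : ℂ)) y = fun z =>
      ((((2 * Real.pi) ^ l)⁻¹ * ∫ p, φ' (phaseReorder n l y (p, z)) : ℝ) : ℂ) := by
    funext z
    rw [sliceSymbol, integral_complex_ofReal]
    push_cast
    ring
  rw [e] at hy
  refine hN y ι _ _ _ (fun z => ?_) hy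
  exact mul_nonneg (by have := Real.pi_pos; positivity) (integral_nonneg fun p => hφ' _)

end Round

theorem strongWignerNonneg_zero (m : ℕ) : StrongWignerNonneg (0 : H m →L[ℂ] H m) := by
  intro ι _ φ u v hφ h
  simp

theorem strongWignerNonneg_one (m : ℕ) : StrongWignerNonneg (1 : H m →L[ℂ] H m) := by
  intro ι _ φ u v hφ h
  have h1 := h.tsum_inner
  rw [integral_complex_ofReal] at h1
  have h2 : ∑' k, inner ℂ (v k) ((1 : H m →L[ℂ] H m) (u k))
      = ((((2 * Real.pi) ^ m)⁻¹ * ∫ z, φ z : ℝ) : ℂ) := by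
    push_cast
    exact h1
  rw [h2, Complex.ofReal_re]
  exact mul_nonneg (by have := Real.pi_pos; positivity) (integral_nonneg hφ)

/-- The operators describing a binary measurement that is positive, with non-negative Wigner
functions. -/
structure IsWignerEffect {m : ℕ} (M : H m →L[ℂ] H m) : Prop where
  pos : M.IsPositive
  pos_compl : (1 - M).IsPositive
  wigner : StrongWignerNonneg M
  wigner_compl : StrongWignerNonneg (1 - M)

theorem IsWignerEffect.compl {m : ℕ} {M : H m →L[ℂ] H m} (h : IsWignerEffect M) :
    IsWignerEffect (1 - M) :=
  ⟨h.pos_compl, by simpa using h.pos, h.wigner_compl, by simpa using h.wigner⟩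

theorem isWignerEffect_zero (m : ℕ) : IsWignerEffect (0 : H m →L[ℂ] H m) :=
  ⟨ContinuousLinearMap.isPositive_zero, by simp, strongWignerNonneg_zero m, by
    simpa using strongWignerNonneg_one m⟩

/-- The invariant is symmetric under `M ↦ 1 - M`: the complement satisfies the same round equations
with `N y`, `T` replaced by `1 - N y`, `1 - T`, so each round lemma is applied twice. Positivity of
both operators also gives the bound `‖N y‖ ≤ 1` used for integrability. -/
theorem IsProtocolEffect.isWignerEffect {R m : ℕ} {M : H m →L[ℂ] H m}
    (h : IsProtocolEffect R m M) : IsWignerEffect M := by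
  induction h with
  | reject => exact isWignerEffect_zero 0
  | accept => simpa using (isWignerEffect_zero 0).compl
  | @round R m k n l hmodes U hU N hN hmeas T hT M hM ih =>
    have hN1 : ∀ y, ‖N y‖ ≤ 1 := fun y => norm_le_one_of_isPositive (ih y).pos (ih y).pos_compl
    have hN1' : ∀ y, ‖1 - N y‖ ≤ 1 := fun y =>
      norm_le_one_of_isPositive (ih y).compl.pos (ih y).compl.pos_compl
    have hmeas' : ∀ f f' : H n, Measurable fun y => inner ℂ f ((1 - N y) f') := fun f f' => by
      simp only [sub_apply, one_apply_eq_self, inner_sub_right]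
      exact measurable_const.sub (hmeas f f')
    have hT' : IsConditional (fun y => 1 - N y) (1 - T) := fun f f' g g' => by
      have hi : Integrable fun y => (starRingEnd ℂ) (g y) * g' y :=
        (Lp.memLp g).star.integrable_mul (Lp.memLp g')
      simp only [sub_apply, one_apply_eq_self, inner_sub_right,
        mul_sub]
      rw [integral_sub (hi.mul_const _) (integrable_conditional hN1 hmeas f f' g g'), ← hT,
        inner_tensor_tensor, integral_mul_const, mul_comm]
      simp only [L2.inner_def, RCLike.inner_apply']
    have hM' : ∀ φ ψ : H m, inner ℂ φ ((1 - M) ψ) =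
        inner ℂ (U (tensor φ (vacuum k))) ((1 - T) (U (tensor ψ (vacuum k)))) := fun φ ψ => by
      simp only [sub_apply, one_apply_eq_self, inner_sub_right, hM,
        LinearIsometryEquiv.inner_map_map, inner_tensor_tensor, inner_self_eq_norm_sq_to_K,
        norm_vacuum]
      simp
    exact ⟨isPositive_round hN1 (fun y => (ih y).pos) hmeas hT hM,
      isPositive_round hN1' (fun y => (ih y).pos_compl) hmeas' hT' hM',
      strongWignerNonneg_round hmodes hU hN1 (fun y => (ih y).wigner) hmeas hT hM,
      strongWignerNonneg_round hmodes hU hN1' (fun y => (ih y).wigner_compl) hmeas' hT' hM'⟩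

/-! ### Weyl quantization of Schwartz functions -/

theorem norm_sq_le_phaseNormSq {m : ℕ} (z : Phase m) : ‖z‖ ^ 2 ≤ phaseNormSq z := by
  have h1 : ‖z‖ ≤ Real.sqrt (phaseNormSq z) := by
    have : ∀ j, z.1 j ^ 2 + z.2 j ^ 2 ≤ phaseNormSq z := fun j =>
      Finset.single_le_sum (f := fun j => z.1 j ^ 2 + z.2 j ^ 2) (fun j _ => by positivity)
        (Finset.mem_univ j)
    refine max_le ((pi_norm_le_iff_of_nonneg (Real.sqrt_nonneg _)).2 fun j => ?_)
      ((pi_norm_le_iff_of_nonneg (Real.sqrt_nonneg _)).2 fun j => ?_) <;>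
    · rw [Real.norm_eq_abs]
      refine Real.abs_le_sqrt ?_
      nlinarith [this j, sq_nonneg (z.1 j), sq_nonneg (z.2 j)]
  calc ‖z‖ ^ 2 ≤ Real.sqrt (phaseNormSq z) ^ 2 := by gcongr
    _ = phaseNormSq z := Real.sq_sqrt (phaseNormSq_nonneg z)

/-- Peetre's inequality, which lets polynomial weights be transferred between nearby points. -/
theorem one_add_norm_le_mul {V : Type*} [SeminormedAddCommGroup V] (a b : V) :
    1 + ‖a‖ ≤ (1 + ‖a - b‖) * (1 + ‖b‖) := by
  have h := norm_le_norm_sub_add a b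
  nlinarith [norm_nonneg (a - b), norm_nonneg b, mul_nonneg (norm_nonneg (a - b)) (norm_nonneg b)]

/-- Convolution with a Gaussian preserves polynomial decay. -/
theorem weight_mul_gaussian_le {m : ℕ} (N : ℕ) (a b : Phase m) :
    (1 + ‖a‖) ^ N * Real.exp (-phaseNormSq (a - b) / 4)
      ≤ N.factorial * Real.exp 2 * (1 + ‖b‖) ^ N := by
  have h1 : (1 + ‖a - b‖) ^ N ≤ N.factorial * Real.exp (1 + ‖a - b‖) := by
    have := Real.pow_div_factorial_le_exp (1 + ‖a - b‖) (by positivity) N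
    rwa [div_le_iff₀ (by positivity), mul_comm] at this
  -- With `t = ‖a - b‖`, the exponent satisfies `1 + t - t²/4 ≤ 2`, because `(t - 2)² ≥ 0`.
  have h2 : Real.exp (1 + ‖a - b‖) * Real.exp (-phaseNormSq (a - b) / 4) ≤ Real.exp 2 := by
    rw [← Real.exp_add]
    refine Real.exp_le_exp.2 ?_
    nlinarith [norm_sq_le_phaseNormSq (a - b), sq_nonneg (‖a - b‖ - 2)]
  calc (1 + ‖a‖) ^ N * Real.exp (-phaseNormSq (a - b) / 4)
      ≤ ((1 + ‖a - b‖) * (1 + ‖b‖)) ^ N * Real.exp (-phaseNormSq (a - b) / 4) := by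
        gcongr
        exact one_add_norm_le_mul a b
    _ = (1 + ‖a - b‖) ^ N * Real.exp (-phaseNormSq (a - b) / 4) * (1 + ‖b‖) ^ N := by
        rw [mul_pow]; ring
    _ ≤ N.factorial * Real.exp (1 + ‖a - b‖) * Real.exp (-phaseNormSq (a - b) / 4)
          * (1 + ‖b‖) ^ N := by gcongr
    _ ≤ N.factorial * Real.exp 2 * (1 + ‖b‖) ^ N := by
        rw [mul_assoc (N.factorial : ℝ)]
        gcongr

theorem integrable_weight_mul_schwartz {D V : Type*} [NormedAddCommGroup D] [NormedSpace ℝ D]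
    [MeasurableSpace D] [BorelSpace D] [SecondCountableTopology D] [NormedAddCommGroup V]
    [NormedSpace ℝ V] (μ : Measure D) [μ.HasTemperateGrowth] (f : SchwartzMap D V) (N : ℕ) :
    Integrable (fun x => (1 + ‖x‖) ^ N * ‖f x‖) μ := by
  have h0 : Integrable (fun x => ‖f x‖) μ := by simpa using f.integrable_pow_mul μ 0
  refine ((h0.add (f.integrable_pow_mul μ N)).const_mul (2 ^ (N - 1))).mono'
    (Continuous.aestronglyMeasurable (by fun_prop)) (Filter.Eventually.of_forall fun x => ?_)
  have h1 := add_pow_le zero_le_one (norm_nonneg x) N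
  rw [Real.norm_of_nonneg (by positivity)]
  calc (1 + ‖x‖) ^ N * ‖f x‖ ≤ (2 ^ (N - 1) * (1 ^ N + ‖x‖ ^ N)) * ‖f x‖ := by gcongr
    _ = _ := by simp only [Pi.add_apply]; ring

/-- Phase space as a Euclidean space. -/
def euclideanPhase (m : ℕ) : EuclideanSpace ℝ (Fin m ⊕ Fin m) ≃L[ℝ] Phase m :=
  ((WithLp.linearEquiv 2 ℝ (Fin m ⊕ Fin m → ℝ)).trans
    (LinearEquiv.sumArrowLequivProdArrow (Fin m) (Fin m) ℝ ℝ)).toContinuousLinearEquiv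

/-- The symplectic dual variable of the Fourier transform. -/
def dualPhase (m : ℕ) (v : EuclideanSpace ℝ (Fin m ⊕ Fin m)) : Phase m :=
  (fun j => 2 * Real.pi * v (Sum.inr j), fun j => -(2 * Real.pi * v (Sum.inl j)))

theorem symp_dualPhase {m : ℕ} (v x : EuclideanSpace ℝ (Fin m ⊕ Fin m)) :
    symp (dualPhase m v) (euclideanPhase m x) = 2 * Real.pi * inner ℝ v x := by
  rw [PiLp.inner_apply, Fintype.sum_sum_type, ← Finset.sum_add_distrib, Finset.mul_sum, symp]
  refine Finset.sum_congr rfl fun j _ => ?_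
  change 2 * Real.pi * v (Sum.inr j) * x (Sum.inr j)
    - -(2 * Real.pi * v (Sum.inl j)) * x (Sum.inl j) = _
  simp only [RCLike.inner_apply, conj_trivial]
  ring

theorem continuous_dualPhase (m : ℕ) : Continuous (dualPhase m) := by
  unfold dualPhase; fun_prop

theorem norm_dualPhase_le {m : ℕ} (v : EuclideanSpace ℝ (Fin m ⊕ Fin m)) :
    ‖dualPhase m v‖ ≤ 2 * Real.pi * ‖v‖ := by
  have hπ := Real.pi_pos
  have h : ∀ i, ‖v i‖ ≤ ‖v‖ := fun i => PiLp.norm_apply_le v i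
  refine max_le ((pi_norm_le_iff_of_nonneg (by positivity)).2 fun j => ?_)
    ((pi_norm_le_iff_of_nonneg (by positivity)).2 fun j => ?_)
  · simp only [dualPhase, norm_mul, Real.norm_of_nonneg Real.pi_pos.le, Real.norm_ofNat]
    gcongr
    exact h _
  · simp only [dualPhase, norm_neg, norm_mul, Real.norm_of_nonneg Real.pi_pos.le, Real.norm_ofNat]
    gcongr
    exact h _

open FourierTransform in
/-- Fourier inversion on phase space. -/
theorem exists_symplectic_fourier {m : ℕ} (φ : SchwartzMap (Phase m) ℝ) :
    ∃ g : SchwartzMap (EuclideanSpace ℝ (Fin m ⊕ Fin m)) ℂ, ∀ z,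
      (φ z : ℂ) = ∫ v, g v * ephase (symp (dualPhase m v) z) := by
  let f : SchwartzMap (EuclideanSpace ℝ (Fin m ⊕ Fin m)) ℂ :=
    SchwartzMap.compCLMOfContinuousLinearEquiv ℝ (euclideanPhase m)
      (φ.postcompCLM Complex.ofRealCLM)
  refine ⟨𝓕 f, fun z => ?_⟩
  obtain ⟨x, rfl⟩ := (euclideanPhase m).surjective z
  have h1 : (φ (euclideanPhase m x) : ℂ) = f x := rfl
  have h2 : 𝓕⁻ (𝓕 (f : EuclideanSpace ℝ (Fin m ⊕ Fin m) → ℂ)) x = f x :=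
    congrFun (f.continuous.fourierInv_fourier_eq f.integrable (𝓕 f).integrable) x
  rw [h1, ← h2, Real.fourierInv_eq']
  refine integral_congr_ae (Filter.Eventually.of_forall fun v => ?_)
  simp only [symp_dualPhase, ephase, smul_eq_mul]
  rw [mul_comm]
  rfl

/-- As a function of `z` this is a Gaussian centred at the midpoint of `w` and `w'`, oscillating
with frequency `w - w'`. Integrated against a Schwartz `φ`, it therefore decays in the midpoint
because `φ` does, and in the difference because the Fourier transform of `φ` does. -/
theorem inner_displacement_phasePoint_displacement {m : ℕ} (w w' z : Phase m) :
    inner ℂ (displacement w (vacuum m)) (phasePoint z (displacement w' (vacuum m)))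
      = (((Real.pi ^ m)⁻¹ : ℝ) : ℂ) * (ephase (-symp w w' / 2) * (ephase (symp (w - w') z) *
        (Real.exp (-phaseNormSq (z - (1 / 2 : ℝ) • (w + w'))) : ℂ))) := by
  rw [phasePoint_apply, parity_displacement, parity_vacuum, inner_smul_right,
    displacement_displacement, inner_smul_right, inner_displacement_left,
    displacement_displacement, inner_smul_right, inner_vacuum_displacement]
  have h1 : -phaseNormSq (-w + ((2 : ℝ) • z + -w')) / 4
      = -phaseNormSq (z - (1 / 2 : ℝ) • (w + w')) := by
    have : -w + ((2 : ℝ) • z + -w') = (2 : ℝ) • (z - (1 / 2 : ℝ) • (w + w')) := by module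
    rw [this, phaseNormSq_smul]
    ring
  have h2 : -symp ((2 : ℝ) • z) (-w') / 2 + -symp (-w) ((2 : ℝ) • z + -w') / 2
      = -symp w w' / 2 + symp (w - w') z := by
    simp only [symp_smul_left, symp_smul_right, symp_neg_left, symp_neg_right, symp_add_right,
      symp_sub_left, symp_swap z w']
    ring
  rw [h1, ← mul_assoc (ephase _), ← ephase_add, h2, ephase_add]
  ring

theorem integrable_exp_phaseNormSq (m : ℕ) :
    Integrable fun z : Phase m => Real.exp (-phaseNormSq z) := by
  have h := (integrable_vacuumWigner m).const_mul (Real.pi ^ m)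
  refine h.congr (Filter.Eventually.of_forall fun z => ?_)
  have := Real.pi_pos
  simp only [vacuumWigner]
  field_simp

theorem norm_coherent_le_of_sum {m : ℕ} (φ : SchwartzMap (Phase m) ℝ) (N : ℕ) :
    ∃ C, 0 ≤ C ∧ ∀ w w' : Phase m, (1 + ‖(1 / 2 : ℝ) • (w + w')‖) ^ N *
      ‖∫ z, (φ z : ℂ) * inner ℂ (displacement w (vacuum m))
        (phasePoint z (displacement w' (vacuum m)))‖ ≤ C := by
  have hπ := Real.pi_pos
  have hi := integrable_weight_mul_schwartz volume φ N
  refine ⟨(Real.pi ^ m)⁻¹ * (N.factorial * Real.exp 2 * ∫ z, (1 + ‖z‖) ^ N * ‖φ z‖),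
    mul_nonneg (by positivity) (mul_nonneg (by positivity)
      (integral_nonneg fun z => by positivity)), fun w w' => ?_⟩
  obtain ⟨σ, hσ⟩ : ∃ σ, (1 / 2 : ℝ) • (w + w') = σ := ⟨_, rfl⟩
  rw [hσ]
  calc (1 + ‖σ‖) ^ N * ‖∫ z, (φ z : ℂ) * inner ℂ (displacement w (vacuum m))
        (phasePoint z (displacement w' (vacuum m)))‖
      = ‖∫ z, ((1 + ‖σ‖) ^ N : ℝ) • ((φ z : ℂ) * inner ℂ (displacement w (vacuum m))
        (phasePoint z (displacement w' (vacuum m))))‖ := by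
        rw [integral_smul, norm_smul, Real.norm_of_nonneg (by positivity)]
    _ ≤ ∫ z, (Real.pi ^ m)⁻¹ * (N.factorial * Real.exp 2 * ((1 + ‖z‖) ^ N * ‖φ z‖)) := by
        refine norm_integral_le_of_norm_le ((hi.const_mul _).const_mul _)
          (Filter.Eventually.of_forall fun z => ?_)
        rw [inner_displacement_phasePoint_displacement, hσ, norm_smul, norm_mul, norm_mul,
          norm_mul, norm_mul, norm_ephase, norm_ephase, one_mul, one_mul, Complex.norm_real,
          Complex.norm_real, Complex.norm_real, Real.norm_of_nonneg (Real.exp_pos _).le,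
          Real.norm_of_nonneg (show 0 ≤ (1 + ‖σ‖) ^ N by positivity),
          Real.norm_of_nonneg (show 0 ≤ (Real.pi ^ m)⁻¹ by positivity)]
        have h1 := weight_mul_gaussian_le N σ z
        have h2 : Real.exp (-phaseNormSq (z - σ)) ≤ Real.exp (-phaseNormSq (σ - z) / 4) := by
          refine Real.exp_le_exp.2 ?_
          rw [← neg_sub, phaseNormSq_neg]
          linarith [phaseNormSq_nonneg (σ - z)]
        calc (1 + ‖σ‖) ^ N * (‖φ z‖ * ((Real.pi ^ m)⁻¹ * Real.exp (-phaseNormSq (z - σ))))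
            ≤ (1 + ‖σ‖) ^ N * (‖φ z‖ * ((Real.pi ^ m)⁻¹ *
              Real.exp (-phaseNormSq (σ - z) / 4))) := by gcongr
          _ = (Real.pi ^ m)⁻¹ * ((1 + ‖σ‖) ^ N * Real.exp (-phaseNormSq (σ - z) / 4) * ‖φ z‖) := by
              ring
          _ ≤ (Real.pi ^ m)⁻¹ * (N.factorial * Real.exp 2 * (1 + ‖z‖) ^ N * ‖φ z‖) := by gcongr
          _ = _ := by ring
    _ = _ := by rw [integral_const_mul, integral_const_mul]

theorem norm_coherent_le_of_sub {m : ℕ} (φ : SchwartzMap (Phase m) ℝ) (N : ℕ) :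
    ∃ C, 0 ≤ C ∧ ∀ w w' : Phase m, (1 + ‖w - w'‖) ^ N *
      ‖∫ z, (φ z : ℂ) * inner ℂ (displacement w (vacuum m))
        (phasePoint z (displacement w' (vacuum m)))‖ ≤ C := by
  have hπ := Real.pi_pos
  obtain ⟨g, hg⟩ := exists_symplectic_fourier φ
  have hi := integrable_weight_mul_schwartz volume g N
  refine ⟨N.factorial * Real.exp 2 * ((1 + 2 * Real.pi) ^ N * ∫ v, (1 + ‖v‖) ^ N * ‖g v‖),
    mul_nonneg (by positivity) (mul_nonneg (by positivity)
      (integral_nonneg fun z => by positivity)), fun w w' => ?_⟩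
  set δ := w - w' with hδ
  set σ := (1 / 2 : ℝ) • (w + w') with hσ
  have hc : ∫ z, (φ z : ℂ) * inner ℂ (displacement w (vacuum m))
        (phasePoint z (displacement w' (vacuum m)))
      -- Inserting the Fourier representation of `φ` and shifting `z` by the midpoint leaves a
      -- Gaussian Fourier integral in `z`. Its value is concentrated where the dual variable is
      -- close to `-(w - w')`.
      = ephase (-symp w w' / 2) * ∫ v, g v * ephase (symp (dualPhase m v + δ) σ)
        * (Real.exp (-phaseNormSq (dualPhase m v + δ) / 4) : ℂ) := by
    have h1 : ∀ z, (φ (z + σ) : ℂ) * inner ℂ (displacement w (vacuum m))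
        (phasePoint (z + σ) (displacement w' (vacuum m)))
        = (((Real.pi ^ m)⁻¹ : ℝ) : ℂ) * ephase (-symp w w' / 2) *
          ∫ v, (g v * ephase (symp (dualPhase m v + δ) σ)) *
            ((Real.exp (-phaseNormSq z) : ℂ) * ephase (symp (dualPhase m v + δ) z)) := fun z => by
      have h2 : ∀ v, (g v * ephase (symp (dualPhase m v + δ) σ)) *
            ((Real.exp (-phaseNormSq z) : ℂ) * ephase (symp (dualPhase m v + δ) z))
          = (ephase (symp δ (z + σ)) * (Real.exp (-phaseNormSq z) : ℂ)) *
            (g v * ephase (symp (dualPhase m v) (z + σ))) := fun v => by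
        have : ephase (symp (dualPhase m v + δ) σ) * ephase (symp (dualPhase m v + δ) z)
            = ephase (symp δ (z + σ)) * ephase (symp (dualPhase m v) (z + σ)) := by
          rw [← ephase_add, ← ephase_add]
          congr 1
          simp only [symp_add_left, symp_add_right]
          ring
        linear_combination (g v * (Real.exp (-phaseNormSq z) : ℂ)) * this
      simp only [h2]
      rw [integral_const_mul, ← hg, inner_displacement_phasePoint_displacement, ← hδ, ← hσ,
        add_sub_cancel_right]
      ring
    rw [← integral_add_right_eq_self _ σ]
    simp only [h1]
    rw [integral_const_mul, integral_integral_swap]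
    · simp only [integral_const_mul, integral_gaussian_phase]
      have h3 : ∀ v, g v * ephase (symp (dualPhase m v + δ) σ) * ((Real.pi : ℂ) ^ m *
          (Real.exp (-phaseNormSq (dualPhase m v + δ) / 4) : ℂ)) = (Real.pi : ℂ) ^ m *
          (g v * ephase (symp (dualPhase m v + δ) σ) *
          (Real.exp (-phaseNormSq (dualPhase m v + δ) / 4) : ℂ)) := fun v => by ring
      simp only [h3]
      rw [integral_const_mul]
      have h4 : (((Real.pi ^ m)⁻¹ : ℝ) : ℂ) * (Real.pi : ℂ) ^ m = 1 := by
        push_cast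
        exact inv_mul_cancel₀ (pow_ne_zero _ (by exact_mod_cast hπ.ne'))
      linear_combination (ephase (-symp w w' / 2) * ∫ v, g v * ephase (symp (dualPhase m v + δ) σ)
        * (Real.exp (-phaseNormSq (dualPhase m v + δ) / 4) : ℂ)) * h4
    · have h5 : Integrable (fun p : Phase m × EuclideanSpace ℝ (Fin m ⊕ Fin m) =>
          (Real.exp (-phaseNormSq p.1) : ℂ) * g p.2) (volume.prod volume) :=
        (integrable_exp_phaseNormSq m).ofReal.mul_prod (g.integrable (μ := volume))
      have hd := continuous_dualPhase m
      have hcs : Continuous fun p : Phase m × EuclideanSpace ℝ (Fin m ⊕ Fin m) =>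
          ephase (symp (dualPhase m p.2 + δ) σ) * ephase (symp (dualPhase m p.2 + δ) p.1) := by
        refine (continuous_ephase.comp ?_).mul (continuous_ephase.comp ?_) <;>
        · unfold symp; fun_prop
      refine (h5.mul_bdd (c := 1) hcs.aestronglyMeasurable
        (Filter.Eventually.of_forall fun z => by simp)).congr
        (Filter.Eventually.of_forall fun p => ?_)
      simp only [Function.uncurry]
      ring
  rw [hc, norm_mul, norm_ephase, one_mul]
  calc (1 + ‖δ‖) ^ N * ‖∫ v, g v * ephase (symp (dualPhase m v + δ) σ)
        * (Real.exp (-phaseNormSq (dualPhase m v + δ) / 4) : ℂ)‖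
      = ‖∫ v, ((1 + ‖δ‖) ^ N : ℝ) • (g v * ephase (symp (dualPhase m v + δ) σ)
        * (Real.exp (-phaseNormSq (dualPhase m v + δ) / 4) : ℂ))‖ := by
        rw [integral_smul, norm_smul, Real.norm_of_nonneg (by positivity)]
    _ ≤ ∫ v, N.factorial * Real.exp 2 * ((1 + 2 * Real.pi) ^ N * ((1 + ‖v‖) ^ N * ‖g v‖)) := by
        refine norm_integral_le_of_norm_le ((hi.const_mul _).const_mul _)
          (Filter.Eventually.of_forall fun v => ?_)
        rw [norm_smul, norm_mul, norm_mul, norm_ephase, mul_one, Complex.norm_real,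
          Real.norm_of_nonneg (Real.exp_pos _).le, Real.norm_of_nonneg (by positivity)]
        have h6 := weight_mul_gaussian_le N δ (-dualPhase m v)
        rw [sub_neg_eq_add, add_comm δ, norm_neg] at h6
        have h7 : 1 + ‖dualPhase m v‖ ≤ (1 + 2 * Real.pi) * (1 + ‖v‖) := by
          have := norm_dualPhase_le v
          nlinarith [norm_nonneg v]
        calc (1 + ‖δ‖) ^ N * (‖g v‖ * Real.exp (-phaseNormSq (dualPhase m v + δ) / 4))
            = (1 + ‖δ‖) ^ N * Real.exp (-phaseNormSq (dualPhase m v + δ) / 4) * ‖g v‖ := by ring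
          _ ≤ N.factorial * Real.exp 2 * (1 + ‖dualPhase m v‖) ^ N * ‖g v‖ := by gcongr
          _ ≤ N.factorial * Real.exp 2 * ((1 + 2 * Real.pi) * (1 + ‖v‖)) ^ N * ‖g v‖ := by gcongr
          _ = _ := by rw [mul_pow]; ring
    _ = _ := by rw [integral_const_mul, integral_const_mul]

/-- Midpoint and difference together control both points: `1 + ‖w‖` and `1 + ‖w'‖` are each at most
`(1 + ‖σ‖)(1 + ‖δ‖)`. Multiplying the two decay estimates is what produces the square. -/
theorem norm_sq_coherent_le {m : ℕ} (φ : SchwartzMap (Phase m) ℝ) (K : ℕ) :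
    ∃ C, 0 ≤ C ∧ ∀ w w' : Phase m, (1 + ‖w‖) ^ K * ((1 + ‖w'‖) ^ K *
      ‖∫ z, (φ z : ℂ) * inner ℂ (displacement w (vacuum m))
        (phasePoint z (displacement w' (vacuum m)))‖ ^ 2) ≤ C := by
  obtain ⟨C₁, h1, hC₁⟩ := norm_coherent_le_of_sum φ (2 * K)
  obtain ⟨C₂, h2, hC₂⟩ := norm_coherent_le_of_sub φ (2 * K)
  refine ⟨C₁ * C₂, mul_nonneg h1 h2, fun w w' => ?_⟩
  set c := ‖∫ z, (φ z : ℂ) * inner ℂ (displacement w (vacuum m))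
        (phasePoint z (displacement w' (vacuum m)))‖ with hc
  obtain ⟨σ, hσ⟩ : ∃ σ, (1 / 2 : ℝ) • (w + w') = σ := ⟨_, rfl⟩
  obtain ⟨δ, hδ⟩ : ∃ δ, w - w' = δ := ⟨_, rfl⟩
  obtain ⟨η, hη⟩ : ∃ η, (1 / 2 : ℝ) • δ = η := ⟨_, rfl⟩
  have e1 : w = σ + η := by rw [← hη, ← hσ, ← hδ]; module
  have e2 : w' = σ - η := by rw [← hη, ← hσ, ← hδ]; module
  have h3 := hC₁ w w'
  have h4 := hC₂ w w'
  rw [hσ] at h3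
  rw [hδ] at h4
  have hhalf : ‖η‖ ≤ ‖δ‖ := by
    rw [← hη, norm_smul]
    norm_num
    linarith [norm_nonneg δ]
  have b : ∀ x : Phase m, ‖x‖ ≤ ‖σ‖ + ‖η‖ → 1 + ‖x‖ ≤ (1 + ‖σ‖) * (1 + ‖δ‖) := fun x hx => by
    nlinarith [norm_nonneg σ, norm_nonneg δ, mul_nonneg (norm_nonneg σ) (norm_nonneg δ)]
  have b1 := b w (by rw [e1]; exact norm_add_le _ _)
  have b2 := b w' (by rw [e2]; exact norm_sub_le _ _)
  calc (1 + ‖w‖) ^ K * ((1 + ‖w'‖) ^ K * c ^ 2)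
      ≤ ((1 + ‖σ‖) * (1 + ‖δ‖)) ^ K * (((1 + ‖σ‖) * (1 + ‖δ‖)) ^ K * c ^ 2) := by gcongr
    _ = ((1 + ‖σ‖) ^ (2 * K) * c) * ((1 + ‖δ‖) ^ (2 * K) * c) := by
        rw [mul_pow]; ring
    _ ≤ C₁ * C₂ := by gcongr

theorem integrable_inv_one_add_norm_pow (m : ℕ) :
    Integrable fun w : Phase m => ((1 + ‖w‖) ^ (2 * m + 2))⁻¹ := by
  have h := integrable_one_add_norm (E := Phase m) (μ := volume) (r := ((2 * m + 2 : ℕ) : ℝ)) (by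
    rw [finrank_phase]
    push_cast
    linarith)
  refine h.congr (Filter.Eventually.of_forall fun w => ?_)
  simp only
  rw [Real.rpow_neg (by positivity), Real.rpow_natCast]

/-- The squared norm is expanded in coherent states and estimated by the decay of the matrix
elements. The power `4m + 4` is twice the integrable power `2m + 2`, leaving room for the weight
used in `exists_isWeylSum_schwartz`. -/
theorem norm_sq_adjoint_weyl_le {m : ℕ} (φ : SchwartzMap (Phase m) ℝ)
    (hφ : Integrable fun z => (φ z : ℂ)) : ∃ C, 0 ≤ C ∧ ∀ w : Phase m, (1 + ‖w‖) ^ (4 * m + 4) *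
      ‖ContinuousLinearMap.adjoint (weyl hφ) (displacement w (vacuum m))‖ ^ 2 ≤ C := by
  have hπ := Real.pi_pos
  obtain ⟨C, hC0, hC⟩ := norm_sq_coherent_le φ (4 * m + 4)
  have hi := integrable_inv_one_add_norm_pow m
  refine ⟨((2 * Real.pi) ^ m)⁻¹ * (C * ∫ w : Phase m, ((1 + ‖w‖) ^ (2 * m + 2))⁻¹),
    mul_nonneg (by positivity) (mul_nonneg hC0 (integral_nonneg fun w => by positivity)),
    fun w => ?_⟩
  have h1 := integral_norm_sq_inner_displacement
    (ContinuousLinearMap.adjoint (weyl hφ) (displacement w (vacuum m))) (vacuum m)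
  rw [norm_vacuum, one_pow, mul_one] at h1
  rw [eq_comm, ← eq_inv_mul_iff_mul_eq₀ (by positivity)] at h1
  rw [h1, mul_left_comm]
  refine mul_le_mul_of_nonneg_left ?_ (by positivity)
  rw [← integral_const_mul, ← integral_const_mul]
  have hi2 : Integrable fun w' : Phase m => ‖inner ℂ
      (ContinuousLinearMap.adjoint (weyl hφ) (displacement w (vacuum m)))
      (displacement w' (vacuum m))‖ ^ 2 := integrable_norm_sq_inner_displacement _ _
  refine integral_mono (hi2.const_mul _) (hi.const_mul _) fun w' => ?_
  simp only [ContinuousLinearMap.adjoint_inner_left, inner_weyl]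
  have h2 := hC w w'
  rw [mul_left_comm, ← le_div_iff₀' (by positivity)] at h2
  refine h2.trans ?_
  rw [div_eq_mul_inv]
  gcongr
  · linarith [norm_nonneg w']
  · omega
  · norm_num

/-! ### Integrals of rank one operators -/

section Trace

theorem tsum_enorm_sq_inner {κ V : Type*} [NormedAddCommGroup V] [InnerProductSpace ℂ V]
    (b : HilbertBasis κ ℂ V) (x : V) : ∑' i, ‖inner ℂ (b i) x‖ₑ ^ 2 = ‖x‖ₑ ^ 2 := by
  have hy := hasSum_norm_sq_inner b x
  have h := ENNReal.ofReal_tsum_of_nonneg (fun i => by positivity) hy.summable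
  rw [hy.tsum_eq, ENNReal.ofReal_pow (norm_nonneg _), ofReal_norm] at h
  rw [h]
  refine tsum_congr fun i => ?_
  rw [ENNReal.ofReal_pow (norm_nonneg _), ofReal_norm]

theorem enorm_sq_eq_lintegral {α : Type*} [MeasurableSpace α] {μ : Measure α} (f : Lp ℂ 2 μ) :
    ‖f‖ₑ ^ 2 = ∫⁻ q, ‖f q‖ₑ ^ 2 ∂μ := by
  rw [← ofReal_norm, ← ENNReal.ofReal_pow (norm_nonneg _), norm_sq_eq_integral,
    ofReal_integral_eq_lintegral_ofReal (integrable_norm_sq f)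
    (Filter.Eventually.of_forall fun q => by positivity)]
  simp only [ENNReal.ofReal_pow (norm_nonneg _), ofReal_norm]

variable {m : ℕ} {u v : Phase m → H m}

theorem integrable_smul_of_memLp (hu : MemLp u 2) (e : Lp ℂ 2 (volume : Measure (Phase m))) :
    Integrable fun w => e w • u w :=
  ((Lp.memLp e).norm.integrable_mul hu.norm).mono' ((Lp.aestronglyMeasurable e).smul hu.1)
    (Filter.Eventually.of_forall fun w => by rw [norm_smul]; rfl)

theorem inner_integral_smul (hu : MemLp u 2) (e : Lp ℂ 2 (volume : Measure (Phase m))) (f : H m) :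
    inner ℂ f (∫ w, e w • u w) = inner ℂ ((hu.inner_const (𝕜 := ℂ) f).toLp _) e := by
  rw [← integral_inner (integrable_smul_of_memLp hu e), L2.inner_def]
  refine integral_congr_ae ?_
  filter_upwards [(hu.inner_const (𝕜 := ℂ) f).coeFn_toLp] with w hw
  rw [hw, inner_smul_right, RCLike.inner_apply, inner_conj_symm]

/-- The map `e ↦ ∫ e(w) u(w) dw` from `L²` of phase space to `H m` is Hilbert–Schmidt. Its squared
Hilbert–Schmidt norm is `∫ ‖u‖²`, by Parseval in both spaces. -/
theorem summable_norm_sq_integral_smul {κ : Type*}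
    (e : HilbertBasis κ ℂ (Lp ℂ 2 (volume : Measure (Phase m)))) (hu : MemLp u 2) :
    Summable fun k => ‖∫ w, e k w • u w‖ ^ 2 := by
  have h1 : ∑' k, ‖∫ w, e k w • u w‖ₑ ^ 2 = ∫⁻ w, ‖u w‖ₑ ^ 2 := by
    simp only [← tsum_enorm_sq_inner (basis m)]
    rw [ENNReal.tsum_comm, lintegral_tsum fun i =>
      ((hu.const_inner (𝕜 := ℂ) (basis m i)).1.enorm.pow_const 2)]
    refine tsum_congr fun i => ?_
    simp only [inner_integral_smul hu]
    have h2 : ∀ x y : Lp ℂ 2 (volume : Measure (Phase m)), ‖inner ℂ x y‖ₑ = ‖inner ℂ y x‖ₑ :=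
      fun x y => by rw [← inner_conj_symm, enorm_eq_nnnorm, RCLike.nnnorm_conj, enorm_eq_nnnorm]
    simp only [h2 _ (e _)]
    rw [tsum_enorm_sq_inner e, enorm_sq_eq_lintegral]
    refine lintegral_congr_ae ?_
    filter_upwards [(hu.inner_const (𝕜 := ℂ) (basis m i)).coeFn_toLp] with w hw
    rw [hw, ← inner_conj_symm, enorm_eq_nnnorm, RCLike.nnnorm_conj, enorm_eq_nnnorm]
  have h3 : ∑' k, ‖∫ w, e k w • u w‖ₑ ^ 2 ≠ ⊤ := by
    rw [h1]
    have := hu.2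
    rw [eLpNorm_lt_top_iff_lintegral_rpow_enorm_lt_top (by norm_num) (by norm_num)] at this
    simpa using this.ne
  simpa using ENNReal.summable_toReal h3

/-- A weakly integrated family of rank one operators is a sum of such a family. -/
theorem exists_tsum_eq_integral (hu : MemLp u 2) (hv : MemLp v 2) :
    ∃ (ι : Type) (_ : Countable ι) (a b : ι → H m), (Summable fun k => ‖a k‖ ^ 2) ∧
      (Summable fun k => ‖b k‖ ^ 2) ∧ ∀ f g, ∑' k, inner ℂ f (a k) * inner ℂ (b k) g
        = ∫ w, inner ℂ f (u w) * inner ℂ (v w) g := by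
  -- The integral over `w` is the `L²` inner product of the functions `⟨u(w), f⟩` and `⟨v(w), g⟩`;
  -- expanding it in a Hilbert basis turns the integral into a sum.
  obtain ⟨κ, e, -⟩ := exists_hilbertBasis ℂ (Lp ℂ 2 (volume : Measure (Phase m)))
  refine ⟨κ, HilbertBasis.countable_index e, fun k => ∫ w, e k w • u w, fun k => ∫ w, e k w • v w,
    summable_norm_sq_integral_smul e hu, summable_norm_sq_integral_smul e hv, fun f g => ?_⟩
  have h1 : ∀ k, inner ℂ (∫ w, e k w • v w) g = inner ℂ (e k) ((hv.inner_const (𝕜 := ℂ) g).toLp _) :=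
    fun k => by rw [← inner_conj_symm, inner_integral_smul hv, inner_conj_symm]
  simp only [inner_integral_smul hu, h1]
  rw [e.tsum_inner_mul_inner, L2.inner_def]
  refine integral_congr_ae ?_
  filter_upwards [(hu.inner_const (𝕜 := ℂ) f).coeFn_toLp, (hv.inner_const (𝕜 := ℂ) g).coeFn_toLp]
    with w h2 h3
  rw [h2, h3, RCLike.inner_apply, inner_conj_symm, mul_comm]

end Trace

/-- The Weyl quantization of a Schwartz function is trace class. -/
theorem exists_isWeylSum_schwartz {m : ℕ} (φ : SchwartzMap (Phase m) ℝ) :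
    ∃ (ι : Type) (_ : Countable ι) (u v : ι → H m), IsWeylSum (fun z => (φ z : ℂ)) u v := by
  have hπ := Real.pi_pos
  have hφ : Integrable fun z => (φ z : ℂ) := (φ.integrable (μ := volume)).ofReal
  obtain ⟨C, hC0, hC⟩ := norm_sq_adjoint_weyl_le φ hφ
  have hi := integrable_inv_one_add_norm_pow m
  have hcD := continuous_displacement (vacuum m)
  -- The coherent resolution gives `G = (2π)⁻ᵐ ∫ |D(w)Ω⟩⟨G† D(w)Ω| dw`, whose left factor has
  -- constant norm. Moving the weight `g` to the right makes both factors square-integrable: their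
  -- squared norms are bounded by multiples of `(1 + ‖w‖)^(-(2m + 2))`.
  set g : Phase m → ℝ := fun w => (1 + ‖w‖) ^ (m + 1) with hg
  have hg0 : ∀ w, 0 < g w := fun w => by positivity
  have hgc : Continuous g := by fun_prop
  set u : Phase m → H m := fun w => (((g w)⁻¹ : ℝ) : ℂ) • displacement w (vacuum m) with hu
  set v : Phase m → H m := fun w => ((((2 * Real.pi) ^ m)⁻¹ * g w : ℝ) : ℂ) •
    ContinuousLinearMap.adjoint (weyl hφ) (displacement w (vacuum m)) with hv
  have huL : MemLp u 2 := by
    have hc : Continuous u :=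
      (Complex.continuous_ofReal.comp (hgc.inv₀ fun w => (hg0 w).ne')).smul hcD
    rw [memLp_two_iff_integrable_sq_norm hc.aestronglyMeasurable]
    refine hi.congr (Filter.Eventually.of_forall fun w => ?_)
    simp only [hu, norm_smul, norm_displacement, norm_vacuum, mul_one, Complex.norm_real, hg]
    rw [Real.norm_of_nonneg (by positivity), inv_pow, ← pow_mul]
    congr 2
    ring
  have hvL : MemLp v 2 := by
    have hc : Continuous v := (Complex.continuous_ofReal.comp (continuous_const.mul hgc)).smul
      ((ContinuousLinearMap.continuous _).comp hcD)
    rw [memLp_two_iff_integrable_sq_norm hc.aestronglyMeasurable]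
    refine (hi.const_mul ((((2 * Real.pi) ^ m)⁻¹) ^ 2 * C)).mono' (by fun_prop)
      (Filter.Eventually.of_forall fun w => ?_)
    rw [Real.norm_of_nonneg (by positivity)]
    simp only [hv, norm_smul, Complex.norm_real,
      Real.norm_of_nonneg (mul_nonneg (inv_nonneg.2 (pow_nonneg (by positivity : 0 ≤ 2 * Real.pi) m))
        (hg0 w).le)]
    rw [mul_pow, mul_pow, mul_assoc, mul_assoc]
    refine mul_le_mul_of_nonneg_left ?_ (by positivity)
    rw [← div_eq_mul_inv, le_div_iff₀ (by positivity)]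
    refine le_trans (le_of_eq ?_) (hC w)
    simp only [hg]
    ring
  obtain ⟨ι, hι, a, b, ha, hb, hab⟩ := exists_tsum_eq_integral huL hvL
  refine ⟨ι, hι, a, b, hφ, ha, hb, fun f f' => ?_⟩
  rw [hab, ← inner_weyl hφ, inner_eq_integral_coherent,
    ← integral_const_mul]
  refine integral_congr_ae (Filter.Eventually.of_forall fun w => ?_)
  simp only [hu, hv, inner_smul_left, inner_smul_right, ContinuousLinearMap.adjoint_inner_left,
    Complex.conj_ofReal]
  have h1 : (g w : ℂ) ≠ 0 := by exact_mod_cast (hg0 w).ne'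
  push_cast
  field_simp

/-! ### GOCC measurements have non-negative Wigner functions -/

theorem IsWeylSum.wignerDist_eq {m : ℕ} {ι : Type*} {φ : SchwartzMap (Phase m) ℝ} {u v : ι → H m}
    (h : IsWeylSum (fun z => (φ z : ℂ)) u v) (M : H m →L[ℂ] H m) :
    wignerDist M φ = ∑' k, inner ℂ (v k) (M (u k)) :=
  h.tsum_basis (basis m) M

theorem StrongWignerNonneg.wignerNonneg {m : ℕ} {M : H m →L[ℂ] H m} (h : StrongWignerNonneg M) :
    WignerNonneg M := by
  intro φ hφ
  obtain ⟨ι, _, u, v, huv⟩ := exists_isWeylSum_schwartz φ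
  rw [huv.wignerDist_eq]
  exact h ι φ u v hφ huv

/-- Positivity of the operator and of its Wigner function are preserved by bounded strong limits. -/
theorem strongWignerNonneg_of_mem_closure {m : ℕ} {M : H m →L[ℂ] H m}
    (hM : (M : H m → H m) ∈ closure {F : H m → H m | ∃ M' : H m →L[ℂ] H m,
      M'.IsPositive ∧ ‖M'‖ ≤ 1 ∧ StrongWignerNonneg M' ∧ F = M'}) :
    M.IsPositive ∧ StrongWignerNonneg M := by
  set S := {F : H m → H m | ∃ M' : H m →L[ℂ] H m,
      M'.IsPositive ∧ ‖M'‖ ≤ 1 ∧ StrongWignerNonneg M' ∧ F = M'} with hS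
  have hne : (nhdsWithin (M : H m → H m) S).NeBot := mem_closure_iff_nhdsWithin_neBot.1 hM
  have hev : ∀ᶠ F in nhdsWithin (M : H m → H m) S, F ∈ S := self_mem_nhdsWithin
  have hlim : ∀ x, Filter.Tendsto (fun F : H m → H m => F x) (nhdsWithin (M : H m → H m) S)
      (nhds (M x)) := fun x => ((continuous_apply x).tendsto _).mono_left nhdsWithin_le_nhds
  constructor
  · refine isPositive_of_inner_eq_ofReal fun x => ?_
    have h1 : Filter.Tendsto (fun F : H m → H m => inner ℂ x (F x))
        (nhdsWithin (M : H m → H m) S) (nhds (inner ℂ x (M x))) :=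
      (continuous_const.inner continuous_id).tendsto _ |>.comp (hlim x)
    have hre := (Complex.continuous_re.tendsto _).comp h1
    have him := (Complex.continuous_im.tendsto _).comp h1
    refine ⟨(inner ℂ x (M x)).re, ge_of_tendsto hre ?_, Complex.ext rfl ?_⟩
    · filter_upwards [hev] with F hF
      obtain ⟨M', h, -, -, rfl⟩ := hF
      exact (inner_eq_ofReal_re h x).1
    · refine tendsto_nhds_unique him (tendsto_const_nhds.congr' ?_)
      filter_upwards [hev] with F hF
      obtain ⟨M', h, -, -, rfl⟩ := hF
      have := congrArg Complex.im (inner_eq_ofReal_re h x).2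
      simpa using this.symm
  · intro ι _ φ u v hφ h
    have h1 : Filter.Tendsto (fun F : H m → H m => ∑' k, inner ℂ (v k) (F (u k)))
        (nhdsWithin (M : H m → H m) S) (nhds (∑' k, inner ℂ (v k) (M (u k)))) := by
      -- The bound `‖M'‖ ≤ 1` supplies a majorant independent of the approximant. Dominated
      -- convergence of series holds along any filter, so nets need not be replaced by sequences.
      refine tendsto_tsum_of_dominated_convergence
        (summable_norm_mul_norm h.summable_right h.summable_left) (fun k => ?_) ?_
      · exact (continuous_const.inner continuous_id).tendsto _ |>.comp (hlim (u k))
      · filter_upwards [hev] with F hF k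
        obtain ⟨M', -, h2, -, rfl⟩ := hF
        exact norm_inner_apply_le h2 _ _
    refine ge_of_tendsto ((Complex.continuous_re.tendsto _).comp h1) ?_
    filter_upwards [hev] with F hF
    obtain ⟨M', -, -, h2, rfl⟩ := hF
    exact h2 ι φ u v hφ h

theorem gocc_subset_wPlus (m : ℕ) : gocc m ⊆ wPlus m := by
  intro M hM
  have h1 := strongWignerNonneg_of_mem_closure (M := M) (closure_mono (by
    rintro F ⟨R, M', h, rfl⟩
    have h' := h.isWignerEffect
    exact ⟨M', h'.pos, norm_le_one_of_isPositive h'.pos h'.pos_compl, h'.wigner, rfl⟩) hM)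
  have h2 : ((1 - M : H m →L[ℂ] H m) : H m → H m) ∈ closure {F : H m → H m |
      ∃ M' : H m →L[ℂ] H m, M'.IsPositive ∧ ‖M'‖ ≤ 1 ∧ StrongWignerNonneg M' ∧ F = M'} := by
    have hc : Continuous fun F : H m → H m => fun x => x - F x := by fun_prop
    refine map_mem_closure (f := fun F : H m → H m => fun x => x - F x) hc hM ?_
    rintro F ⟨R, M', h, rfl⟩
    have h' := h.isWignerEffect.compl
    exact ⟨1 - M', h'.pos, norm_le_one_of_isPositive h'.pos h'.pos_compl, h'.wigner, rfl⟩
  have h3 := strongWignerNonneg_of_mem_closure h2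
  exact ⟨h1.1, h3.1, h1.2.wignerNonneg, h3.2.wignerNonneg⟩

theorem exists_isGaussianUnitary {a b : ℕ} (hab : a = b) :
    ∃ U : H a ≃ₗᵢ[ℂ] H b, IsGaussianUnitary U := by
  subst hab
  exact ⟨LinearIsometryEquiv.refl ℂ _, LinearEquiv.refl ℝ _, 0, fun z w => rfl, fun z ψ => by simp⟩

/-- One round that adds nothing, measures all `m` modes and always rejects. It makes the sets of
measurements non-empty, as the comparisons of infima of reals require. -/
theorem isProtocolEffect_zero (m : ℕ) : IsProtocolEffect 1 m 0 := by
  have hmodes : m + 0 = 0 + m := by omega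
  obtain ⟨U, hU⟩ := exists_isGaussianUnitary hmodes
  exact IsProtocolEffect.round hmodes U hU (fun _ => 0) (fun _ => IsProtocolEffect.reject)
    (fun f f' => by simp) 0 (fun f f' g g' => by simp) 0 (fun φ ψ => by simp)

theorem gocc_nonempty (m : ℕ) : (gocc m).Nonempty :=
  ⟨0, subset_closure ⟨1, 0, isProtocolEffect_zero m, rfl⟩⟩

/-! ### Duality between trace class and bounded Weyl symbols -/

/-- The diagonal of a trace class operator has partial absolute sums bounded independently of the
basis and of the finite set. After displacement the same bound holds uniformly in the phase space
point. -/
theorem sum_norm_tsum_inner_mul_inner_le {V ι κ : Type*} [NormedAddCommGroup V]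
    [InnerProductSpace ℂ V] (b : HilbertBasis κ ℂ V) {u v : ι → V}
    (hu : Summable fun k => ‖u k‖ ^ 2) (hv : Summable fun k => ‖v k‖ ^ 2) (s : Finset κ) :
    ∑ i ∈ s, ‖∑' k, inner ℂ (b i) (u k) * inner ℂ (v k) (b i)‖
      ≤ ∑' k, (‖u k‖ ^ 2 + ‖v k‖ ^ 2) / 2 := by
  have hs : ∀ i, Summable fun k => (‖inner ℂ (b i) (u k)‖ ^ 2 + ‖inner ℂ (v k) (b i)‖ ^ 2) / 2 :=
    fun i => by
      simp only [norm_inner_symm (v _)]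
      exact ((summable_norm_sq_map hu (innerSL ℂ (b i))).add
        (summable_norm_sq_map hv (innerSL ℂ (b i)))).div_const 2
  have hb : ∀ x : V, ∑ i ∈ s, ‖inner ℂ (b i) x‖ ^ 2 ≤ ‖x‖ ^ 2 := fun x =>
    sum_le_hasSum s (fun i _ => by positivity) (hasSum_norm_sq_inner b x)
  calc _ ≤ ∑ i ∈ s, ∑' k, (‖inner ℂ (b i) (u k)‖ ^ 2 + ‖inner ℂ (v k) (b i)‖ ^ 2) / 2 := by
        refine Finset.sum_le_sum fun i _ => tsum_of_norm_bounded (hs i).hasSum fun k => ?_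
        rw [norm_mul]
        exact mul_le_half_add_sq _ _
    _ = ∑' k, ∑ i ∈ s, (‖inner ℂ (b i) (u k)‖ ^ 2 + ‖inner ℂ (v k) (b i)‖ ^ 2) / 2 :=
        (Summable.tsum_finsetSum fun i _ => hs i).symm
    _ ≤ _ := by
        refine Summable.tsum_le_tsum (fun k => ?_) (summable_sum fun i _ => hs i)
          ((hu.add hv).div_const 2)
        rw [← Finset.sum_div, Finset.sum_add_distrib]
        simp only [norm_inner_symm (v k)]
        gcongr <;> exact hb _

/-- A bound on the partial sums uniform in `w` replaces a summable majorant of the individual terms,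
which is not available for basis expansions of displaced operators. -/
theorem integral_mul_tsum {α κ : Type*} [MeasurableSpace α] {μ : Measure α} [Countable κ]
    {F : α → ℂ} (hF : Integrable F μ) {γ : κ → α → ℂ} (hγ : ∀ i, AEStronglyMeasurable (γ i) μ)
    {C : ℝ} (hC : ∀ w (s : Finset κ), ∑ i ∈ s, ‖γ i w‖ ≤ C) :
    ∫ w, F w * ∑' i, γ i w ∂μ = ∑' i, ∫ w, F w * γ i w ∂μ := by
  have hi : ∀ i, Integrable (fun w => F w * γ i w) μ := fun i =>
    hF.mul_bdd (c := C) (hγ i) (Filter.Eventually.of_forall fun w => by simpa using hC w {i})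
  simp only [← tsum_mul_left]
  refine (integral_tsum_of_summable_integral_norm hi ?_).symm
  refine summable_of_sum_le (c := ∫ w, ‖F w‖ * C ∂μ)
    (fun i => integral_nonneg fun w => norm_nonneg _) fun s => ?_
  rw [← integral_finsetSum s fun i _ => (hi i).norm]
  refine integral_mono (integrable_finsetSum s fun i _ => (hi i).norm) (hF.norm.mul_const C)
    fun w => ?_
  simp only [norm_mul, ← Finset.mul_sum]
  exact mul_le_mul_of_nonneg_left (hC w s) (norm_nonneg _)

theorem integral_norm_moyal_phasePoint_le {m : ℕ} (a b c d : H m) :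
    ∫ z : Phase m, ‖inner ℂ a (phasePoint z b) * inner ℂ (phasePoint z d) c‖
      ≤ (Real.pi ^ m)⁻¹ * (Real.pi ^ m)⁻¹ * (|((2 : ℝ) ^ (Module.finrank ℝ (Phase m)))⁻¹| *
        (2 * Real.pi) ^ m) * (‖a‖ * ‖b‖ * (‖c‖ * ‖d‖)) := by
  have hπ := Real.pi_pos
  -- The substitution `w = 2z` reduces to displacements. The constant is left unevaluated, since
  -- only its independence of the vectors matters.
  have e : ∀ z : Phase m, ‖inner ℂ a (phasePoint z b) * inner ℂ (phasePoint z d) c‖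
      = ((Real.pi ^ m)⁻¹ * (Real.pi ^ m)⁻¹) * (fun w => ‖inner ℂ a (displacement w (parity m b))‖ *
        ‖inner ℂ (displacement w (parity m d)) c‖) ((2 : ℝ) • z) := fun z => by
    simp only [phasePoint_apply, inner_smul_left, inner_smul_right, Complex.conj_ofReal, norm_mul,
      Complex.norm_real]
    rw [Real.norm_of_nonneg (by positivity)]
    ring
  simp only [e]
  rw [integral_const_mul, Measure.integral_comp_smul volume (fun w : Phase m =>
    ‖inner ℂ a (displacement w (parity m b))‖ * ‖inner ℂ (displacement w (parity m d)) c‖),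
    smul_eq_mul, mul_assoc ((Real.pi ^ m)⁻¹ * (Real.pi ^ m)⁻¹), mul_assoc |_|]
  have h := integral_norm_moyal_le a (parity m b) c (parity m d)
  rw [norm_parity, norm_parity] at h
  gcongr

section Duality

variable {m : ℕ} {ι J : Type*} {g : Phase m → ℂ} {u v : ι → H m}
  {e f : J → H m}

theorem continuous_tsum_displacement (he : Summable fun j => ‖e j‖ ^ 2)
    (hf : Summable fun j => ‖f j‖ ^ 2) (a c : H m) (B : H m →L[ℂ] H m) :
    Continuous fun z : Phase m => ∑' j, inner ℂ a (B (displacement z (e j)))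
      * inner ℂ (displacement z (f j)) c := by
  refine continuous_tsum (fun j => ?_)
    ((summable_norm_mul_norm he hf).mul_left (‖a‖ * ‖B‖ * ‖c‖)) fun j z => ?_
  · exact (continuous_const.inner (B.continuous.comp (continuous_displacement _))).mul
      ((continuous_displacement _).inner continuous_const)
  · rw [norm_mul]
    calc _ ≤ (‖a‖ * (‖B‖ * ‖e j‖)) * (‖f j‖ * ‖c‖) := by
          gcongr
          · refine (norm_inner_le_norm _ _).trans ?_
            gcongr
            refine (B.le_opNorm _).trans ?_
            rw [norm_displacement]
          · refine (norm_inner_le_norm _ _).trans ?_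
            rw [norm_displacement]
      _ = _ := by ring

theorem sum_norm_tsum_displacement_le {κ : Type*} (b : HilbertBasis κ ℂ (H m))
    (he : Summable fun j => ‖e j‖ ^ 2) (hf : Summable fun j => ‖f j‖ ^ 2) (B : H m →L[ℂ] H m)
    (z : Phase m) (s : Finset κ) :
    ∑ i ∈ s, ‖∑' j, inner ℂ (b i) (B (displacement z (e j)))
        * inner ℂ (displacement z (f j)) (b i)‖ ≤ ∑' j, ((‖B‖ * ‖e j‖) ^ 2 + ‖f j‖ ^ 2) / 2 := by
  have he' : Summable fun j => ‖displacement z (e j)‖ ^ 2 := by simpa using he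
  have hf' : Summable fun j => ‖displacement z (f j)‖ ^ 2 := by simpa using hf
  have hB : Summable fun j => (‖B‖ * ‖e j‖) ^ 2 := by simpa [mul_pow] using he.mul_left (‖B‖ ^ 2)
  refine (sum_norm_tsum_inner_mul_inner_le b (summable_norm_sq_map he' B) hf' s).trans ?_
  refine Summable.tsum_le_tsum (fun j => ?_) (((summable_norm_sq_map he' B).add hf').div_const 2)
    ((hB.add hf).div_const 2)
  rw [norm_displacement]
  gcongr
  exact (B.le_opNorm _).trans (by rw [norm_displacement])

/-- For `X = ∑ |e j⟩⟨f j|` with Wigner function `W`, the inversion formula `∫ W(w) A_w dw = (2π)⁻ᵐ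
X`, displaced by `z` and written in matrix elements. -/
theorem integral_tsum_phasePoint_mul [Countable J] (he : Summable fun j => ‖e j‖ ^ 2)
    (hf : Summable fun j => ‖f j‖ ^ 2) (a c : H m) (z : Phase m) :
    ∫ w, (∑' j, inner ℂ (f j) (phasePoint w (e j))) * inner ℂ c (phasePoint (z + w) a)
      = (((2 * Real.pi) ^ m)⁻¹ : ℂ) *
        ∑' j, inner ℂ c (displacement z (e j)) * inner ℂ (displacement z (f j)) a := by
  have h1 : ∀ w, inner ℂ c (phasePoint (z + w) a)
      = inner ℂ (phasePoint w (displacement (-z) c)) (displacement (-z) a) := fun w => by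
    rw [inner_phasePoint_left, inner_displacement_phasePoint, sub_neg_eq_add, add_comm]
  simp only [h1, ← tsum_mul_right]
  rw [← integral_tsum_of_summable_integral_norm (fun j => integrable_moyal_phasePoint _ _ _ _)]
  · simp only [integral_moyal_phasePoint, tsum_mul_left]
    congr 1
    refine tsum_congr fun j => ?_
    rw [inner_displacement_left, inner_displacement_right, neg_neg, mul_comm]
  · refine Summable.of_nonneg_of_le (fun j => integral_nonneg fun w => norm_nonneg _)
      (fun j => integral_norm_moyal_phasePoint_le _ _ _ _) ?_
    exact ((summable_norm_mul_norm hf he).mul_right _).mul_left _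

/-- With `X = ∑ |e j⟩⟨f j|`, Wigner function `W`, and `G = ∑ |u k⟩⟨v k|`, both sides are the trace
of `B` against `∫∫ W(w) g(z) A_{z+w} dw dz`. Integrating over `z` first displaces `G` by `w`;
integrating over `w` first displaces `X` by `z`. The trace is taken in a basis so that every
exchange happens between scalar integrals. -/
theorem IsWeylSum.integral_duality [Countable J] (h : IsWeylSum g u v) (he : Summable fun j => ‖e j‖ ^ 2)
    (hf : Summable fun j => ‖f j‖ ^ 2)
    (hF : Integrable fun w : Phase m => ∑' j, inner ℂ (f j) (phasePoint w (e j)))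
    (B : H m →L[ℂ] H m) :
    ∫ w, (∑' j, inner ℂ (f j) (phasePoint w (e j))) *
        ∑' k, inner ℂ (displacement w (v k)) (B (displacement w (u k)))
      = (((2 * Real.pi) ^ m)⁻¹ : ℂ) *
        ∫ z, g z * ∑' j, inner ℂ (displacement z (f j)) (B (displacement z (e j))) := by
  set F := fun w : Phase m => ∑' j, inner ℂ (f j) (phasePoint w (e j)) with hFdef
  set γ : basisIndex m → Phase m → ℂ := fun i w =>
    ∫ z, g z * inner ℂ (basis m i) (B (phasePoint (z + w) (basis m i))) with hγ
  have h1 : ∀ w i, γ i w = ∫ z, g (z - w) * inner ℂ (basis m i) (B (phasePoint z (basis m i))) :=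
    fun w i => by
      simp only [hγ]
      rw [← integral_sub_right_eq_self _ w]
      simp
  have h2 : ∀ w, ∑' k, inner ℂ (displacement w (v k)) (B (displacement w (u k))) = ∑' i, γ i w :=
    fun w => by
      simp only [h1]
      exact ((h.comp_sub w).tsum_basis (basis m) B).symm
  have hprod : ∀ i, AEStronglyMeasurable (fun p : Phase m × Phase m => g p.2 *
      inner ℂ (basis m i) (B (phasePoint (p.2 + p.1) (basis m i)))) (volume.prod volume) := fun i =>
    h.integrable.1.comp_snd.mul (continuous_const.inner (B.continuous.comp
      ((continuous_phasePoint _).comp (continuous_snd.add continuous_fst)))).aestronglyMeasurable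
  have h3 : ∫ w, F w * ∑' i, γ i w = ∑' i, ∫ w, F w * γ i w := by
    refine integral_mul_tsum hF (fun i => (hprod i).integral_prod_right')
      (C := ∑' k, ((‖B‖ * ‖u k‖) ^ 2 + ‖v k‖ ^ 2) / 2) fun w s => ?_
    refine le_of_eq_of_le (Finset.sum_congr rfl fun i _ => ?_)
      (sum_norm_tsum_displacement_le (basis m) h.summable_left h.summable_right B w s)
    have h6 := (h.comp_sub w).tsum_eq (ContinuousLinearMap.adjoint B (basis m i)) (basis m i)
    simp only [ContinuousLinearMap.adjoint_inner_left] at h6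
    rw [h1, h6]
  -- For each basis vector, Fubini applies because `W(w) g(z)` is jointly integrable and the matrix
  -- elements of `A_{z+w}` are bounded.
  have h4 : ∀ i, ∫ w, F w * γ i w = ∫ z, ((((2 * Real.pi) ^ m)⁻¹ : ℂ) * g z) *
      ∑' j, inner ℂ (basis m i) (B (displacement z (e j)))
        * inner ℂ (displacement z (f j)) (basis m i) := fun i => by
    have h5 : ∀ z, ∫ w, F w * inner ℂ (basis m i) (B (phasePoint (z + w) (basis m i)))
        = (((2 * Real.pi) ^ m)⁻¹ : ℂ) * ∑' j, inner ℂ (basis m i) (B (displacement z (e j)))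
        * inner ℂ (displacement z (f j)) (basis m i) := fun z => by
      simp only [← ContinuousLinearMap.adjoint_inner_left B]
      exact integral_tsum_phasePoint_mul he hf _ _ z
    simp only [hγ, ← integral_const_mul]
    rw [integral_integral_swap]
    · refine integral_congr_ae (Filter.Eventually.of_forall fun z => ?_)
      simp only [mul_left_comm (F _)]
      rw [integral_const_mul, h5]
      ring
    · have h6 : Integrable (fun p : Phase m × Phase m => F p.1 * g p.2 *
          inner ℂ (basis m i) (B (phasePoint (p.2 + p.1) (basis m i)))) (volume.prod volume) := by
        refine (hF.mul_prod h.integrable).mul_bdd (c := ‖basis m i‖ * (‖B‖ * ((Real.pi ^ m)⁻¹ *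
          ‖basis m i‖))) (continuous_const.inner (B.continuous.comp
          ((continuous_phasePoint _).comp (continuous_snd.add continuous_fst)))).aestronglyMeasurable
          (Filter.Eventually.of_forall fun p => (norm_inner_le_norm _ _).trans ?_)
        gcongr
        exact (B.le_opNorm _).trans (by rw [norm_phasePoint])
      simpa only [Function.uncurry_def, mul_assoc] using h6
  simp only [h2]
  rw [h3]
  simp only [h4]
  rw [← integral_mul_tsum (h.integrable.const_mul _)
    (fun i => (continuous_tsum_displacement he hf _ _ B).aestronglyMeasurable)
    (C := ∑' j, ((‖B‖ * ‖e j‖) ^ 2 + ‖f j‖ ^ 2) / 2) fun w s =>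
      sum_norm_tsum_displacement_le (basis m) he hf B w s]
  · rw [← integral_const_mul]
    refine integral_congr_ae (Filter.Eventually.of_forall fun z => ?_)
    simp only
    rw [tsum_tsum_inner_mul_inner (basis m), mul_assoc]
    · exact summable_norm_sq_map (by simpa using he) B
    · simpa using hf

end Duality

/-! ### States -/

theorem exists_sqrt_of_isPositive {V : Type*} [NormedAddCommGroup V] [InnerProductSpace ℂ V]
    [CompleteSpace V] {X : V →L[ℂ] V} (h : X.IsPositive) : ∃ S : V →L[ℂ] V,
      (∀ f g, inner ℂ (S f) g = inner ℂ f (S g)) ∧ ∀ g, S (S g) = X g := by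
  have h0 : 0 ≤ X := (ContinuousLinearMap.nonneg_iff_isPositive X).2 h
  refine ⟨CFC.sqrt X, fun f g => ?_, fun g => ?_⟩
  · exact ((ContinuousLinearMap.nonneg_iff_isPositive _).1 (CFC.sqrt_nonneg X)).isSymmetric f g
  · exact congrArg (fun Y : V →L[ℂ] V => Y g) (CFC.sqrt_mul_sqrt_self X)

/-- The spectral decomposition of a state, in the form `ρ = ∑ j, |e j⟩⟨e j|`. -/
theorem IsState.exists_decomposition {m : ℕ} {ρ : H m →L[ℂ] H m} (h : IsState ρ) :
    ∃ e : basisIndex m → H m, HasSum (fun j => ‖e j‖ ^ 2) 1 ∧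
      ∀ X : H m →L[ℂ] H m, trace (ρ.comp X) = ∑' j, inner ℂ (e j) (X (e j)) := by
  obtain ⟨S, hSs, hS⟩ := exists_sqrt_of_isPositive h.pos
  have hS2 : ∀ f g : H m, inner ℂ f (ρ g) = inner ℂ (S f) (S g) := fun f g => by rw [hSs, hS]
  have hsum : HasSum (fun j => ‖S (basis m j)‖ ^ 2) 1 := by
    have h1 := h.hasSum_one
    simp only [hS2, inner_self_eq_norm_sq_to_K] at h1
    have h2 : HasSum (fun j => ((‖S (basis m j)‖ ^ 2 : ℝ) : ℂ)) ((1 : ℝ) : ℂ) := by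
      simpa using h1
    exact Complex.hasSum_ofReal.1 h2
  -- With `S = √ρ` one has `ρ = ∑ |S b_j⟩⟨S b_j|` for any basis, so no diagonalization of `ρ` is
  -- needed.
  refine ⟨fun j => S (basis m j), hsum, fun X => ?_⟩
  have h3 : ∀ f g : H m, inner ℂ f (ρ g)
      = ∑' j, inner ℂ f (S (basis m j)) * inner ℂ (S (basis m j)) g := fun f g => by
    rw [hS2, ← (basis m).tsum_inner_mul_inner]
    simp only [hSs]
  have h4 := tsum_tsum_inner_mul_inner (basis m) hsum.summable
    (summable_norm_sq_map hsum.summable (ContinuousLinearMap.adjoint X))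
  simp only [ContinuousLinearMap.adjoint_inner_left] at h4
  rw [← h4, trace]
  exact tsum_congr fun i => h3 _ _

/-! ### Mollifiers -/

/-- A positive mollifier on phase space with values in the Schwartz functions. -/
theorem exists_schwartz_mollifier {m : ℕ} {s : Set (Phase m)} (hs : s ∈ nhds (0 : Phase m)) :
    ∃ g : SchwartzMap (Phase m) ℝ, (∀ z, 0 ≤ g z) ∧ (∀ z, z ∉ s → g z = 0) ∧ ∫ z, g z = 1 := by
  obtain ⟨r, hr, hrs⟩ := Metric.mem_nhds_iff.1 hs
  let f : ContDiffBump (0 : Phase m) := ⟨r / 2, r, by positivity, by linarith⟩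
  refine ⟨(f.hasCompactSupport_normed (μ := volume)).toSchwartzMap f.contDiff_normed,
    fun z => f.nonneg_normed z, fun z hz => ?_, f.integral_normed⟩
  have : z ∉ Function.support (f.normed volume) := by
    rw [f.support_normed_eq]
    exact fun h => hz (hrs h)
  simpa using this

/-! ### Measurements with non-negative Wigner functions -/

theorem errorProb_nonneg {m : ℕ} {ρ₀ ρ₁ M : H m →L[ℂ] H m} (h₀ : IsState ρ₀) (h₁ : IsState ρ₁)
    (hM : M ∈ wPlus m) : 0 ≤ errorProb ρ₀ ρ₁ M := by
  have key : ∀ {ρ X : H m →L[ℂ] H m}, IsState ρ → X.IsPositive → 0 ≤ (trace (ρ.comp X)).re := by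
    intro ρ X hρ hX
    obtain ⟨e, -, he⟩ := hρ.exists_decomposition
    rw [he, tsum_congr fun j => (inner_eq_ofReal_re hX (e j)).2, ← Complex.ofReal_tsum,
      Complex.ofReal_re]
    exact tsum_nonneg fun j => (inner_eq_ofReal_re hX (e j)).1
  have h1 := key h₀ hM.2.1
  have h2 := key h₁ hM.1
  unfold errorProb
  linarith

/-- The smoothed Wigner function of a W+ measurement is bounded by `(2π)⁻ᵐ`. -/
theorem abs_re_tsum_inner_displacement_le {m : ℕ} {M : H m →L[ℂ] H m} (hM : M ∈ wPlus m)
    {ι : Type*} [Countable ι] {g : SchwartzMap (Phase m) ℝ} (hg : ∀ z, 0 ≤ g z)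
    (hg1 : ∫ z, g z = 1) {u v : ι → H m} (h : IsWeylSum (fun z => (g z : ℂ)) u v) (w : Phase m) :
    |(∑' k, inner ℂ (displacement w (v k)) (((2 : ℂ) • M - 1) (displacement w (u k)))).re|
      ≤ ((2 * Real.pi) ^ m)⁻¹ := by
  have h' : IsWeylSum (fun z => ((g.compSubConstCLM ℝ w z : ℝ) : ℂ))
    (fun k => displacement w (u k)) (fun k => displacement w (v k)) := h.comp_sub w
  have h1 := hM.2.2.1 (g.compSubConstCLM ℝ w) fun z => hg _
  have h2 := hM.2.2.2 (g.compSubConstCLM ℝ w) fun z => hg _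
  rw [h'.wignerDist_eq] at h1 h2
  have h3 : (∑' k, inner ℂ (displacement w (v k)) (displacement w (u k))).re
      = ((2 * Real.pi) ^ m)⁻¹ := by
    have := h.tsum_inner
    rw [integral_complex_ofReal, hg1] at this
    simp only [inner_displacement_displacement, this]
    rw [Complex.ofReal_one, mul_one, ← Complex.ofReal_re (((2 * Real.pi) ^ m)⁻¹)]
    push_cast
    rfl
  have hs : ∀ X : H m →L[ℂ] H m, Summable fun k =>
      inner ℂ (displacement w (v k)) (X (displacement w (u k))) := fun X =>
    summable_inner (summable_norm_sq_map h'.summable_left X) h'.summable_right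
  have hs1 : Summable fun k => inner ℂ (displacement w (v k)) (displacement w (u k)) := hs 1
  have h4 : (∑' k, inner ℂ (displacement w (v k)) ((1 - M) (displacement w (u k)))).re
      = ((2 * Real.pi) ^ m)⁻¹
        - (∑' k, inner ℂ (displacement w (v k)) (M (displacement w (u k)))).re := by
    simp only [sub_apply, one_apply_eq_self, inner_sub_right]
    rw [hs1.tsum_sub (hs M), Complex.sub_re, h3]
  -- If `t` is the smoothed value for `M`, the two W+ conditions give `0 ≤ t ≤ (2π)⁻ᵐ`, and the
  -- value for `2M - 1` is `2t - (2π)⁻ᵐ`.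
  have h5 : (∑' k, inner ℂ (displacement w (v k)) (((2 : ℂ) • M - 1) (displacement w (u k)))).re
      = 2 * (∑' k, inner ℂ (displacement w (v k)) (M (displacement w (u k)))).re
        - ((2 * Real.pi) ^ m)⁻¹ := by
    simp only [sub_apply, one_apply_eq_self, inner_sub_right, smul_apply, inner_smul_right]
    rw [((hs M).mul_left 2).tsum_sub hs1, Complex.sub_re, tsum_mul_left, h3]
    simp
  rw [h5, abs_le]
  constructor <;> linarith

theorem norm_inner_displacement_apply_le {m : ℕ} (a c : H m) (B : H m →L[ℂ] H m) (z : Phase m) :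
    ‖inner ℂ (displacement z a) (B (displacement z c))‖ ≤ ‖B‖ * (‖a‖ * ‖c‖) := by
  calc _ ≤ ‖displacement z a‖ * (‖B‖ * ‖displacement z c‖) := by
        refine (norm_inner_le_norm _ _).trans ?_
        gcongr
        exact B.le_opNorm _
    _ = _ := by rw [norm_displacement, norm_displacement]; ring

theorem continuous_tsum_inner_displacement {m : ℕ} {J : Type*} {e f : J → H m}
    (he : Summable fun j => ‖e j‖ ^ 2) (hf : Summable fun j => ‖f j‖ ^ 2) (B : H m →L[ℂ] H m) :
    Continuous fun z : Phase m =>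
      ∑' j, inner ℂ (displacement z (f j)) (B (displacement z (e j))) :=
  continuous_tsum (fun _ => (continuous_displacement _).inner
    (B.continuous.comp (continuous_displacement _)))
    ((summable_norm_mul_norm hf he).mul_left ‖B‖)
    fun _ z => norm_inner_displacement_apply_le _ _ B z

/-- By duality, the `g`-average of `τ` is `(2π)ᵐ` times the integral of `W` against a smoothed
symbol bounded by `(2π)⁻ᵐ`, so its real part is at most `∫ |W|`. If `Re τ(0)` exceeded this,
continuity of `τ` would let a mollifier concentrated near `0` violate the bound. -/
theorem re_tsum_le_integral_norm {m : ℕ} {J : Type*} [Countable J] {e f : J → H m}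
    (he : Summable fun j => ‖e j‖ ^ 2) (hf : Summable fun j => ‖f j‖ ^ 2) {W : Phase m → ℝ}
    (hW : Integrable W) (hWe : ∀ w, ∑' j, inner ℂ (f j) (phasePoint w (e j)) = (W w : ℂ))
    {M : H m →L[ℂ] H m} (hM : M ∈ wPlus m) :
    (∑' j, inner ℂ (f j) (((2 : ℂ) • M - 1) (e j))).re ≤ ∫ w, |W w| := by
  have hπ := Real.pi_pos
  set B := (2 : ℂ) • M - 1 with hB
  set τ : Phase m → ℂ := fun z =>
    ∑' j, inner ℂ (displacement z (f j)) (B (displacement z (e j))) with hτ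
  have hτc : Continuous τ := continuous_tsum_inner_displacement he hf B
  have hτ0 : τ 0 = ∑' j, inner ℂ (f j) (B (e j)) := by simp only [hτ, displacement_zero]
  have hτb : ∀ z, ‖τ z‖ ≤ ∑' j, ‖B‖ * (‖f j‖ * ‖e j‖) := fun z =>
    tsum_of_norm_bounded ((summable_norm_mul_norm hf he).mul_left ‖B‖).hasSum
      fun j => norm_inner_displacement_apply_le _ _ B z
  rw [← hτ0]
  by_contra! hlt
  set I := ∫ w, |W w| with hI
  obtain ⟨t, ht1, ht2⟩ := exists_between hlt
  have hs : {z | t < (τ z).re} ∈ nhds (0 : Phase m) :=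
    (isOpen_lt continuous_const (Complex.continuous_re.comp hτc)).mem_nhds ht2
  obtain ⟨g, hg0, hgs, hg1⟩ := exists_schwartz_mollifier hs
  obtain ⟨ι, _, u, v, h⟩ := exists_isWeylSum_schwartz g
  have hgi : Integrable fun z => g z := g.integrable
  have hWc : Integrable fun w => (W w : ℂ) := hW.ofReal
  have hd := h.integral_duality he hf (by simpa only [hWe] using hWc) B
  simp only [hWe] at hd
  have h1 : t ≤ (∫ z, (g z : ℂ) * τ z).re := by
    have hi : Integrable fun z => (g z : ℂ) * τ z :=
      hgi.ofReal.mul_bdd hτc.aestronglyMeasurable (Filter.Eventually.of_forall hτb)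
    have h2 := integral_re (𝕜 := ℂ) hi
    rw [← RCLike.re_eq_complex_re, ← h2]
    calc t = ∫ z, g z * t := by rw [integral_mul_const, hg1, one_mul]
      _ ≤ ∫ z, RCLike.re ((g z : ℂ) * τ z) := by
        refine integral_mono (hgi.mul_const t) hi.re fun z => ?_
        simp only [RCLike.re_eq_complex_re, Complex.re_ofReal_mul]
        by_cases hz : t < (τ z).re
        · exact mul_le_mul_of_nonneg_left hz.le (hg0 z)
        · simp [hgs z hz]
  have h2 : (∫ w, (W w : ℂ) *
      ∑' k, inner ℂ (displacement w (v k)) (B (displacement w (u k)))).re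
      ≤ ((2 * Real.pi) ^ m)⁻¹ * I := by
    -- If the product is not integrable its integral is `0` by convention, and the bound holds
    -- trivially.
    by_cases hi : Integrable fun w => (W w : ℂ) *
      ∑' k, inner ℂ (displacement w (v k)) (B (displacement w (u k)))
    · have h3 := integral_re (𝕜 := ℂ) hi
      rw [← RCLike.re_eq_complex_re, ← h3, hI, ← integral_const_mul]
      refine integral_mono hi.re (hW.abs.const_mul _) fun w => ?_
      simp only [RCLike.re_eq_complex_re, Complex.re_ofReal_mul]
      have h4 := abs_re_tsum_inner_displacement_le hM hg0 hg1 h w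
      refine (le_abs_self _).trans ?_
      rw [abs_mul, mul_comm]
      exact mul_le_mul_of_nonneg_right h4 (abs_nonneg _)
    · rw [integral_undef hi, Complex.zero_re]
      exact mul_nonneg (by positivity) (integral_nonneg fun w => abs_nonneg _)
  have h3 : (((2 * Real.pi) ^ m)⁻¹ : ℂ) = ((((2 * Real.pi) ^ m)⁻¹ : ℝ) : ℂ) := by push_cast; rfl
  rw [hd, h3, Complex.re_ofReal_mul] at h2
  have h4 := le_of_mul_le_mul_left h2 (by positivity)
  linarith

theorem IsState.trace_eq_one {m : ℕ} {ρ : H m →L[ℂ] H m} (h : IsState ρ) : trace ρ = 1 :=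
  h.hasSum_one.tsum_eq

theorem IsState.exists_difference {m : ℕ} {ρ₀ ρ₁ : H m →L[ℂ] H m} (h₀ : IsState ρ₀)
    (h₁ : IsState ρ₁) : ∃ e f : basisIndex m ⊕ basisIndex m → H m,
      (Summable fun j => ‖e j‖ ^ 2) ∧ (Summable fun j => ‖f j‖ ^ 2) ∧
      ∀ X : H m →L[ℂ] H m, ∑' j, inner ℂ (f j) (X (e j))
        = trace (ρ₀.comp X) - trace (ρ₁.comp X) := by
  obtain ⟨e₀, hs₀, he₀⟩ := h₀.exists_decomposition
  obtain ⟨e₁, hs₁, he₁⟩ := h₁.exists_decomposition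
  -- The minus sign of `ρ₁` is carried by the bra vectors, so that the difference is a single sum `∑
  -- |e j⟩⟨f j|`.
  refine ⟨Sum.elim e₀ e₁, Sum.elim e₀ (fun j => -e₁ j), ?_, ?_, fun X => ?_⟩
  · exact (HasSum.sum (f := fun j => ‖Sum.elim e₀ e₁ j‖ ^ 2) hs₀ hs₁).summable
  · exact (HasSum.sum (f := fun j => ‖Sum.elim e₀ (fun j => -e₁ j) j‖ ^ 2) hs₀
      (by simpa [Function.comp_def] using hs₁)).summable
  · have hs : ∀ {e : basisIndex m → H m}, HasSum (fun j => ‖e j‖ ^ 2) 1 →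
        Summable fun j => inner ℂ (e j) (X (e j)) := fun {e} he =>
      summable_inner (summable_norm_sq_map he.summable X) he.summable
    have h2 := HasSum.sum (f := fun j => inner ℂ (Sum.elim e₀ (fun j => -e₁ j) j)
      (X (Sum.elim e₀ e₁ j))) (hs hs₀).hasSum (b := -∑' j, inner ℂ (e₁ j) (X (e₁ j)))
      (by simpa [Function.comp_def] using (hs hs₁).hasSum.neg)
    rw [h2.tsum_eq, he₀, he₁, sub_eq_add_neg]

/-- Phase point operators are self-adjoint, so the trace against a positive operator is real and
taking the real part in `wigner` loses nothing. -/
theorem IsState.trace_phasePoint {m : ℕ} {ρ : H m →L[ℂ] H m} (h : IsState ρ) (z : Phase m) :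
    trace (ρ.comp (phasePoint z)) = (wigner ρ z : ℂ) := by
  obtain ⟨e, -, he⟩ := h.exists_decomposition
  refine Complex.ext rfl ?_
  rw [Complex.ofReal_im, ← Complex.conj_eq_iff_im, he, Complex.conj_tsum]
  refine tsum_congr fun j => ?_
  rw [inner_conj_symm, inner_phasePoint_left]

/-- Since both states have trace one, the error probability is `1/2 - tr((ρ₀ - ρ₁)(2M - 1))/4`, and
the trace is bounded by the `L¹` distance. -/
theorem le_errorProb {m : ℕ} {ρ₀ ρ₁ M : H m →L[ℂ] H m} (h₀ : IsState ρ₀) (h₁ : IsState ρ₁)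
    (hM : M ∈ wPlus m) (hW : Integrable fun z => wigner ρ₀ z - wigner ρ₁ z) :
    1 / 2 - (∫ z, |wigner ρ₀ z - wigner ρ₁ z|) / 4 ≤ errorProb ρ₀ ρ₁ M := by
  obtain ⟨e, f, he, hf, hef⟩ := h₀.exists_difference h₁
  have key := re_tsum_le_integral_norm he hf hW (fun w => by
    rw [hef, h₀.trace_phasePoint, h₁.trace_phasePoint, Complex.ofReal_sub]) hM
  have hlin : ∑' j, inner ℂ (f j) (((2 : ℂ) • M - 1) (e j))
      = 2 * (trace (ρ₀.comp M) - trace (ρ₁.comp M)) := by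
    have hs : ∀ X : H m →L[ℂ] H m, Summable fun j => inner ℂ (f j) (X (e j)) := fun X =>
      summable_inner (summable_norm_sq_map he X) hf
    have hs1 : Summable fun j => inner ℂ (f j) (e j) := hs 1
    have h1 : ∑' j, inner ℂ (f j) (e j) = trace ρ₀ - trace ρ₁ := hef 1
    simp only [sub_apply, one_apply_eq_self, inner_sub_right, smul_apply, inner_smul_right]
    rw [((hs M).mul_left 2).tsum_sub hs1, tsum_mul_left, hef, h1, h₀.trace_eq_one,
      h₁.trace_eq_one, sub_self, sub_zero]
  have hcomp : trace (ρ₀.comp (1 - M)) = 1 - trace (ρ₀.comp M) := by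
    obtain ⟨e', hs', he'⟩ := h₀.exists_decomposition
    have hs1 : Summable fun j => inner ℂ (e' j) (e' j) := summable_inner hs'.summable hs'.summable
    have h1 : ∑' j, inner ℂ (e' j) (e' j) = trace ρ₀ := (he' 1).symm
    rw [he', he']
    simp only [sub_apply, one_apply_eq_self, inner_sub_right]
    rw [hs1.tsum_sub (summable_inner (summable_norm_sq_map hs'.summable M) hs'.summable), h1,
      h₀.trace_eq_one]
  rw [hlin] at key
  rw [errorProb, hcomp]
  simp only [Complex.mul_re, Complex.sub_re, Complex.re_ofNat, Complex.im_ofNat, zero_mul,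
    sub_zero, Complex.one_re] at key ⊢
  linarith

theorem distNorm_gocc_le {m : ℕ} {ρ₀ ρ₁ : H m →L[ℂ] H m} (h₀ : IsState ρ₀) (h₁ : IsState ρ₁) :
    distNorm (gocc m) ρ₀ ρ₁ ≤ distNorm (wPlus m) ρ₀ ρ₁ := by
  have h : sInf (errorProb ρ₀ ρ₁ '' wPlus m) ≤ sInf (errorProb ρ₀ ρ₁ '' gocc m) := by
    -- The real infimum is monotone only for sets that are bounded below and non-empty; error
    -- probabilities of W+ measurements are non-negative.
    refine csInf_le_csInf ⟨0, ?_⟩ ((gocc_nonempty m).image _)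
      (Set.image_mono (gocc_subset_wPlus m))
    rintro _ ⟨M, hM, rfl⟩
    exact errorProb_nonneg h₀ h₁ hM
  unfold distNorm
  linarith

theorem distNorm_wPlus_le {m : ℕ} {ρ₀ ρ₁ : H m →L[ℂ] H m} (h₀ : IsState ρ₀) (h₁ : IsState ρ₁)
    (hW : Integrable fun z => wigner ρ₀ z - wigner ρ₁ z) :
    distNorm (wPlus m) ρ₀ ρ₁ ≤ ∫ z, |wigner ρ₀ z - wigner ρ₁ z| := by
  have h : 1 / 2 - (∫ z, |wigner ρ₀ z - wigner ρ₁ z|) / 4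
      ≤ sInf (errorProb ρ₀ ρ₁ '' wPlus m) := by
    refine le_csInf (((gocc_nonempty m).mono (gocc_subset_wPlus m)).image _) ?_
    rintro _ ⟨M, hM, rfl⟩
    exact le_errorProb h₀ h₁ hM hW
  unfold distNorm
  linarith

theorem IsState.continuous_wigner {m : ℕ} {ρ : H m →L[ℂ] H m} (h : IsState ρ) :
    Continuous (wigner ρ) := by
  obtain ⟨e, hs, he⟩ := h.exists_decomposition
  have : wigner ρ = fun z => (∑' j, inner ℂ (e j) (phasePoint z (e j))).re := by
    funext z
    rw [wigner, he]
  rw [this]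
  refine Complex.continuous_re.comp (continuous_tsum
    (fun j => continuous_const.inner (continuous_phasePoint (e j)))
    (hs.summable.mul_left (Real.pi ^ m)⁻¹) fun j z => ?_)
  exact (norm_inner_phasePoint_le z _ _).trans (by rw [sq])

end Bosonic

end

/-! ### The chain of inequalities -/

theorem lemma1 (m : ℕ) (ρ₀ ρ₁ : Bosonic.H m →L[ℂ] Bosonic.H m)
    (h₀ : Bosonic.IsState ρ₀) (h₁ : Bosonic.IsState ρ₁) :
    Bosonic.distNorm (Bosonic.gocc m) ρ₀ ρ₁ ≤ Bosonic.distNorm (Bosonic.wPlus m) ρ₀ ρ₁ ∧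
    ENNReal.ofReal (Bosonic.distNorm (Bosonic.wPlus m) ρ₀ ρ₁) ≤
      eLpNorm (fun z => Bosonic.wigner ρ₀ z - Bosonic.wigner ρ₁ z) 1
        (volume : Measure (Bosonic.Phase m)) ∧
    eLpNorm (fun z => Bosonic.wigner ρ₀ z - Bosonic.wigner ρ₁ z) 1
        (volume : Measure (Bosonic.Phase m)) =
      ∫⁻ z : Bosonic.Phase m,
        ENNReal.ofReal |Bosonic.wigner ρ₀ z - Bosonic.wigner ρ₁ z| := by
  have h3 : eLpNorm (fun z => Bosonic.wigner ρ₀ z - Bosonic.wigner ρ₁ z) 1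
      (volume : Measure (Bosonic.Phase m)) = ∫⁻ z : Bosonic.Phase m,
        ENNReal.ofReal |Bosonic.wigner ρ₀ z - Bosonic.wigner ρ₁ z| := by
    rw [eLpNorm_one_eq_lintegral_enorm]
    simp only [Real.enorm_eq_ofReal_abs]
  refine ⟨Bosonic.distNorm_gocc_le h₀ h₁, ?_, h3⟩
  by_cases htop : eLpNorm (fun z => Bosonic.wigner ρ₀ z - Bosonic.wigner ρ₁ z) 1
      (volume : Measure (Bosonic.Phase m)) = ⊤
  · rw [htop]
    exact le_top
  -- Wigner functions of states are continuous, hence measurable, so a finite seminorm already means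
  -- integrability.
  · have hW : Integrable fun z => Bosonic.wigner ρ₀ z - Bosonic.wigner ρ₁ z :=
      memLp_one_iff_integrable.1
        ⟨(h₀.continuous_wigner.sub h₁.continuous_wigner).aestronglyMeasurable, Ne.lt_top htop⟩
    rw [h3, ← ofReal_integral_eq_lintegral_ofReal hW.abs
      (Filter.Eventually.of_forall fun z => abs_nonneg _)]
    exact ENNReal.ofReal_le_ofReal (Bosonic.distNorm_wPlus_le h₀ h₁ hW)
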